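/- Let $\beta\ge 0$, $\eta>0$ and $s>-\tfrac12$. Let $\mathbb T=\mathbb R/2\pi\mathbb Z$, and let $H^s(\mathbb T)$ be the Sobolev space of real-valued periodic distributions with norm $\|\phi\|_{H^s}=(2\pi)^{1/2}\|(1+k^2)^{s/2}\widehat\phi(k)\|_{\ell^2(\mathbb Z)}$, where $\widehat\phi(k)=\frac1{2\pi}\int_{-\pi}^{\pi}e^{-ikz}\phi(z)\,dz$; write $L^2=H^0$ and $H^\infty=\bigcap_r H^r$. For $t\ge0$ let $S(t)$ be the Fourier multiplier $\widehat{S(t)f}(k)=e^{t(iq(k)-p(k))}\widehat f(k)$ with $q(k)=\beta k|k|$ and $p(k)=\eta(k^2-|k|)$, and consider the integral form $$u(t)=S(t)\phi-\int_0^tS(t-t')[u(t')u_x(t')]\,dt' ,\qquad u u_x=\tfrac12\partial_x(u^2),\tag{1}$$ of the Chen–Lee equation $u_t+uu_x+\beta\mathcal H u_{xx}+\eta(\mathcal H u_x-u_{xx})=0$, $u(0)=\phi$, where the Hilbert transform $\mathcal H$ is normalised so that this semigroup is the one generated by the linear part. For $T>0$ let $\mathfrak X_T^s=C([0,T];H^s(\mathbb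 T))$ if $s\ge0$, and, if $s<0$, let $\mathfrak X_T^s$ be the space of all $u\in C([0,T];H^s(\mathbb T))$ with $$\|u\|_{\mathfrak X_T^s}=\sup_{t\in(0,T]}\bigl(\|u(t)\|_{H^s}+t^{|s|/2}\|u(t)\|_{L^2}\bigr)<\infty .$$ For $\phi\in H^s(\mathbb T)$ and $T>0$, say that the local conclusions hold for $(\phi,T)$ if there is an open neighbourhood $B$ of $\phi$ in $H^s(\mathbb T)$ such that (a) for every $\psi\in B$ equation (1) with initial value $\psi$ has a solution $u_\psi$ on $[0,T]$ in $C([0,T];H^s(\mathbb T))\cap C((0,T];H^\infty(\mathbb T))\cap\mathfrak X_T^s$, and it is the only solution in $C([0,T];H^s(\mathbb T))\cap C((0,T);H^\infty(\mathbb T))$ and the only solution in $\mathfrak X_T^s$; (b) the flow map $\psi\mapsto u_\psi$ is $C^\infty$ from $B$ to $C([0,T];H^s(\mathbb T))\cap C((0,T];H^\infty(\mathbb T))\cap\mathfrak X_T^s$ (for $C((0,T];H^\infty(\mathbb T))$ this means: into $C([\varepsilon,T];H^r(\mathbb T))$ for all $\varepsilon>0$ and $r\in\mathbb R$). Then for every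 $\phi\in H^s(\mathbb T)$ the supremum of all $T>0$ for which the local conclusions hold for $(\phi,T)$ is $+\infty$. Moreover, for every $T>0$, (a) and (b) hold with $B=H^s(\mathbb T)$. -/

import Mathlib

open Set MeasureTheory
open scoped ContDiff ENNReal Topology

noncomputable section

namespace ChenLee

/-! ### Sobolev spaces on the circle `𝕋 = ℝ / 2πℤ`

A periodic distribution is given by its sequence of Fourier coefficients
`f̂ k = (2π)⁻¹ ∫_{-π}^{π} exp (-i k z) f z dz`, `k ∈ ℤ`; it is real-valued exactly if
`f̂ (-k)` is the complex conjugate of `f̂ k` for all `k`. -/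

/-- The sequence `(2π)^{1/2} (1 + k²)^{s/2} f̂ k`, whose `ℓ²(ℤ)` norm is the `H^s` norm. -/
def weighted (s : ℝ) (f : ℤ → ℂ) : ℤ → ℂ :=
  fun k => ((Real.sqrt (2 * Real.pi) * (1 + (k : ℝ) ^ 2) ^ (s / 2) : ℝ) : ℂ) * f k

lemma weighted_add (s : ℝ) (f g : ℤ → ℂ) :
    weighted s (f + g) = weighted s f + weighted s g := by
  funext k; simp [weighted, mul_add]

lemma weighted_smul (s : ℝ) (c : ℝ) (f : ℤ → ℂ) :
    weighted s (c • f) = c • weighted s f := by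
  funext k; simp [weighted]; ring

/-- The real-valued periodic distributions with finite `H^s` norm, as a real vector space. -/
def hsSubmodule (s : ℝ) : Submodule ℝ (ℤ → ℂ) where
  carrier := {f | Memℓp (weighted s f) 2 ∧ ∀ k, f (-k) = (starRingEnd ℂ) (f k)}
  add_mem' := by
    rintro f g ⟨hf, hf'⟩ ⟨hg, hg'⟩
    refine ⟨?_, fun k => ?_⟩
    · rw [weighted_add]; exact hf.add hg
    · simp [hf' k, hg' k]
  zero_mem' := by
    refine ⟨?_, fun k => by simp⟩
    have : weighted s 0 = 0 := by funext k; simp [weighted]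
    rw [this]; exact zero_memℓp
  smul_mem' := by
    rintro c f ⟨hf, hf'⟩
    refine ⟨?_, fun k => ?_⟩
    · rw [weighted_smul]; exact hf.const_smul c
    · simp [hf' k]

/-- The real Sobolev space `H^s(𝕋)`; in particular `Hs 0` is the real `L²(𝕋)`. -/
def Hs (s : ℝ) : Type := hsSubmodule s

instance (s : ℝ) : AddCommGroup (Hs s) := inferInstanceAs (AddCommGroup (hsSubmodule s))
instance (s : ℝ) : Module ℝ (Hs s) := inferInstanceAs (Module ℝ (hsSubmodule s))

/-- The Fourier coefficients of an element of `H^s(𝕋)`. -/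
def Hs.coeff {s : ℝ} : Hs s →ₗ[ℝ] (ℤ → ℂ) := (hsSubmodule s).subtype

lemma Hs.coeff_injective {s : ℝ} : Function.Injective (Hs.coeff (s := s)) :=
  Subtype.val_injective

lemma Hs.coeff_mem {s : ℝ} (f : Hs s) : f.coeff ∈ hsSubmodule s := f.2

/-- The map `f ↦ ((2π)^{1/2} (1 + k²)^{s/2} f̂ k)_k` from `H^s(𝕋)` to `ℓ²(ℤ)`. -/
def Hs.toLp (s : ℝ) : Hs s →ₗ[ℝ] lp (fun _ : ℤ => ℂ) 2 where
  toFun f := ⟨weighted s f.coeff, f.2.1⟩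
  map_add' f g := by
    apply Subtype.ext
    simp only [map_add, weighted_add]; rfl
  map_smul' c f := by
    apply Subtype.ext
    simp only [map_smul, weighted_smul]; rfl

lemma Hs.toLp_injective (s : ℝ) : Function.Injective (Hs.toLp s) := by
  intro f g h
  apply Hs.coeff_injective
  funext k
  have h1 : weighted s f.coeff k = weighted s g.coeff k :=
    congrFun (congrArg Subtype.val h) k
  have h2 : (Real.sqrt (2 * Real.pi) * (1 + (k : ℝ) ^ 2) ^ (s / 2)) ≠ 0 := by positivity
  exact mul_left_cancel₀ (Complex.ofReal_ne_zero.mpr h2) h1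

/-- `‖f‖_{H^s} = (2π)^{1/2} ‖(1 + k²)^{s/2} f̂ k‖_{ℓ²(ℤ)}`. -/
instance (s : ℝ) : NormedAddCommGroup (Hs s) :=
  NormedAddCommGroup.induced (Hs s) (lp (fun _ : ℤ => ℂ) 2) (Hs.toLp s) (Hs.toLp_injective s)

instance (s : ℝ) : NormedSpace ℝ (Hs s) :=
  NormedSpace.induced ℝ (Hs s) (lp (fun _ : ℤ => ℂ) 2) (Hs.toLp s)

/-! ### Spaces of functions of time -/

/-- The positive times. -/
abbrev PosTime : Type := {T : ℝ // 0 < T}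

/-- The Banach space `C([0,T]; H^s(𝕋))` with the supremum norm. -/
abbrev Curve (s : ℝ) (T : PosTime) : Type := C(Icc (0 : ℝ) T.1, Hs s)

/-- A time in `(0,T]`, as an element of `[0,T]`. -/
def posToIcc {T : PosTime} (t : Ioc (0 : ℝ) T.1) : Icc (0 : ℝ) T.1 :=
  ⟨t.1, t.2.1.le, t.2.2⟩

/-- For `t ∈ (0,T]`, the pair `(u t, t^{|s|/2} w t)` in `H^s × L²`, the latter with the
norm `‖(a, b)‖ = ‖a‖_{H^s} + ‖b‖_{L²}`. -/
def xPair (s : ℝ) (T : PosTime) :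
    (Curve s T × (Ioc (0 : ℝ) T.1 → Hs 0)) →ₗ[ℝ]
      (Ioc (0 : ℝ) T.1 → WithLp 1 (Hs s × Hs 0)) where
  toFun p t := WithLp.toLp 1 (p.1 (posToIcc t), ((t : ℝ) ^ (|s| / 2)) • p.2 t)
  map_add' p q := by
    funext t
    simp only [Prod.fst_add, Prod.snd_add, ContinuousMap.add_apply, Pi.add_apply, smul_add]
    rfl
  map_smul' c p := by
    funext t
    simp only [Prod.smul_fst, Prod.smul_snd, ContinuousMap.smul_apply, Pi.smul_apply,
      RingHom.id_apply, smul_comm _ c]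
    rfl

/-- The curves `u ∈ C([0,T]; H^s(𝕋))` with `u t ∈ L²` for `t ∈ (0,T]` and
`sup_{t ∈ (0,T]} (‖u t‖_{H^s} + t^{|s|/2} ‖u t‖_{L²}) < ∞`. An element is a pair `(u, w)`,
where `w t` is `u t` regarded as an element of `L²` (so `w` is determined by `u`). -/
def xSubmodule (s : ℝ) (T : PosTime) :
    Submodule ℝ (Curve s T × (Ioc (0 : ℝ) T.1 → Hs 0)) where
  carrier := {p | (∀ t, (p.2 t).coeff = (p.1 (posToIcc t)).coeff) ∧ Memℓp (xPair s T p) ∞}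
  add_mem' := by
    rintro p q ⟨hp, hp'⟩ ⟨hq, hq'⟩
    refine ⟨fun t => ?_, ?_⟩
    · simp [hp t, hq t]
    · rw [map_add]; exact hp'.add hq'
  zero_mem' := by
    refine ⟨fun t => by simp, ?_⟩
    rw [map_zero]; exact zero_memℓp
  smul_mem' := by
    rintro c p ⟨hp, hp'⟩
    refine ⟨fun t => ?_, ?_⟩
    · simp [hp t]
    · rw [map_smul]; exact hp'.const_smul c

/-- The space `X_T^s`. -/
def XSpace (s : ℝ) (T : PosTime) : Type := xSubmodule s T

instance (s : ℝ) (T : PosTime) : AddCommGroup (XSpace s T) :=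
  inferInstanceAs (AddCommGroup (xSubmodule s T))
instance (s : ℝ) (T : PosTime) : Module ℝ (XSpace s T) :=
  inferInstanceAs (Module ℝ (xSubmodule s T))

/-- An element of `X_T^s` as a curve in `C([0,T]; H^s(𝕋))`. -/
def XSpace.toCurve {s : ℝ} {T : PosTime} (u : XSpace s T) : Curve s T := u.1.1

/-- The map `u ↦ (t ↦ (u t, t^{|s|/2} u t))` from `X_T^s` to the bounded functions on `(0,T]`
with values in `H^s × L²`. -/
def XSpace.toLp (s : ℝ) (T : PosTime) :
    XSpace s T →ₗ[ℝ] lp (fun _ : Ioc (0 : ℝ) T.1 => WithLp 1 (Hs s × Hs 0)) ∞ where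
  toFun u := ⟨xPair s T u.1, u.2.2⟩
  map_add' u v := Subtype.ext (map_add (xPair s T) u.1 v.1)
  map_smul' c u := Subtype.ext (map_smul (xPair s T) c u.1)

lemma XSpace.toLp_injective (s : ℝ) (T : PosTime) :
    Function.Injective (XSpace.toLp s T) := by
  rw [injective_iff_map_eq_zero]
  intro u hu
  have h1 : ∀ t : Ioc (0 : ℝ) T.1, u.1.1 (posToIcc t) = 0 := fun t => by
    have h := congrFun (congrArg Subtype.val hu) t
    exact congrArg (fun z : WithLp 1 (Hs s × Hs 0) => z.fst) h
  have h2 : u.1.1 = 0 := by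
    have hd : Dense {t : Icc (0 : ℝ) T.1 | 0 < t.1} := by
      intro t
      rw [mem_closure_iff_seq_limit]
      refine ⟨fun n => ⟨t.1 + (T.1 - t.1) / (n + 2), ?_⟩, ?_, ?_⟩
      · have h0 := t.2.1
        have hT := t.2.2
        have h3 : 0 ≤ (T.1 - t.1) / ((n : ℝ) + 2) := div_nonneg (by linarith) (by positivity)
        have h4 : (T.1 - t.1) / ((n : ℝ) + 2) ≤ T.1 - t.1 :=
          div_le_self (by linarith) (by linarith [Nat.cast_nonneg (α := ℝ) n])
        exact ⟨by linarith, by linarith⟩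
      · intro n
        have hT := t.2.2
        change 0 < t.1 + (T.1 - t.1) / ((n : ℝ) + 2)
        rcases eq_or_lt_of_le t.2.1 with h | h
        · rw [← h]; have := T.2
          simp only [zero_add, sub_zero]; positivity
        · have h3 : 0 ≤ (T.1 - t.1) / ((n : ℝ) + 2) := div_nonneg (by linarith) (by positivity)
          linarith
      · rw [tendsto_subtype_rng]
        have h5 : Filter.Tendsto (fun n : ℕ => (T.1 - t.1) / ((n : ℝ) + 2)) Filter.atTop (𝓝 0) :=
          Filter.Tendsto.div_atTop tendsto_const_nhds
            (Filter.tendsto_atTop_add_const_right _ _ tendsto_natCast_atTop_atTop)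
        simpa using h5.const_add t.1
    apply ContinuousMap.coe_injective
    refine Continuous.ext_on hd u.1.1.continuous continuous_const ?_
    intro t ht
    exact h1 ⟨t.1, ht, t.2.2⟩
  have h3 : u.1.2 = 0 := by
    funext t
    apply Hs.coeff_injective
    rw [u.2.1 t, h2]
    simp
  exact Subtype.ext (Prod.ext h2 h3)

/-- `‖u‖_{X_T^s} = sup_{t ∈ (0,T]} (‖u t‖_{H^s} + t^{|s|/2} ‖u t‖_{L²})`. -/
instance (s : ℝ) (T : PosTime) : NormedAddCommGroup (XSpace s T) :=
  NormedAddCommGroup.induced (XSpace s T) _ (XSpace.toLp s T) (XSpace.toLp_injective s T)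

instance (s : ℝ) (T : PosTime) : NormedSpace ℝ (XSpace s T) :=
  NormedSpace.induced ℝ (XSpace s T) _ (XSpace.toLp s T)

/-- Membership in `𝔛_T^s`, which is `X_T^s` for `s < 0` and `C([0,T]; H^s(𝕋))` for `s ≥ 0`. -/
def InFrakX {s : ℝ} {T : PosTime} (u : Curve s T) : Prop :=
  s < 0 → ∃ v : XSpace s T, v.toCurve = u

/-- `u ∈ C(J; H^∞(𝕋))`: for every `r`, the restriction of `u` to the times in `J` takes values
in `H^r(𝕋)` and is continuous for the `H^r` norm. -/
def ContHInfty {s : ℝ} {T : PosTime} (J : Set ℝ) (u : Curve s T) : Prop :=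
  ∀ r : ℝ, ∃ w : C({t : Icc (0 : ℝ) T.1 // t.1 ∈ J}, Hs r),
    ∀ t, (w t).coeff = (u t.1).coeff

/-! ### The integral equation -/

/-- `i q(k) - p(k)` with `q(k) = β k |k|` and `p(k) = η (k² - |k|)`: the Fourier symbol of
`-(β 𝓗 ∂ₓ² + η (𝓗 ∂ₓ - ∂ₓ²))`. The semigroup `S t` multiplies the `k`-th Fourier coefficient
by `exp (t (i q(k) - p(k)))`. -/
def symbol (β η : ℝ) (k : ℤ) : ℂ :=
  Complex.I * ((β * k * |(k : ℝ)| : ℝ) : ℂ) - ((η * ((k : ℝ) ^ 2 - |(k : ℝ)|) : ℝ) : ℂ)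

/-- The `k`-th Fourier coefficient of `f f_x = ½ ∂ₓ (f²)` for `f ∈ L²(𝕋)`. -/
def nonlin (f : ℤ → ℂ) (k : ℤ) : ℂ :=
  Complex.I * (k : ℂ) / 2 * ∑' j : ℤ, f j * f (k - j)

/-- The integrand `S(t - t') [u(t') u_x(t')]` (its `k`-th Fourier coefficient), for
`t' ∈ [0,T]`. -/
def duhamelIntegrand (β η : ℝ) {s : ℝ} {T : PosTime} (u : Curve s T) (t : ℝ) (k : ℤ)
    (t' : ℝ) : ℂ :=
  Complex.exp (((t - t' : ℝ) : ℂ) * symbol β η k) *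
    nonlin (IccExtend T.2.le u t').coeff k

/-- `u` solves `u(t) = S(t) φ - ∫_0^t S(t - t') [u(t') u_x(t')] dt'` on `[0,T]`, as an identity
between periodic distributions; `u(t)²` makes sense because `u t ∈ L²` for `0 < t < T`. -/
def IsSolution (β η : ℝ) {s : ℝ} {T : PosTime} (φ : Hs s) (u : Curve s T) : Prop :=
  (∀ t : Icc (0 : ℝ) T.1, t.1 ∈ Ioo 0 T.1 → (u t).coeff ∈ hsSubmodule 0) ∧
  ∀ (t : Icc (0 : ℝ) T.1) (k : ℤ),
    IntervalIntegrable (duhamelIntegrand β η u t.1 k) volume 0 t.1 ∧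
    (u t).coeff k = Complex.exp ((t.1 : ℂ) * symbol β η k) * φ.coeff k
      - ∫ t' in (0 : ℝ)..t.1, duhamelIntegrand β η u t.1 k t'

/-- `u` is the solution with initial value `φ` on `[0,T]`: it solves the integral equation and
lies in `C([0,T]; H^s) ∩ C((0,T]; H^∞) ∩ 𝔛_T^s`, and it is the only solution in
`C([0,T]; H^s) ∩ C((0,T); H^∞)` as well as the only solution in `𝔛_T^s`. -/
def IsTheSolution (β η : ℝ) {s : ℝ} {T : PosTime} (φ : Hs s) (u : Curve s T) : Prop :=
  IsSolution β η φ u ∧ ContHInfty (Ioc 0 T.1) u ∧ InFrakX u ∧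
  ∀ v : Curve s T, IsSolution β η φ v → (ContHInfty (Ioo 0 T.1) v ∨ InFrakX v) → v = u

/-- The flow map `φ ↦ u` exists on the set `B` of initial data up to time `T`, and it is smooth
from `B` to `C([0,T]; H^s) ∩ C((0,T]; H^∞) ∩ 𝔛_T^s`. As `C((0,T]; H^∞)` is the projective
limit of the Banach spaces `C([ε,T]; H^r)`, `ε > 0`, `r ∈ ℝ`, smoothness into it is smoothness
into each of them. -/
def SmoothFlowOn (β η s : ℝ) (T : PosTime) (B : Set (Hs s)) : Prop :=
  ∃ Φ : Hs s → Curve s T,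
    (∀ φ ∈ B, IsTheSolution β η φ (Φ φ)) ∧
    ContDiffOn ℝ ∞ Φ B ∧
    (s < 0 → ∃ Ψ : Hs s → XSpace s T,
      ContDiffOn ℝ ∞ Ψ B ∧ ∀ φ ∈ B, (Ψ φ).toCurve = Φ φ) ∧
    ∀ ε r : ℝ, 0 < ε → ∃ Ψ : Hs s → C(Icc ε T.1, Hs r),
      ContDiffOn ℝ ∞ Ψ B ∧
      ∀ φ ∈ B, ∀ (t : ℝ) (h : t ∈ Icc 0 T.1) (h' : t ∈ Icc ε T.1),
        (Ψ φ ⟨t, h'⟩).coeff = (Φ φ ⟨t, h⟩).coeff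

/-- The conclusions of the local well-posedness theorem for the initial value `φ` and the time
`T`: the flow map exists up to time `T` and is smooth on an open neighbourhood of `φ`. -/
def LocalConclusions (β η : ℝ) {s : ℝ} (φ : Hs s) (T : PosTime) : Prop :=
  ∃ B : Set (Hs s), IsOpen B ∧ φ ∈ B ∧ SmoothFlowOn β η s T B

end ChenLee

end

/-!
The linear part of the equation is a Fourier multiplier with real part `-η (k² - |k|) ≤ 0`, and the
whole proof works with one Fourier coefficient at a time. If `f t'` and `g t'` have `H^r` norms
whose product is at most `K (t' - a)^{-σ}`, with `r ≥ 0` and `σ < 1`, then the `k`-th coefficient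
of the Duhamel integral of `½ ∂ₓ (f g)` is bounded by an explicit power of `t - a` times a power of
`1 + k²` (`norm_duh_le`). Every mapping property needed, in time-weighted `L²`, in `H^s` and in the
smoothing steps, is a consequence of this bound by choosing exponents, and continuity in time
follows by dominated convergence from the continuity of the coefficients
(`exists_bilinear_of_dominated`).

Let `σ = max 0 (-s) < 1/2`. A solution is written as `u t = t^{-σ/2} w t` with `w` bounded and
continuous from `(0,T]` to `L²`, and the equation becomes `w + B(w,w) = L φ` with a bounded
bilinear `B` and a bounded linear `L`. The bound also allows a factor `e^{l(t - a)}` and then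
gains a negative power of `l`; so every derivative `h ↦ h + B(w,h) + B(h,w)` is invertible, being
conjugate to a perturbation of the identity of norm less than one (`isUnit_linearization`). For the
same reason `w ↦ w + B(w,w)` is injective. By the inverse function theorem, the flow is then a
smooth function of `φ` wherever it exists (`contDiff_of_nonlinMap_eq`), which includes the whole
interval `[0,T]` as soon as solutions exist there.

Global existence comes from a cutoff (`exists_cutoff_solution`): with the argument of `B` replaced
by its radial projection to a ball of a time-dependent radius, the right-hand side is globally
Lipschitz, and a contraction for an exponentially weighted norm solves the modified equation on
`[0,T]`. The solution never meets the cutoff (`norm_ev_le_of_cutoff`): for small times because of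
the positive power of `t` in the bound, afterwards because the `L²` norm does not grow
(`tsum_sq_le_of_mild`). The latter rests on the cancellation `∫ u · u u_x = 0`, which is legitimate
because solutions are smooth for positive times: restarting the equation gains a quarter of a
derivative, and the step is repeated (`exists_contDiff_curve`). The same iteration gives the
smoothness of the flow with values in `C([ε,T]; H^r)`.

A solution in `C((0,T); H^∞)` has no a priori bound at `t = 0`. Started at time `d > 0`, however, it
is bounded in `L²` and hence equal to the flow applied to `u d`; the continuity of the flow in the
initial value permits the limit `d → 0` (`coeff_eq_of_continuousOn`).
-/

noncomputable section

namespace ChenLee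

open scoped BoundedContinuousFunction

/-! ### Japanese bracket weights -/

/-- The Sobolev weight `(1 + k²)^{r/2}`. -/
def wt (r : ℝ) (k : ℤ) : ℝ := (1 + (k : ℝ) ^ 2) ^ (r / 2)

lemma wt_pos (r : ℝ) (k : ℤ) : 0 < wt r k := by unfold wt; positivity

lemma wt_add (r r' : ℝ) (k : ℤ) : wt (r + r') k = wt r k * wt r' k := by
  unfold wt
  rw [← Real.rpow_add (by positivity)]
  congr 1; ring

lemma wt_zero (k : ℤ) : wt 0 k = 1 := by simp [wt]

lemma wt_neg_mul_self (r : ℝ) (k : ℤ) : wt (-r) k * wt r k = 1 := by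
  rw [← wt_add, neg_add_cancel, wt_zero]

lemma wt_neg_arg (r : ℝ) (k : ℤ) : wt r (-k) = wt r k := by simp [wt]

lemma wt_mono {r r' : ℝ} (h : r ≤ r') (k : ℤ) : wt r k ≤ wt r' k := by
  unfold wt
  exact Real.rpow_le_rpow_of_exponent_le (by nlinarith [sq_nonneg (k : ℝ)]) (by linarith)

lemma abs_le_wt_one (k : ℤ) : |(k : ℝ)| ≤ wt 1 k := by
  unfold wt
  rw [← Real.sqrt_eq_rpow]
  apply Real.abs_le_sqrt; linarith

/-- Peetre's inequality. -/
lemma wt_le_mul {r : ℝ} (hr : 0 ≤ r) (k j : ℤ) :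
    wt r k ≤ 2 ^ (r / 2) * (wt r j * wt r (k - j)) := by
  unfold wt
  rw [← Real.mul_rpow (by positivity) (by positivity),
    ← Real.mul_rpow (by positivity) (by positivity)]
  apply Real.rpow_le_rpow (by positivity) _ (by linarith)
  push_cast
  nlinarith [sq_nonneg ((k : ℝ) - 2 * j), sq_nonneg ((j : ℝ) * (k - j))]

lemma summable_wt {q : ℝ} (hq : 1 < q) : Summable (fun k : ℤ => wt (-q) k) := by
  refine Summable.of_norm_bounded_eventually (Real.summable_abs_int_rpow hq) ?_
  have h0 : ∀ᶠ k : ℤ in Filter.cofinite, k ≠ 0 := by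
    simpa using (Set.finite_singleton (0 : ℤ)).compl_mem_cofinite
  filter_upwards [h0] with k hk
  have hk' : 0 < |(k : ℝ)| := by positivity
  rw [Real.norm_of_nonneg (wt_pos _ _).le]
  unfold wt
  have : |(k : ℝ)| ^ (-q) = (|(k : ℝ)| ^ (2 : ℝ)) ^ (-q / 2) := by
    rw [← Real.rpow_mul hk'.le]; congr 1; ring
  rw [this]
  apply Real.rpow_le_rpow_of_nonpos (by positivity) _ (by linarith)
  rw [Real.rpow_two, sq_abs]; linarith

/-! ### The Sobolev norm -/

/-- The element of `H^s(𝕋)` with given Fourier coefficients. -/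
def Hs.mk {s : ℝ} (f : ℤ → ℂ) (hf : f ∈ hsSubmodule s) : Hs s := ⟨f, hf⟩

@[simp] lemma Hs.coeff_mk {s : ℝ} (f : ℤ → ℂ) (hf : f ∈ hsSubmodule s) :
    (Hs.mk f hf).coeff = f := rfl

lemma Hs.coeff_neg {s : ℝ} (f : Hs s) (k : ℤ) :
    f.coeff (-k) = (starRingEnd ℂ) (f.coeff k) := f.2.2 k

lemma norm_weighted (s : ℝ) (f : ℤ → ℂ) (k : ℤ) :
    ‖weighted s f k‖ = √(2 * Real.pi) * wt s k * ‖f k‖ := by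
  unfold weighted
  rw [norm_mul, Complex.norm_real, Real.norm_of_nonneg (by positivity)]
  rfl

lemma memℓp_weighted_iff (s : ℝ) (f : ℤ → ℂ) :
    Memℓp (weighted s f) 2 ↔ Summable (fun k => (wt s k * ‖f k‖) ^ 2) := by
  rw [memℓp_gen_iff (by norm_num)]
  have : (fun k => ‖weighted s f k‖ ^ (2 : ℝ≥0∞).toReal) =
      fun k => (2 * Real.pi) * (wt s k * ‖f k‖) ^ 2 := by
    funext k
    rw [norm_weighted, ENNReal.toReal_ofNat, Real.rpow_two, mul_assoc, mul_pow,
      Real.sq_sqrt (by positivity)]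
  rw [this, summable_mul_left_iff (by positivity)]

lemma Hs.summable_sq {s : ℝ} (f : Hs s) : Summable (fun k => (wt s k * ‖f.coeff k‖) ^ 2) :=
  (memℓp_weighted_iff s _).1 f.2.1

lemma Hs.norm_sq_eq {s : ℝ} (f : Hs s) :
    ‖f‖ ^ 2 = 2 * Real.pi * ∑' k, (wt s k * ‖f.coeff k‖) ^ 2 := by
  have h1 : ‖f‖ = ‖Hs.toLp s f‖ := rfl
  have h2 := lp.norm_rpow_eq_tsum (p := 2) (by norm_num) (Hs.toLp s f)
  rw [ENNReal.toReal_ofNat, Real.rpow_two] at h2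
  rw [h1, h2, ← tsum_mul_left]
  congr 1
  funext k
  have h3 : (Hs.toLp s f : ℤ → ℂ) k = weighted s f.coeff k := rfl
  rw [h3, norm_weighted, Real.rpow_two, mul_assoc, mul_pow, Real.sq_sqrt (by positivity)]

lemma Hs.coeff_bound {s : ℝ} (f : Hs s) (k : ℤ) : wt s k * ‖f.coeff k‖ ≤ ‖f‖ := by
  apply le_of_sq_le_sq _ (norm_nonneg _)
  rw [Hs.norm_sq_eq]
  have h1 := f.summable_sq.le_tsum k (fun j _ => sq_nonneg _)
  have h2 : 0 ≤ ∑' k, (wt s k * ‖f.coeff k‖) ^ 2 := tsum_nonneg fun _ => sq_nonneg _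
  nlinarith [Real.pi_gt_three]

lemma Hs.norm_coeff_le {s : ℝ} (f : Hs s) (k : ℤ) : ‖f.coeff k‖ ≤ ‖f‖ * wt (-s) k := by
  have h := mul_le_mul_of_nonneg_left (f.coeff_bound k) (wt_pos (-s) k).le
  rw [← mul_assoc, wt_neg_mul_self, one_mul] at h
  linarith

lemma Hs.tsum_sq_le {s : ℝ} (f : Hs s) :
    ∑' k, (wt s k * ‖f.coeff k‖) ^ 2 ≤ ‖f‖ ^ 2 := by
  rw [Hs.norm_sq_eq]
  have h2 : 0 ≤ ∑' k, (wt s k * ‖f.coeff k‖) ^ 2 := tsum_nonneg fun _ => sq_nonneg _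
  nlinarith [Real.pi_gt_three]

lemma mem_hsSubmodule_of_dominated {s : ℝ} {f : ℤ → ℂ}
    (hf : ∀ k, f (-k) = (starRingEnd ℂ) (f k)) (d : Hs s)
    (h : ∀ k, ‖f k‖ ≤ ‖d.coeff k‖) : f ∈ hsSubmodule s := by
  refine ⟨(memℓp_weighted_iff s f).2 ?_, hf⟩
  refine d.summable_sq.of_nonneg_of_le (fun k => sq_nonneg _) fun k => ?_
  have := wt_pos s k
  gcongr
  exact h k

lemma Hs.norm_le_of_dominated {s : ℝ} (f d : Hs s)
    (h : ∀ k, ‖f.coeff k‖ ≤ ‖d.coeff k‖) : ‖f‖ ≤ ‖d‖ := by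
  apply le_of_sq_le_sq _ (norm_nonneg _)
  rw [Hs.norm_sq_eq, Hs.norm_sq_eq]
  gcongr with k
  · exact f.summable_sq
  · exact d.summable_sq
  · exact mul_nonneg (wt_pos s k).le (norm_nonneg _)
  · exact (wt_pos s k).le
  · exact h k

/-- Dominated convergence: a map into `H^s(𝕋)` whose Fourier coefficients are continuous and
locally dominated by those of a fixed element is continuous. -/
lemma Hs.continuousAt_of_dominated {X : Type*} [TopologicalSpace X] {s : ℝ} {F : X → Hs s}
    {x : X} (hc : ∀ k, ContinuousAt (fun y => (F y).coeff k) x) (d : Hs s)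
    (hd : ∀ᶠ y in 𝓝 x, ∀ k, ‖(F y).coeff k‖ ≤ ‖d.coeff k‖) : ContinuousAt F x := by
  have key : Filter.Tendsto (fun y => ‖F y - F x‖ ^ 2) (𝓝 x) (𝓝 0) := by
    have h0 : (0 : ℝ) = 2 * Real.pi * ∑' k : ℤ, (0 : ℝ) := by simp
    rw [h0]
    simp_rw [Hs.norm_sq_eq]
    refine Filter.Tendsto.const_mul _ ?_
    refine tendsto_tsum_of_dominated_convergence (bound := fun k => 4 * (wt s k * ‖d.coeff k‖) ^ 2)
      (d.summable_sq.mul_left 4) ?_ ?_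
    · intro k
      have h1 : Filter.Tendsto (fun y => (F y).coeff k - (F x).coeff k) (𝓝 x) (𝓝 0) := by
        have := (hc k).tendsto.sub_const ((F x).coeff k)
        simpa using this
      have h2 := ((h1.norm.const_mul (wt s k)).pow 2)
      simpa using h2
    · filter_upwards [hd] with y hy k
      rw [Real.norm_of_nonneg (sq_nonneg _)]
      have h1 : ‖(F y - F x).coeff k‖ ≤ 2 * ‖d.coeff k‖ := by
        rw [map_sub, Pi.sub_apply]
        have := norm_sub_le ((F y).coeff k) ((F x).coeff k)
        linarith [hy k, hd.self_of_nhds k]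
      have := wt_pos s k
      calc (wt s k * ‖(F y - F x).coeff k‖) ^ 2 ≤ (wt s k * (2 * ‖d.coeff k‖)) ^ 2 := by gcongr
        _ = _ := by ring
  rw [ContinuousAt, tendsto_iff_norm_sub_tendsto_zero]
  have h3 := key.sqrt
  simpa [Real.sqrt_sq_eq_abs] using h3

lemma Hs.continuous_coeff {s : ℝ} (k : ℤ) : Continuous (fun f : Hs s => f.coeff k) := by
  have h : LipschitzWith (Real.toNNReal (wt (-s) k)) (fun f : Hs s => f.coeff k) := by
    apply LipschitzWith.of_dist_le_mul
    intro f g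
    rw [dist_eq_norm, dist_eq_norm, Real.coe_toNNReal _ (wt_pos _ _).le]
    have := (f - g).norm_coeff_le k
    rw [map_sub, Pi.sub_apply] at this
    linarith
  exact h.continuous

instance instCompleteSpaceHs (s : ℝ) : CompleteSpace (Hs s) := by
  have hi : Isometry (Hs.toLp s) := fun _ _ => rfl
  rw [completeSpace_iff_isComplete_range hi.isUniformInducing]
  apply IsClosed.isComplete
  have hr : range (Hs.toLp s) = {g : lp (fun _ : ℤ => ℂ) 2 |
      ∀ k, g (-k) = (starRingEnd ℂ) (g k)} := by
    ext g
    constructor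
    · rintro ⟨f, rfl⟩ k
      have h1 : ∀ k, (Hs.toLp s f) k = weighted s f.coeff k := fun k => rfl
      rw [h1, h1]
      simp [weighted, f.coeff_neg k]
    · intro hg
      have hne : ∀ k : ℤ, ((√(2 * Real.pi) * (1 + (k : ℝ) ^ 2) ^ (s / 2) : ℝ) : ℂ) ≠ 0 := by
        intro k
        have : (√(2 * Real.pi) * (1 + (k : ℝ) ^ 2) ^ (s / 2)) ≠ 0 := by positivity
        exact Complex.ofReal_ne_zero.2 this
      let f : ℤ → ℂ := fun k => ((√(2 * Real.pi) * (1 + (k : ℝ) ^ 2) ^ (s / 2) : ℝ) : ℂ)⁻¹ * g k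
      have hw : weighted s f = g := by
        funext k
        simp only [weighted, f]
        rw [mul_inv_cancel_left₀ (hne k)]
      have hf : f ∈ hsSubmodule s := by
        refine ⟨by rw [hw]; exact g.2, fun k => ?_⟩
        simp only [f, hg k, map_mul, map_inv₀, Complex.conj_ofReal]
        simp
      exact ⟨Hs.mk f hf, Subtype.ext hw⟩
  rw [hr, Set.ofPred_forall]
  have hcont : ∀ k : ℤ, Continuous (fun g : lp (fun _ : ℤ => ℂ) 2 => g k) := fun k =>
    (continuous_apply k).comp lp.uniformContinuous_coe.continuous
  exact isClosed_iInter fun k => isClosed_eq (hcont (-k)) (Complex.continuous_conj.comp (hcont k))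

/-- Multiplication of the Fourier coefficients by `(1 + k²)^{(r - r')/2}`, an isometry of `H^r`
onto `H^{r'}`. -/
def Hs.shift {r : ℝ} (r' : ℝ) (f : Hs r) : Hs r' :=
  Hs.mk (fun k => (wt (r - r') k : ℂ) * f.coeff k) <| by
    refine ⟨(memℓp_weighted_iff _ _).2 ?_, fun k => ?_⟩
    · have := f.summable_sq
      refine this.congr fun k => ?_
      rw [norm_mul, Complex.norm_real, Real.norm_of_nonneg (wt_pos _ _).le, ← mul_assoc, ← wt_add,
        add_sub_cancel]
    · simp [wt_neg_arg, f.coeff_neg]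

@[simp] lemma Hs.coeff_shift {r : ℝ} (r' : ℝ) (f : Hs r) (k : ℤ) :
    (f.shift r').coeff k = (wt (r - r') k : ℂ) * f.coeff k := rfl

lemma Hs.norm_coeff_shift {r : ℝ} (r' : ℝ) (f : Hs r) (k : ℤ) :
    ‖(f.shift r').coeff k‖ = wt (r - r') k * ‖f.coeff k‖ := by
  rw [Hs.coeff_shift, norm_mul, Complex.norm_real, Real.norm_of_nonneg (wt_pos _ _).le]

lemma Hs.norm_shift {r : ℝ} (r' : ℝ) (f : Hs r) : ‖f.shift r'‖ = ‖f‖ := by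
  have : ‖f.shift r'‖ ^ 2 = ‖f‖ ^ 2 := by
    rw [Hs.norm_sq_eq, Hs.norm_sq_eq]
    congr 2
    funext k
    rw [Hs.norm_coeff_shift, ← mul_assoc, ← wt_add, add_sub_cancel]
  exact (sq_eq_sq₀ (norm_nonneg _) (norm_nonneg _)).1 this

/-- The distribution with Fourier coefficients `(1 + k²)^{-q/2}`, which lies in `H^r(𝕋)` for
`q > r + 1/2`. It serves as a majorant. -/
def bracket (r q : ℝ) (h : r + 1 / 2 < q) : Hs r :=
  Hs.mk (fun k => (wt (-q) k : ℂ)) <| by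
    refine ⟨(memℓp_weighted_iff _ _).2 ?_, fun k => ?_⟩
    · have := summable_wt (q := 2 * (q - r)) (by linarith)
      refine this.congr fun k => ?_
      rw [Complex.norm_real, Real.norm_of_nonneg (wt_pos _ _).le, ← wt_add, sq, ← wt_add]
      congr 1; ring
    · simp [wt_neg_arg]

lemma norm_coeff_smul_bracket {r q : ℝ} (h : r + 1 / 2 < q) {c : ℝ} (hc : 0 ≤ c) (k : ℤ) :
    ‖(c • bracket r q h).coeff k‖ = c * wt (-q) k := by
  rw [map_smul, Pi.smul_apply, norm_smul, Real.norm_of_nonneg hc]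
  congr 1
  change ‖((wt (-q) k : ℝ) : ℂ)‖ = _
  rw [Complex.norm_real, Real.norm_of_nonneg (wt_pos _ _).le]

/-! ### The quadratic nonlinearity -/

/-- The `k`-th Fourier coefficient of `½ ∂ₓ (f g)`, the polar form of `nonlin`. -/
def bilin (f g : ℤ → ℂ) (k : ℤ) : ℂ :=
  Complex.I * (k : ℂ) / 2 * ∑' j : ℤ, f j * g (k - j)

lemma Hs.summable_norm_conv {r : ℝ} (hr : 0 ≤ r) (f g : Hs r) (k : ℤ) :
    Summable (fun j => ‖f.coeff j * g.coeff (k - j)‖) ∧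
    ∑' j, ‖f.coeff j * g.coeff (k - j)‖ ≤ 2 ^ (r / 2) * wt (-r) k * (‖f‖ * ‖g‖) := by
  set a : ℤ → ℝ := fun j => wt r j * ‖f.coeff j‖ with ha
  set b : ℤ → ℝ := fun j => wt r (k - j) * ‖g.coeff (k - j)‖ with hb
  have ha0 : ∀ j, 0 ≤ a j := fun j => mul_nonneg (wt_pos _ _).le (norm_nonneg _)
  have hb0 : ∀ j, 0 ≤ b j := fun j => mul_nonneg (wt_pos _ _).le (norm_nonneg _)
  have hae : Summable fun j => a j ^ (2 : ℝ) := by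
    simpa only [Real.rpow_two] using f.summable_sq
  have hbe : Summable fun j => b j ^ (2 : ℝ) := by
    simpa only [Real.rpow_two] using! (Equiv.subLeft k).summable_iff.2 g.summable_sq
  have hbs : ∑' j, b j ^ (2 : ℝ) = ∑' j, (wt r j * ‖g.coeff j‖) ^ 2 := by
    simp only [Real.rpow_two, hb]
    exact (Equiv.subLeft k).tsum_eq (fun j => (wt r j * ‖g.coeff j‖) ^ 2)
  obtain ⟨h1, h2⟩ := Real.summable_and_inner_le_Lp_mul_Lq_tsum_of_nonneg
    (Real.HolderConjugate.two_two) ha0 hb0 hae hbe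
  have h3 : ∑' j, a j * b j ≤ ‖f‖ * ‖g‖ := by
    refine h2.trans ?_
    rw [hbs]
    have e1 : (∑' i, a i ^ (2 : ℝ)) ^ (1 / 2 : ℝ) ≤ ‖f‖ := by
      rw [← Real.sqrt_eq_rpow]
      apply Real.sqrt_le_iff.2 ⟨norm_nonneg _, _⟩
      simpa only [Real.rpow_two] using f.tsum_sq_le
    have e2 : (∑' j, (wt r j * ‖g.coeff j‖) ^ 2) ^ (1 / 2 : ℝ) ≤ ‖g‖ := by
      rw [← Real.sqrt_eq_rpow]
      exact Real.sqrt_le_iff.2 ⟨norm_nonneg _, g.tsum_sq_le⟩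
    gcongr
  have hle : ∀ j, ‖f.coeff j * g.coeff (k - j)‖ ≤ 2 ^ (r / 2) * wt (-r) k * (a j * b j) := by
    intro j
    have e := wt_le_mul hr k j
    have e2 := wt_neg_mul_self r k
    have e3 := wt_pos (-r) k
    rw [norm_mul]
    have e4 : 1 ≤ wt (-r) k * (2 ^ (r / 2) * (wt r j * wt r (k - j))) := by
      rw [← e2]; gcongr
    calc ‖f.coeff j‖ * ‖g.coeff (k - j)‖ = 1 * (‖f.coeff j‖ * ‖g.coeff (k - j)‖) := by ring
      _ ≤ (wt (-r) k * (2 ^ (r / 2) * (wt r j * wt r (k - j)))) *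
          (‖f.coeff j‖ * ‖g.coeff (k - j)‖) := by gcongr
      _ = _ := by simp only [ha, hb]; ring
  have hs : Summable (fun j => ‖f.coeff j * g.coeff (k - j)‖) :=
    (h1.mul_left (2 ^ (r / 2) * wt (-r) k)).of_nonneg_of_le (fun _ => norm_nonneg _) hle
  refine ⟨hs, ?_⟩
  refine (hs.tsum_le_tsum hle (h1.mul_left _)).trans ?_
  rw [tsum_mul_left]
  have := wt_pos (-r) k
  gcongr

lemma Hs.summable_conv {r : ℝ} (hr : 0 ≤ r) (f g : Hs r) (k : ℤ) :
    Summable (fun j => f.coeff j * g.coeff (k - j)) :=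
  (f.summable_norm_conv hr g k).1.of_norm

lemma norm_bilin_le {r : ℝ} (hr : 0 ≤ r) (f g : Hs r) (k : ℤ) :
    ‖bilin f.coeff g.coeff k‖ ≤ |(k : ℝ)| * (2 ^ (r / 2) * wt (-r) k * (‖f‖ * ‖g‖)) := by
  unfold bilin
  obtain ⟨h1, h2⟩ := f.summable_norm_conv hr g k
  have h3 := (norm_tsum_le_tsum_norm h1).trans h2
  rw [norm_mul, norm_div, norm_mul, Complex.norm_I, one_mul, Complex.norm_intCast]
  have h5 : ‖(2 : ℂ)‖ = 2 := by simp
  rw [h5]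
  have h4 : |(k : ℝ)| / 2 ≤ |(k : ℝ)| := by linarith [abs_nonneg (k : ℝ)]
  gcongr

lemma bilin_neg {r : ℝ} (f g : Hs r) (k : ℤ) :
    bilin f.coeff g.coeff (-k) = (starRingEnd ℂ) (bilin f.coeff g.coeff k) := by
  unfold bilin
  rw [map_mul, Complex.conj_tsum, ← (Equiv.neg ℤ).tsum_eq]
  have : ∀ j : ℤ, f.coeff (Equiv.neg ℤ j) * g.coeff (-k - Equiv.neg ℤ j) =
      (starRingEnd ℂ) (f.coeff j * g.coeff (k - j)) := by
    intro j
    rw [Equiv.neg_apply, map_mul, f.coeff_neg, ← g.coeff_neg,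
      show -k - -j = -(k - j) by ring]
  simp_rw [this]
  congr 1
  simp [Complex.conj_ofNat]

lemma bilin_add_left {r : ℝ} (hr : 0 ≤ r) (f f' g : Hs r) (k : ℤ) :
    bilin (f + f').coeff g.coeff k = bilin f.coeff g.coeff k + bilin f'.coeff g.coeff k := by
  unfold bilin
  rw [← mul_add, ← (f.summable_conv hr g k).tsum_add (f'.summable_conv hr g k)]
  simp only [map_add, Pi.add_apply, add_mul]

lemma bilin_add_right {r : ℝ} (hr : 0 ≤ r) (f g g' : Hs r) (k : ℤ) :
    bilin f.coeff (g + g').coeff k = bilin f.coeff g.coeff k + bilin f.coeff g'.coeff k := by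
  unfold bilin
  rw [← mul_add, ← (f.summable_conv hr g k).tsum_add (f.summable_conv hr g' k)]
  simp only [map_add, Pi.add_apply, mul_add]

lemma bilin_smul_left (c : ℝ) (f g : ℤ → ℂ) (k : ℤ) :
    bilin (c • f) g k = c • bilin f g k := by
  unfold bilin
  simp only [Pi.smul_apply, smul_mul_assoc, tsum_const_smul'', mul_smul_comm]

lemma bilin_smul_right (c : ℝ) (f g : ℤ → ℂ) (k : ℤ) :
    bilin f (c • g) k = c • bilin f g k := by
  unfold bilin
  simp only [Pi.smul_apply, tsum_const_smul'', mul_smul_comm]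

/-! ### The dissipative semigroup -/

lemma norm_exp_symbol (β η x : ℝ) (k : ℤ) :
    ‖Complex.exp ((x : ℂ) * symbol β η k)‖ = Real.exp (-(x * (η * ((k : ℝ) ^ 2 - |(k : ℝ)|)))) := by
  rw [Complex.norm_exp]
  congr 1
  unfold symbol
  rw [Complex.re_ofReal_mul, Complex.sub_re, Complex.ofReal_re, Complex.re_mul_ofReal, Complex.I_re]
  ring

lemma dissipation_nonneg {η : ℝ} (hη : 0 < η) (k : ℤ) : 0 ≤ η * ((k : ℝ) ^ 2 - |(k : ℝ)|) := by
  refine mul_nonneg hη.le ?_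
  have h : |k| ≤ k ^ 2 := by
    rw [← sq_abs]; nlinarith [abs_nonneg k, Int.le_self_sq |k|]
  have h2 : |(k : ℝ)| ≤ (k : ℝ) ^ 2 := by exact_mod_cast h
  linarith

lemma dissipation_lower {η l : ℝ} (hη : 0 < η) (hl : 2 * η ≤ l) (k : ℤ) :
    η / 2 * (1 + (k : ℝ) ^ 2) + l / 2 ≤ η * ((k : ℝ) ^ 2 - |(k : ℝ)|) + l := by
  have h : 0 ≤ η * (|(k : ℝ)| - 1) ^ 2 := by positivity
  rw [sub_sq, sq_abs] at h
  nlinarith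

lemma norm_exp_symbol_le_one {β η x : ℝ} (hη : 0 < η) (hx : 0 ≤ x) (k : ℤ) :
    ‖Complex.exp ((x : ℂ) * symbol β η k)‖ ≤ 1 := by
  rw [norm_exp_symbol, Real.exp_le_one_iff, neg_nonpos]
  exact mul_nonneg hx (dissipation_nonneg hη k)

lemma symbol_neg (β η : ℝ) (k : ℤ) : symbol β η (-k) = (starRingEnd ℂ) (symbol β η k) := by
  unfold symbol
  simp only [map_sub, map_mul, Complex.conj_I, Complex.conj_ofReal]
  push_cast
  simp

lemma exp_symbol_neg (β η x : ℝ) (k : ℤ) :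
    Complex.exp ((x : ℂ) * symbol β η (-k)) =
      (starRingEnd ℂ) (Complex.exp ((x : ℂ) * symbol β η k)) := by
  rw [symbol_neg, ← Complex.exp_conj, map_mul, Complex.conj_ofReal]

lemma rpow_le_mul_exp {a x : ℝ} (ha : 0 ≤ a) (hx : 0 < x) : x ^ a ≤ a ^ a * Real.exp x := by
  rcases ha.eq_or_lt with rfl | ha
  · simp [Real.one_le_exp hx.le]
  · have h1 := Real.log_le_sub_one_of_pos (div_pos hx ha)
    rw [Real.log_div hx.ne' ha.ne'] at h1
    have h2 : Real.log x * a ≤ Real.log a * a + x := by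
      have h3 := mul_le_mul_of_nonneg_right h1 ha.le
      have h4 : (x / a - 1) * a = x - a := by field_simp
      nlinarith
    rw [Real.rpow_def_of_pos hx, Real.rpow_def_of_pos ha, ← Real.exp_add]
    exact Real.exp_le_exp.2 h2

/-- Parabolic smoothing: the semigroup at time `t` gains `m` derivatives at the cost
`t^{-m/2}`. -/
lemma norm_exp_symbol_le {η : ℝ} (hη : 0 < η) {m : ℝ} (hm : 0 ≤ m) :
    ∃ C, 0 ≤ C ∧ ∀ β t : ℝ, 0 < t → ∀ k,
      ‖Complex.exp ((t : ℂ) * symbol β η k)‖ ≤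
        C * Real.exp (2 * η * t) * t ^ (-(m / 2)) * wt (-m) k := by
  refine ⟨(m / 2) ^ (m / 2) * (η / 2) ^ (-(m / 2)), by positivity, fun β t ht k => ?_⟩
  have h1 := dissipation_lower hη le_rfl k
  set X : ℝ := t * (η / 2) * (1 + (k : ℝ) ^ 2) with hX
  have hX0 : 0 < X := by positivity
  have h2 : ‖Complex.exp ((t : ℂ) * symbol β η k)‖ ≤ Real.exp (2 * η * t) * Real.exp (-X) := by
    rw [norm_exp_symbol, ← Real.exp_add]
    apply Real.exp_le_exp.2
    rw [hX]
    nlinarith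
  have h3 : Real.exp (-X) ≤ (m / 2) ^ (m / 2) * X ^ (-(m / 2)) := by
    have h4 := rpow_le_mul_exp (a := m / 2) (by positivity) hX0
    rw [Real.exp_neg, Real.rpow_neg hX0.le, ← div_eq_mul_inv, le_div_iff₀ (by positivity),
      inv_mul_le_iff₀ (Real.exp_pos _)]
    linarith
  have h5 : X ^ (-(m / 2)) = t ^ (-(m / 2)) * (η / 2) ^ (-(m / 2)) * wt (-m) k := by
    rw [hX, Real.mul_rpow (by positivity) (by positivity), Real.mul_rpow ht.le (by positivity)]
    unfold wt
    congr 2; ring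
  calc _ ≤ Real.exp (2 * η * t) * ((m / 2) ^ (m / 2) * X ^ (-(m / 2))) := h2.trans (by gcongr)
    _ = _ := by rw [h5]; ring

/-! ### The Duhamel integral -/

/-- The `k`-th Fourier coefficient of `∫_a^t S(t - t') N(t') dt'`. -/
def duh (β η a : ℝ) (N : ℝ → ℤ → ℂ) (t : ℝ) (k : ℤ) : ℂ :=
  ∫ t' in a..t, Complex.exp (((t - t' : ℝ) : ℂ) * symbol β η k) * N t' k

/-- A forcing term whose `k`-th coefficient is at most
`K |k| (1 + k²)^{-r/2} e^{l (t - a)} (t - a)^{-σ}` at times `t ∈ (a,b]`. -/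
structure ForcingBound (a b r σ l K : ℝ) (N : ℝ → ℤ → ℂ) : Prop where
  meas : ∀ k, AEStronglyMeasurable (fun t => N t k) (volume.restrict (Ioc a b))
  bound : ∀ t ∈ Ioc a b, ∀ k,
    ‖N t k‖ ≤ |(k : ℝ)| * wt (-r) k * (K * (Real.exp (l * (t - a)) * (t - a) ^ (-σ)))

lemma ForcingBound.mono {a b b' r σ l K : ℝ} {N : ℝ → ℤ → ℂ} (h : ForcingBound a b r σ l K N)
    (hb : b' ≤ b) : ForcingBound a b' r σ l K N :=
  ⟨fun k => (h.meas k).mono_set (Ioc_subset_Ioc_right hb),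
    fun t ht k => h.bound t ⟨ht.1, ht.2.trans hb⟩ k⟩

lemma intervalIntegrable_sub_rpow {σ : ℝ} (hσ : σ < 1) (a b : ℝ) :
    IntervalIntegrable (fun t => (t - a) ^ (-σ)) volume a b := by
  have := (intervalIntegral.intervalIntegrable_rpow' (a := a - a) (b := b - a)
    (r := -σ) (by linarith)).comp_sub_right a
  simpa using this

lemma ForcingBound.intervalIntegrable {a b r σ l K : ℝ} {N : ℝ → ℤ → ℂ}
    (h : ForcingBound a b r σ l K N) (hab : a ≤ b) (hσ : σ < 1) (hl : 0 ≤ l) (hK : 0 ≤ K)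
    (k : ℤ) : IntervalIntegrable (fun t => N t k) volume a b := by
  have h1 := (intervalIntegrable_sub_rpow hσ a b).const_mul
    (|(k : ℝ)| * wt (-r) k * (K * Real.exp (l * (b - a))))
  refine h1.mono_fun ?_ ?_
  · rw [uIoc_of_le hab]; exact h.meas k
  · rw [uIoc_of_le hab]
    refine (ae_restrict_mem measurableSet_Ioc).mono fun t ht => ?_
    refine (h.bound t ht k).trans ?_
    refine le_trans ?_ (le_abs_self _)
    have h0 := wt_pos (-r) k
    have h2 : 0 ≤ (t - a) ^ (-σ) := Real.rpow_nonneg (by linarith [ht.1]) _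
    have h3 : l * (t - a) ≤ l * (b - a) := by gcongr; exact ht.2
    calc _ = |(k : ℝ)| * wt (-r) k * (K * Real.exp (l * (t - a))) * (t - a) ^ (-σ) := by ring
      _ ≤ _ := by gcongr

lemma intervalIntegrable_duh {β η t : ℝ} {a b : ℝ} {N : ℝ → ℤ → ℂ} {k : ℤ}
    (h : IntervalIntegrable (fun t => N t k) volume a b) :
    IntervalIntegrable (fun t' => Complex.exp (((t - t' : ℝ) : ℂ) * symbol β η k) * N t' k)
      volume a b := by
  refine h.continuousOn_mul ?_
  fun_prop

lemma duh_eq_mul {β η a c : ℝ} {N : ℝ → ℤ → ℂ} (t : ℝ) (k : ℤ) :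
    duh β η a N t k = Complex.exp (((t - c : ℝ) : ℂ) * symbol β η k) *
      ∫ t' in a..t, Complex.exp (((c - t' : ℝ) : ℂ) * symbol β η k) * N t' k := by
  unfold duh
  rw [← intervalIntegral.integral_const_mul]
  congr 1
  funext t'
  rw [← mul_assoc, ← Complex.exp_add]
  congr 2
  push_cast; ring

lemma continuousOn_duh {β η a b : ℝ} (hab : a ≤ b) {N : ℝ → ℤ → ℂ} {k : ℤ}
    (h : IntervalIntegrable (fun t => N t k) volume a b) :
    ContinuousOn (fun t => duh β η a N t k) (Icc a b) := by
  have h1 : (fun t => duh β η a N t k) = fun t =>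
      Complex.exp (((t - a : ℝ) : ℂ) * symbol β η k) *
        ∫ t' in a..t, Complex.exp (((a - t' : ℝ) : ℂ) * symbol β η k) * N t' k := by
    funext t; exact duh_eq_mul t k
  rw [h1]
  refine ContinuousOn.mul (by fun_prop) ?_
  have h2 := intervalIntegrable_duh (β := β) (η := η) (t := a) h
  rw [← uIcc_of_le hab]
  apply intervalIntegral.continuousOn_primitive_interval
  rwa [uIcc_of_le hab, ← intervalIntegrable_iff_integrableOn_Icc_of_le hab]

lemma duh_neg {β η a t : ℝ} {N : ℝ → ℤ → ℂ} (k : ℤ)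
    (h : ∀ t, N t (-k) = (starRingEnd ℂ) (N t k)) :
    duh β η a N t (-k) = (starRingEnd ℂ) (duh β η a N t k) := by
  unfold duh
  simp only [intervalIntegral, map_sub, ← integral_conj, map_mul, exp_symbol_neg, h]

lemma duh_add {β η a t : ℝ} {N N' : ℝ → ℤ → ℂ} {k : ℤ}
    (h : IntervalIntegrable (fun t => N t k) volume a t)
    (h' : IntervalIntegrable (fun t => N' t k) volume a t) :
    duh β η a (fun t => N t + N' t) t k = duh β η a N t k + duh β η a N' t k := by
  unfold duh
  rw [← intervalIntegral.integral_add (intervalIntegrable_duh h) (intervalIntegrable_duh h')]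
  simp only [Pi.add_apply, mul_add]

lemma duh_smul {β η a t : ℝ} {N : ℝ → ℤ → ℂ} (c : ℝ) (k : ℤ) :
    duh β η a (fun t => c • N t) t k = c • duh β η a N t k := by
  unfold duh
  rw [← intervalIntegral.integral_smul]
  simp only [Pi.smul_apply, mul_smul_comm]

lemma duh_congr_Ioo {β η a t : ℝ} {N N' : ℝ → ℤ → ℂ} {k : ℤ} (hat : a ≤ t)
    (h : ∀ t' ∈ Ioo a t, N t' k = N' t' k) : duh β η a N t k = duh β η a N' t k := by
  unfold duh
  rw [intervalIntegral.integral_of_le hat, intervalIntegral.integral_of_le hat,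
    integral_Ioc_eq_integral_Ioo, integral_Ioc_eq_integral_Ioo]
  refine setIntegral_congr_fun measurableSet_Ioo fun t' ht' => ?_
  simp only [h t' ht']

lemma duh_congr {β η a t : ℝ} {N N' : ℝ → ℤ → ℂ} {k : ℤ} (hat : a ≤ t)
    (h : ∀ t' ∈ Ioc a t, N t' k = N' t' k) : duh β η a N t k = duh β η a N' t k :=
  duh_congr_Ioo hat fun t' ht' => h t' (Ioo_subset_Ioc_self ht')

@[simp] lemma duh_self {β η a : ℝ} {N : ℝ → ℤ → ℂ} (k : ℤ) : duh β η a N a k = 0 := by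
  simp [duh]

/-- A substitute for the Beta integral: on each half of `(a,b)` only one of the two factors is
singular, and the other is at most its value at the midpoint. -/
lemma rpow_mul_rpow_le {a b t θ σ : ℝ} (hat : a < t) (htb : t < b) (hθ : θ ≤ 1) (hσ : 0 ≤ σ) :
    (b - t) ^ (θ - 1) * (t - a) ^ (-σ) ≤
      ((b - a) / 2) ^ (θ - 1) * (t - a) ^ (-σ) + ((b - a) / 2) ^ (-σ) * (b - t) ^ (θ - 1) := by
  have h1 : 0 < b - t := by linarith
  have h2 : 0 < t - a := by linarith
  have h3 : 0 < (b - a) / 2 := by linarith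
  have p1 := Real.rpow_pos_of_pos h1 (θ - 1)
  have p2 := Real.rpow_pos_of_pos h2 (-σ)
  have p3 := Real.rpow_pos_of_pos h3 (θ - 1)
  have p4 := Real.rpow_pos_of_pos h3 (-σ)
  rcases le_total (t - a) ((b - a) / 2) with h | h
  · have : (b - t) ^ (θ - 1) ≤ ((b - a) / 2) ^ (θ - 1) :=
      Real.rpow_le_rpow_of_nonpos h3 (by linarith) (by linarith)
    nlinarith
  · have : (t - a) ^ (-σ) ≤ ((b - a) / 2) ^ (-σ) :=
      Real.rpow_le_rpow_of_nonpos h3 h (by linarith)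
    nlinarith

lemma integral_majorant {a b θ σ : ℝ} (hab : a < b) (hθ : 0 < θ) (hσ : σ < 1) :
    IntervalIntegrable (fun t => ((b - a) / 2) ^ (θ - 1) * (t - a) ^ (-σ) +
      ((b - a) / 2) ^ (-σ) * (b - t) ^ (θ - 1)) volume a b ∧
    ∫ t in a..b, (((b - a) / 2) ^ (θ - 1) * (t - a) ^ (-σ) +
      ((b - a) / 2) ^ (-σ) * (b - t) ^ (θ - 1)) =
      (2 ^ (1 - θ) / (1 - σ) + 2 ^ σ / θ) * (b - a) ^ (θ - σ) := by
  have i1 := (intervalIntegrable_sub_rpow hσ a b).const_mul (((b - a) / 2) ^ (θ - 1))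
  have i2' : IntervalIntegrable (fun t => (b - t) ^ (θ - 1)) volume a b := by
    have := (intervalIntegral.intervalIntegrable_rpow' (a := b - a) (b := b - b)
      (r := θ - 1) (by linarith)).comp_sub_left b
    simpa using this
  have i2 := i2'.const_mul (((b - a) / 2) ^ (-σ))
  refine ⟨i1.add i2, ?_⟩
  have hba : 0 < b - a := by linarith
  rw [intervalIntegral.integral_add i1 i2, intervalIntegral.integral_const_mul,
    intervalIntegral.integral_const_mul,
    intervalIntegral.integral_comp_sub_right (fun x => x ^ (-σ)) a,
    intervalIntegral.integral_comp_sub_left (fun x => x ^ (θ - 1)) b,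
    integral_rpow (Or.inl (by linarith)), integral_rpow (Or.inl (by linarith)), sub_self, sub_self,
    Real.zero_rpow (by linarith), Real.zero_rpow (by linarith),
    Real.div_rpow hba.le (by norm_num), Real.div_rpow hba.le (by norm_num)]
  have e1 : (b - a) ^ (θ - 1) * (b - a) ^ (-σ + 1) = (b - a) ^ (θ - σ) := by
    rw [← Real.rpow_add hba]; congr 1; ring
  have e2 : (b - a) ^ (-σ) * (b - a) ^ (θ - 1 + 1) = (b - a) ^ (θ - σ) := by
    rw [← Real.rpow_add hba]; congr 1; ring
  have e3 : (2 : ℝ) ^ (θ - 1) = (2 ^ (1 - θ))⁻¹ := by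
    rw [← Real.rpow_neg (by norm_num)]; congr 1; ring
  have e4 : (2 : ℝ) ^ (-σ) = (2 ^ σ)⁻¹ := Real.rpow_neg (by norm_num) _
  rw [e3, e4, div_inv_eq_mul, div_inv_eq_mul, sub_zero, sub_zero]
  calc _ = 2 ^ (1 - θ) / (-σ + 1) * ((b - a) ^ (θ - 1) * (b - a) ^ (-σ + 1)) +
        2 ^ σ / (θ - 1 + 1) * ((b - a) ^ (-σ) * (b - a) ^ (θ - 1 + 1)) := by ring
    _ = _ := by rw [e1, e2]; ring_nf

/-- The basic estimate for the Duhamel integral, coefficient by coefficient. The parameter `θ`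
trades time decay against regularity, and `γ` trades regularity against smallness for a large
exponential weight `l`. -/
lemma norm_duh_le {η : ℝ} (hη : 0 < η) {r σ θ γ : ℝ} (hσ : 0 ≤ σ) (hσ1 : σ < 1) (hθ : 0 < θ)
    (hγ : 0 ≤ γ) (hθγ : θ + γ ≤ 1) :
    ∃ C, 0 ≤ C ∧ ∀ (β a b l K : ℝ) (N : ℝ → ℤ → ℂ), a < b → 2 * η ≤ l → 0 ≤ K →
      ForcingBound a b r σ l K N → ∀ k,
      ‖duh β η a N b k‖ ≤ C * K * (Real.exp (l * (b - a)) * (b - a) ^ (θ - σ) * l ^ (-γ)) *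
        wt (-(1 - 2 * θ - 2 * γ + r)) k := by
  set M : ℝ := 2 ^ (1 - θ) / (1 - σ) + 2 ^ σ / θ with hM
  have hM0 : 0 ≤ M := by
    have : 0 < 1 - σ := by linarith
    positivity
  refine ⟨M * (2 ^ γ * (η / 2) ^ (-(1 - θ - γ))), by positivity, ?_⟩
  intro β a b l K N hab hl hK hN k
  have hl0 : 0 < l := by linarith
  set p : ℝ := η * ((k : ℝ) ^ 2 - |(k : ℝ)|) with hp
  have hp0 : 0 ≤ p := dissipation_nonneg hη k
  have hP := dissipation_lower hη hl k
  rw [← hp] at hP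
  have hk2 : 0 < 1 + (k : ℝ) ^ 2 := by positivity
  have hP0 : 0 < p + l := by linarith
  have hw := wt_pos (-r) k
  set A : ℝ := |(k : ℝ)| * wt (-r) k * (K * Real.exp (l * (b - a))) * (p + l) ^ (θ - 1) with hA
  have hA0 : 0 ≤ A := by positivity
  have key : ‖duh β η a N b k‖ ≤ A * (M * (b - a) ^ (θ - σ)) := by
    obtain ⟨j1, j2⟩ := integral_majorant (θ := θ) (σ := σ) hab hθ hσ1
    rw [← j2, ← intervalIntegral.integral_const_mul]
    unfold duh
    refine intervalIntegral.norm_integral_le_of_norm_le hab.le ?_ (j1.const_mul A)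
    have hne : ∀ᵐ t : ℝ ∂volume, t ≠ b := by
      simp [ae_iff, measure_singleton]
    filter_upwards [hne] with t htb ht
    have htb' : t < b := lt_of_le_of_ne ht.2 htb
    have hx : 0 < b - t := by linarith
    have hy : 0 < t - a := by linarith [ht.1]
    rw [norm_mul, norm_exp_symbol, ← hp]
    have b1 := hN.bound t ht k
    have b2 : Real.exp (-((b - t) * p)) * Real.exp (l * (t - a)) =
        Real.exp (l * (b - a)) * Real.exp (-((p + l) * (b - t))) := by
      rw [← Real.exp_add, ← Real.exp_add]; congr 1; ring
    -- `exp (-x) ≤ x ^ (θ - 1)` for `x = (p + l) (b - t)`, as `0 ≤ 1 - θ ≤ 1`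
    have b3 : Real.exp (-((p + l) * (b - t))) ≤ (p + l) ^ (θ - 1) * (b - t) ^ (θ - 1) := by
      rw [← Real.mul_rpow hP0.le hx.le]
      set x := (p + l) * (b - t) with hxdef
      have hx0 : 0 < x := by positivity
      have hx1 : x ^ (1 - θ) ≤ Real.exp x := by
        rcases le_total x 1 with hx1 | hx1
        · exact (Real.rpow_le_one hx0.le hx1 (by linarith)).trans (Real.one_le_exp hx0.le)
        · calc x ^ (1 - θ) ≤ x ^ (1 : ℝ) := Real.rpow_le_rpow_of_exponent_le hx1 (by linarith)
            _ ≤ _ := by rw [Real.rpow_one]; linarith [Real.add_one_le_exp x]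
      have : θ - 1 = -(1 - θ) := by ring
      rw [this, Real.rpow_neg hx0.le, Real.exp_neg]
      exact inv_anti₀ (by positivity) hx1
    have b4 := rpow_mul_rpow_le (θ := θ) (σ := σ) ht.1 htb' (by linarith) hσ
    have hyσ : 0 ≤ (t - a) ^ (-σ) := Real.rpow_nonneg hy.le _
    calc Real.exp (-((b - t) * p)) * ‖N t k‖
        ≤ Real.exp (-((b - t) * p)) * (|(k : ℝ)| * wt (-r) k *
          (K * (Real.exp (l * (t - a)) * (t - a) ^ (-σ)))) := by gcongr
      _ = |(k : ℝ)| * wt (-r) k * K * (t - a) ^ (-σ) *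
          (Real.exp (-((b - t) * p)) * Real.exp (l * (t - a))) := by ring
      _ = |(k : ℝ)| * wt (-r) k * (K * Real.exp (l * (b - a))) * (t - a) ^ (-σ) *
          Real.exp (-((p + l) * (b - t))) := by rw [b2]; ring
      _ ≤ |(k : ℝ)| * wt (-r) k * (K * Real.exp (l * (b - a))) * (t - a) ^ (-σ) *
          ((p + l) ^ (θ - 1) * (b - t) ^ (θ - 1)) := by gcongr
      _ = A * ((b - t) ^ (θ - 1) * (t - a) ^ (-σ)) := by rw [hA]; ring
      _ ≤ _ := by gcongr
  -- `p + l` is at least `l / 2` and at least `(η / 2) (1 + k²)`; the power `θ - 1` is split into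
  -- `-γ`, spent on the first bound, and `-(1 - θ - γ)`, spent on the second
  have hPle : (p + l) ^ (θ - 1) ≤
      (2 ^ γ * l ^ (-γ)) * ((η / 2) ^ (-(1 - θ - γ)) * wt (-(2 * (1 - θ - γ))) k) := by
    have e1 : (p + l) ^ (θ - 1) = (p + l) ^ (-γ) * (p + l) ^ (-(1 - θ - γ)) := by
      rw [← Real.rpow_add hP0]; congr 1; ring
    have e2 : (p + l) ^ (-γ) ≤ 2 ^ γ * l ^ (-γ) := by
      have : (2 : ℝ) ^ γ * l ^ (-γ) = (l / 2) ^ (-γ) := by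
        rw [Real.div_rpow hl0.le (by norm_num), Real.rpow_neg (by norm_num : (0 : ℝ) ≤ 2),
          div_inv_eq_mul, mul_comm]
      rw [this]
      exact Real.rpow_le_rpow_of_nonpos (by positivity) (by nlinarith) (by linarith)
    have e3 : (p + l) ^ (-(1 - θ - γ)) ≤ (η / 2) ^ (-(1 - θ - γ)) * wt (-(2 * (1 - θ - γ))) k := by
      have : wt (-(2 * (1 - θ - γ))) k = (1 + (k : ℝ) ^ 2) ^ (-(1 - θ - γ)) := by
        unfold wt; congr 1; ring
      rw [this, ← Real.mul_rpow (by positivity) hk2.le]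
      exact Real.rpow_le_rpow_of_nonpos (by positivity) (by linarith) (by linarith)
    rw [e1]
    exact mul_le_mul e2 e3 (by positivity) (by positivity)
  have hwt : wt (-(1 - 2 * θ - 2 * γ + r)) k = wt 1 k * wt (-r) k * wt (-(2 * (1 - θ - γ))) k := by
    rw [← wt_add, ← wt_add]; congr 1; ring
  have hk1 := abs_le_wt_one k
  have hba : 0 ≤ (b - a) ^ (θ - σ) := Real.rpow_nonneg (by linarith) _
  have hw2 := wt_pos (-(2 * (1 - θ - γ))) k
  have hw1 := wt_pos 1 k
  calc _ ≤ A * (M * (b - a) ^ (θ - σ)) := key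
    _ ≤ (wt 1 k * wt (-r) k * (K * Real.exp (l * (b - a))) *
        ((2 ^ γ * l ^ (-γ)) * ((η / 2) ^ (-(1 - θ - γ)) * wt (-(2 * (1 - θ - γ))) k))) *
        (M * (b - a) ^ (θ - σ)) := by
      rw [hA]; gcongr
    _ = _ := by rw [hwt]; ring

/-- Restarting the Duhamel formula at a later time. -/
lemma duh_restart {β η a a' t : ℝ} {N : ℝ → ℤ → ℂ} {k : ℤ}
    (h : IntervalIntegrable (fun t => N t k) volume a a')
    (h' : IntervalIntegrable (fun t => N t k) volume a' t) :
    duh β η a N t k = Complex.exp (((t - a' : ℝ) : ℂ) * symbol β η k) * duh β η a N a' k +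
      duh β η a' N t k := by
  have e := duh_eq_mul (β := β) (η := η) (a := a) (c := a') (N := N) t k
  rw [e, ← intervalIntegral.integral_add_adjacent_intervals (b := a')
    (intervalIntegrable_duh h) (intervalIntegrable_duh h'), mul_add]
  rw [← duh_eq_mul]
  rfl

lemma aestronglyMeasurable_bilin {r : ℝ} (hr : 0 ≤ r) {F G : ℝ → Hs r} {S : Set ℝ}
    (hS : MeasurableSet S) (hF : ∀ k, ContinuousOn (fun t => (F t).coeff k) S)
    (hG : ∀ k, ContinuousOn (fun t => (G t).coeff k) S) (k : ℤ) :
    AEStronglyMeasurable (fun t => bilin (F t).coeff (G t).coeff k) (volume.restrict S) := by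
  unfold bilin
  refine AEStronglyMeasurable.const_mul ?_ _
  refine aestronglyMeasurable_of_tendsto_ae (ι := Finset ℤ) Filter.atTop
    (f := fun s t => ∑ j ∈ s, (F t).coeff j * (G t).coeff (k - j)) ?_ ?_
  · intro s
    refine ContinuousOn.aestronglyMeasurable ?_ hS
    exact continuousOn_finsetSum _ fun j _ => (hF j).mul (hG (k - j))
  · exact Filter.Eventually.of_forall fun t => ((F t).summable_conv hr (G t) k).hasSum

lemma forcingBound_bilin {r : ℝ} (hr : 0 ≤ r) {F G : ℝ → Hs r} {a b σ l K : ℝ}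
    (hF : ∀ k, ContinuousOn (fun t => (F t).coeff k) (Ioc a b))
    (hG : ∀ k, ContinuousOn (fun t => (G t).coeff k) (Ioc a b))
    (h : ∀ t ∈ Ioc a b, ‖F t‖ * ‖G t‖ ≤ K * (Real.exp (l * (t - a)) * (t - a) ^ (-σ))) :
    ForcingBound a b r σ l (2 ^ (r / 2) * K) (fun t => bilin (F t).coeff (G t).coeff) := by
  refine ⟨fun k => aestronglyMeasurable_bilin hr measurableSet_Ioc hF hG k, fun t ht k => ?_⟩
  refine (norm_bilin_le hr _ _ k).trans ?_
  have := wt_pos (-r) k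
  have h1 := h t ht
  calc _ ≤ |(k : ℝ)| * (2 ^ (r / 2) * wt (-r) k *
        (K * (Real.exp (l * (t - a)) * (t - a) ^ (-σ)))) := by gcongr
    _ = _ := by ring

/-! ### Operators given by dominated Fourier coefficients -/

section Operators

variable {K : Type*} [TopologicalSpace K] {r : ℝ}

/-- The bounded continuous `H^r(𝕋)`-valued function with given Fourier coefficients, when these
are continuous and dominated by the coefficients of a fixed element of `H^r(𝕋)`. -/
def bcfOfDominated (c : K → ℤ → ℂ) (d : Hs r)
    (hsym : ∀ t k, c t (-k) = (starRingEnd ℂ) (c t k))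
    (hcont : ∀ k, Continuous fun t => c t k) (hd : ∀ t k, ‖c t k‖ ≤ ‖d.coeff k‖) :
    K →ᵇ Hs r :=
  BoundedContinuousFunction.ofNormedAddCommGroup
    (fun t => Hs.mk (c t) (mem_hsSubmodule_of_dominated (hsym t) d (hd t)))
    (continuous_iff_continuousAt.2 fun _ => Hs.continuousAt_of_dominated
      (fun k => (hcont k).continuousAt) d (Filter.Eventually.of_forall fun t k => hd t k))
    ‖d‖ (fun t => Hs.norm_le_of_dominated _ d (hd t))

lemma norm_bcfOfDominated_le (c : K → ℤ → ℂ) (d : Hs r)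
    (hsym : ∀ t k, c t (-k) = (starRingEnd ℂ) (c t k))
    (hcont : ∀ k, Continuous fun t => c t k) (hd : ∀ t k, ‖c t k‖ ≤ ‖d.coeff k‖) :
    ‖bcfOfDominated c d hsym hcont hd‖ ≤ ‖d‖ :=
  BoundedContinuousFunction.norm_ofNormedAddCommGroup_le _ (norm_nonneg _) _

/-- Fourier coefficients that depend linearly on a parameter and have a majorant bounded by the
norm of the parameter define a bounded operator. -/
lemma exists_linear_of_dominated {X : Type*} [NormedAddCommGroup X] [NormedSpace ℝ X]
    (c : X → K → ℤ → ℂ) (d : X → Hs r) (C : ℝ) (hC : ∀ x, ‖d x‖ ≤ C * ‖x‖)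
    (hsym : ∀ x t k, c x t (-k) = (starRingEnd ℂ) (c x t k))
    (hcont : ∀ x k, Continuous fun t => c x t k) (hd : ∀ x t k, ‖c x t k‖ ≤ ‖(d x).coeff k‖)
    (hadd : ∀ x y t k, c (x + y) t k = c x t k + c y t k)
    (hsmul : ∀ (a : ℝ) x t k, c (a • x) t k = a • c x t k) :
    ∃ L : X →L[ℝ] (K →ᵇ Hs r), ∀ x t, (L x t).coeff = c x t := by
  let L₀ : X →ₗ[ℝ] (K →ᵇ Hs r) :=
    { toFun := fun x => bcfOfDominated (c x) (d x) (hsym x) (hcont x) (hd x)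
      map_add' := fun x y => by
        ext1 t
        apply Hs.coeff_injective
        rw [BoundedContinuousFunction.add_apply, map_add]
        exact funext fun k => hadd x y t k
      map_smul' := fun a x => by
        ext1 t
        apply Hs.coeff_injective
        rw [BoundedContinuousFunction.smul_apply, map_smul]
        exact funext fun k => hsmul a x t k }
  exact ⟨L₀.mkContinuous C fun x =>
    (norm_bcfOfDominated_le _ _ (hsym x) (hcont x) (hd x)).trans (hC x), fun x t => rfl⟩

/-- The bilinear analogue of `exists_linear_of_dominated`. -/
lemma exists_bilinear_of_dominated {X : Type*} [NormedAddCommGroup X] [NormedSpace ℝ X]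
    (c : X → X → K → ℤ → ℂ) (d : X → X → Hs r) (C : ℝ) (hC : ∀ x y, ‖d x y‖ ≤ C * ‖x‖ * ‖y‖)
    (hsym : ∀ x y t k, c x y t (-k) = (starRingEnd ℂ) (c x y t k))
    (hcont : ∀ x y k, Continuous fun t => c x y t k)
    (hd : ∀ x y t k, ‖c x y t k‖ ≤ ‖(d x y).coeff k‖)
    (hadd : ∀ x x' y t k, c (x + x') y t k = c x y t k + c x' y t k)
    (hsmul : ∀ (a : ℝ) x y t k, c (a • x) y t k = a • c x y t k)
    (hadd' : ∀ x y y' t k, c x (y + y') t k = c x y t k + c x y' t k)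
    (hsmul' : ∀ (a : ℝ) x y t k, c x (a • y) t k = a • c x y t k) :
    ∃ B : X →L[ℝ] X →L[ℝ] (K →ᵇ Hs r), ∀ x y t, (B x y t).coeff = c x y t := by
  let f : X → X → (K →ᵇ Hs r) :=
    fun x y => bcfOfDominated (c x y) (d x y) (hsym x y) (hcont x y) (hd x y)
  have hf : ∀ x y t, (f x y t).coeff = c x y t := fun x y t => rfl
  let B₀ : X →ₗ[ℝ] X →ₗ[ℝ] (K →ᵇ Hs r) := LinearMap.mk₂ ℝ f
    (fun x x' y => by
      ext1 t; apply Hs.coeff_injective; funext k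
      rw [BoundedContinuousFunction.add_apply, map_add, hf, hf, hf]; exact hadd x x' y t k)
    (fun a x y => by
      ext1 t; apply Hs.coeff_injective; funext k
      rw [BoundedContinuousFunction.smul_apply, map_smul, hf, hf]; exact hsmul a x y t k)
    (fun x y y' => by
      ext1 t; apply Hs.coeff_injective; funext k
      rw [BoundedContinuousFunction.add_apply, map_add, hf, hf, hf]; exact hadd' x y y' t k)
    (fun a x y => by
      ext1 t; apply Hs.coeff_injective; funext k
      rw [BoundedContinuousFunction.smul_apply, map_smul, hf, hf]; exact hsmul' a x y t k)
  exact ⟨B₀.mkContinuous₂ C fun x y =>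
    (norm_bcfOfDominated_le _ _ (hsym x y) (hcont x y) (hd x y)).trans (hC x y), fun x y t => rfl⟩

/-- The weighted semigroup `φ ↦ (t ↦ ρ t • S(τ t) φ)` as a bounded operator from `H^s(𝕋)` to
the bounded continuous `H^r(𝕋)`-valued functions. -/
lemma exists_semigroup (β η : ℝ) {s C : ℝ} (hC : 0 ≤ C) {τ ρ : K → ℝ} (hτ : Continuous τ)
    (hρ : Continuous ρ)
    (h : ∀ t k, |ρ t| * ‖Complex.exp ((τ t : ℂ) * symbol β η k)‖ ≤ C * wt (s - r) k) :
    ∃ L : Hs s →L[ℝ] (K →ᵇ Hs r), ∀ φ t k,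
      (L φ t).coeff k = ρ t • (Complex.exp ((τ t : ℂ) * symbol β η k) * φ.coeff k) := by
  obtain ⟨L, hL⟩ := exists_linear_of_dominated (K := K) (r := r) (X := Hs s)
    (fun φ t k => ρ t • (Complex.exp ((τ t : ℂ) * symbol β η k) * φ.coeff k))
    (fun φ => C • φ.shift r) C
    (fun φ => by rw [norm_smul, Hs.norm_shift, Real.norm_of_nonneg hC])
    (fun φ t k => by
      rw [exp_symbol_neg, φ.coeff_neg, Complex.real_smul, Complex.real_smul, map_mul, map_mul,
        Complex.conj_ofReal])
    (fun φ k => by fun_prop)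
    (fun φ t k => by
      rw [map_smul, Pi.smul_apply, norm_smul, norm_smul, norm_mul, Hs.norm_coeff_shift,
        Real.norm_of_nonneg hC, ← mul_assoc, ← mul_assoc, Real.norm_eq_abs]
      exact mul_le_mul_of_nonneg_right (h t k) (norm_nonneg _))
    (fun φ ψ t k => by rw [map_add, Pi.add_apply, mul_add, smul_add])
    (fun a φ t k => by rw [map_smul, Pi.smul_apply, mul_smul_comm, smul_comm])
  exact ⟨L, fun φ t k => by rw [hL]⟩

/-- The weighted bilinear Duhamel operator
`(x, y) ↦ (t ↦ ρ t • ∫_a^{τ t} S(τ t - t') ½ ∂ₓ (x(t') y(t')) dt')`, where elements `x` of `X`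
are realised by `ev` as functions of time with values in `H^r(𝕋)` whose norm is at most
`A ‖x‖ (t - a)^{-σ/2}`. It gains up to `1/2 - 2θ` derivatives and has the time weight
`(t - a)^{θ - σ}`. -/
lemma exists_duhamel (β : ℝ) {η : ℝ} (hη : 0 < η) {a b r r' σ θ A A' : ℝ} (hr : 0 ≤ r)
    (hσ : 0 ≤ σ) (hσ1 : σ < 1) (hθ : 0 < θ) (hθ1 : θ ≤ 1) (hq : r' + 1 / 2 < 1 - 2 * θ + r)
    {X : Type*} [NormedAddCommGroup X] [NormedSpace ℝ X] (ev : X →ₗ[ℝ] (ℝ → Hs r))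
    (hA : 0 ≤ A) (hev : ∀ x, ∀ t ∈ Ioc a b, ‖ev x t‖ ≤ A * ‖x‖ * (t - a) ^ (-(σ / 2)))
    (hevc : ∀ x k, ContinuousOn (fun t => (ev x t).coeff k) (Ioc a b))
    {τ ρ : K → ℝ} (hτ : Continuous τ) (hτm : ∀ t, τ t ∈ Icc a b) (hρ : Continuous ρ)
    (hA' : 0 ≤ A') (hρb : ∀ t, a < τ t → |ρ t| * (τ t - a) ^ (θ - σ) ≤ A') :
    ∃ B : X →L[ℝ] X →L[ℝ] (K →ᵇ Hs r'), ∀ x y t k, (B x y t).coeff k =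
      ρ t • duh β η a (fun t' => bilin (ev x t').coeff (ev y t').coeff) (τ t) k := by
  obtain ⟨C, hC0, hC⟩ := norm_duh_le hη (r := r) hσ hσ1 hθ (le_refl (0 : ℝ)) (by simpa using hθ1)
  have hq' : r' + 1 / 2 < 1 - 2 * θ - 2 * 0 + r := by linarith
  have hfb : ∀ x y, ForcingBound a b r σ (2 * η) (2 ^ (r / 2) * (A * ‖x‖ * (A * ‖y‖)))
      (fun t' => bilin (ev x t').coeff (ev y t').coeff) := by
    intro x y
    refine forcingBound_bilin hr (hevc x) (hevc y) fun t ht => ?_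
    have ht0 : 0 < t - a := by linarith [ht.1]
    have h1 := hev x t ht
    have h2 := hev y t ht
    have h3 : (t - a) ^ (-(σ / 2)) * (t - a) ^ (-(σ / 2)) = (t - a) ^ (-σ) := by
      rw [← Real.rpow_add ht0]; congr 1; ring
    have h4 : 1 ≤ Real.exp (2 * η * (t - a)) := Real.one_le_exp (by positivity)
    have h5 := Real.rpow_pos_of_pos ht0 (-σ)
    calc ‖ev x t‖ * ‖ev y t‖
        ≤ (A * ‖x‖ * (t - a) ^ (-(σ / 2))) * (A * ‖y‖ * (t - a) ^ (-(σ / 2))) := by gcongr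
      _ = A * ‖x‖ * (A * ‖y‖) * (1 * (t - a) ^ (-σ)) := by rw [← h3]; ring
      _ ≤ _ := by gcongr
  have hint : ∀ x y (t : K) k, IntervalIntegrable
      (fun t' => bilin (ev x t').coeff (ev y t').coeff k) volume a (τ t) := fun x y t k =>
    ((hfb x y).mono (hτm t).2).intervalIntegrable (hτm t).1 hσ1 (by positivity) (by positivity) k
  set D : ℝ := A' * C * 2 ^ (r / 2) * A * A * Real.exp (2 * η * (b - a)) with hD
  have hD0 : 0 ≤ D := by positivity
  obtain ⟨B, hB⟩ := exists_bilinear_of_dominated (K := K) (r := r') (X := X)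
    (fun x y t k =>
      ρ t • duh β η a (fun t' => bilin (ev x t').coeff (ev y t').coeff) (τ t) k)
    (fun x y => (D * ‖x‖ * ‖y‖) • bracket r' _ hq')
    (D * ‖bracket r' _ hq'‖)
    (fun x y => by
      rw [norm_smul, Real.norm_of_nonneg (by positivity)]
      apply le_of_eq; ring)
    (fun x y t k => by
      rw [duh_neg k fun t => bilin_neg _ _ k, Complex.real_smul, Complex.real_smul, map_mul,
        Complex.conj_ofReal])
    (fun x y k => by
      refine hρ.smul ?_
      rcases le_or_gt a b with hab | hab
      · have h1 := continuousOn_duh (β := β) (η := η) hab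
          ((hfb x y).intervalIntegrable hab hσ1 (by positivity) (by positivity) k)
        exact h1.comp_continuous hτ hτm
      · exact continuous_iff_continuousAt.2 fun t =>
          absurd ((hτm t).1.trans (hτm t).2) (not_le.2 hab))
    (fun x y t k => by
      rw [norm_coeff_smul_bracket hq' (by positivity), norm_smul, Real.norm_eq_abs]
      have hw := wt_pos (-(1 - 2 * θ - 2 * 0 + r)) k
      rcases (hτm t).1.eq_or_lt with h0 | h0
      · rw [← h0, duh_self, norm_zero, mul_zero]; positivity
      · have h1 := hC β a (τ t) (2 * η) _ _ h0 le_rfl (by positivity)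
          ((hfb x y).mono (hτm t).2) k
        have h2 := hρb t h0
        have h3 : Real.exp (2 * η * (τ t - a)) ≤ Real.exp (2 * η * (b - a)) := by
          gcongr; exact (hτm t).2
        have h4 : 0 ≤ (τ t - a) ^ (θ - σ) := Real.rpow_nonneg (by linarith) _
        rw [neg_zero, Real.rpow_zero, mul_one] at h1
        calc _ ≤ |ρ t| * (C * (2 ^ (r / 2) * (A * ‖x‖ * (A * ‖y‖))) *
              (Real.exp (2 * η * (τ t - a)) * (τ t - a) ^ (θ - σ)) *
              wt (-(1 - 2 * θ - 2 * 0 + r)) k) := by gcongr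
          _ = (|ρ t| * (τ t - a) ^ (θ - σ)) * C * 2 ^ (r / 2) * A * A *
              Real.exp (2 * η * (τ t - a)) * ‖x‖ * ‖y‖ * wt (-(1 - 2 * θ - 2 * 0 + r)) k := by
            ring
          _ ≤ A' * C * 2 ^ (r / 2) * A * A * Real.exp (2 * η * (b - a)) * ‖x‖ * ‖y‖ *
              wt (-(1 - 2 * θ - 2 * 0 + r)) k := by gcongr
          _ = _ := by rw [hD])
    (fun x x' y t k => by
      rw [← smul_add, ← duh_add (hint x y t k) (hint x' y t k)]
      congr 2
      funext t' k
      simp only [map_add, Pi.add_apply]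
      rw [← bilin_add_left hr, map_add])
    (fun c x y t k => by
      rw [smul_comm c (ρ t), ← duh_smul c]
      congr 2
      funext t' k
      simp only [map_smul, Pi.smul_apply, bilin_smul_left])
    (fun x y y' t k => by
      rw [← smul_add, ← duh_add (hint x y t k) (hint x y' t k)]
      congr 2
      funext t' k
      simp only [map_add, Pi.add_apply]
      rw [← bilin_add_right hr, map_add])
    (fun c x y t k => by
      rw [smul_comm c (ρ t), ← duh_smul c]
      congr 2
      funext t' k
      simp only [map_smul, Pi.smul_apply, bilin_smul_right])
  exact ⟨B, fun x y t k => by rw [hB]⟩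

end Operators

/-! ### The equation in a time-weighted space -/

/-- The parameters of the problem. The exponent `σ` describes the admissible singularity
`‖u t‖_{L²} = O(t^{-σ/2})` of a solution at `t = 0`; it is taken to be `max 0 (-s)`. -/
structure Params where
  /-- the dispersion coefficient -/
  β : ℝ
  /-- the dissipation coefficient -/
  η : ℝ
  /-- the regularity of the initial values -/
  s : ℝ
  /-- the order of the singularity at time zero -/
  σ : ℝ
  hη : 0 < η
  hσ : 0 ≤ σ
  hσ' : σ < 1 / 2
  hs : -σ ≤ s

/-- The space of all functions `t ↦ t^{σ/2} u t` on `(0,T]` with values in `L²(𝕋)` that are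
bounded and continuous. -/
abbrev WSpace (T : ℝ) : Type := Ioc (0 : ℝ) T →ᵇ Hs 0

namespace Params

variable (P : Params) {T : ℝ}

/-- The function `u t = t^{-σ/2} w t`, extended by zero outside of `(0,T]`. -/
def ev (T : ℝ) : WSpace T →ₗ[ℝ] (ℝ → Hs 0) where
  toFun w t := if h : t ∈ Ioc 0 T then t ^ (-(P.σ / 2)) • w ⟨t, h⟩ else 0
  map_add' w w' := by
    funext t
    by_cases h : t ∈ Ioc 0 T
    · simp only [dif_pos h, Pi.add_apply, BoundedContinuousFunction.add_apply, smul_add]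
    · simp only [dif_neg h, Pi.add_apply, add_zero]
  map_smul' c w := by
    funext t
    by_cases h : t ∈ Ioc 0 T
    · simp only [dif_pos h, Pi.smul_apply, BoundedContinuousFunction.smul_apply, smul_comm _ c,
        RingHom.id_apply]
    · simp only [dif_neg h, Pi.smul_apply, smul_zero]

lemma ev_apply (w : WSpace T) (t : Ioc (0 : ℝ) T) :
    P.ev T w t = (t : ℝ) ^ (-(P.σ / 2)) • w t := by
  change (if h : (t : ℝ) ∈ Ioc 0 T then (t : ℝ) ^ (-(P.σ / 2)) • w ⟨t, h⟩ else 0) = _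
  rw [dif_pos t.2]

lemma norm_ev (w : WSpace T) (t : Ioc (0 : ℝ) T) :
    ‖P.ev T w t‖ = (t : ℝ) ^ (-(P.σ / 2)) * ‖w t‖ := by
  rw [ev_apply, norm_smul, Real.norm_of_nonneg (Real.rpow_nonneg t.2.1.le _)]

lemma norm_ev_le (w : WSpace T) {t : ℝ} (ht : t ∈ Ioc 0 T) :
    ‖P.ev T w t‖ ≤ 1 * ‖w‖ * (t - 0) ^ (-(P.σ / 2)) := by
  have := P.norm_ev w ⟨t, ht⟩
  rw [this, sub_zero, one_mul, mul_comm]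
  have h0 := Real.rpow_nonneg ht.1.le (-(P.σ / 2))
  gcongr
  exact w.norm_coe_le_norm _

lemma continuousOn_ev (w : WSpace T) : ContinuousOn (P.ev T w) (Ioc 0 T) := by
  rw [continuousOn_iff_continuous_domRestrict]
  have : (Ioc 0 T).domRestrict (P.ev T w) = fun t : Ioc (0 : ℝ) T => (t : ℝ) ^ (-(P.σ / 2)) • w t := by
    funext t; exact P.ev_apply w t
  rw [this]
  have hc : Continuous fun t : Ioc (0 : ℝ) T => (t : ℝ) ^ (-(P.σ / 2)) :=
    continuous_subtype_val.rpow_const fun t => Or.inl t.2.1.ne'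
  exact hc.smul w.continuous

lemma continuousOn_coeff_ev (w : WSpace T) (k : ℤ) :
    ContinuousOn (fun t => (P.ev T w t).coeff k) (Ioc 0 T) :=
  (Hs.continuous_coeff k).comp_continuousOn (P.continuousOn_ev w)

/-- A positive exponent measuring how far `σ` is from the critical value `1/2`; it is the gain
in powers of time in the Duhamel term. -/
def δ : ℝ := (1 / 2 - P.σ) / 8

lemma δ_pos : 0 < P.δ := by unfold δ; linarith [P.hσ']

/-- The forcing term `½ ∂ₓ (u v)` of two functions of time. -/
def forcing {r : ℝ} (F G : ℝ → Hs r) : ℝ → ℤ → ℂ := fun t => bilin (F t).coeff (G t).coeff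

lemma exists_linPart (T : ℝ) : ∃ L : Hs P.s →L[ℝ] WSpace T, ∀ φ t k,
    (L φ t).coeff k = (t : ℝ) ^ (P.σ / 2) •
      (Complex.exp (((t : ℝ) : ℂ) * symbol P.β P.η k) * φ.coeff k) := by
  obtain ⟨C, hC0, hC⟩ := norm_exp_symbol_le P.hη P.hσ
  refine exists_semigroup P.β P.η (C := C * Real.exp (2 * P.η * T)) (by positivity)
    (K := Ioc (0 : ℝ) T) (τ := fun t => (t : ℝ)) (ρ := fun t => (t : ℝ) ^ (P.σ / 2))
    continuous_subtype_val
    (continuous_subtype_val.rpow_const fun t => Or.inr (by linarith [P.hσ])) ?_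
  intro t k
  have ht := t.2.1
  have h1 := hC P.β t ht k
  have h2 : wt (-P.σ) k ≤ wt (P.s - 0) k := wt_mono (by linarith [P.hs]) k
  have h3 : Real.exp (2 * P.η * t) ≤ Real.exp (2 * P.η * T) := by
    have := P.hη; gcongr; exact t.2.2
  have h4 : (t : ℝ) ^ (P.σ / 2) * (t : ℝ) ^ (-(P.σ / 2)) = 1 := by
    rw [← Real.rpow_add ht, add_neg_cancel, Real.rpow_zero]
  have h5 := Real.rpow_nonneg ht.le (P.σ / 2)
  have h6 := wt_pos (-P.σ) k
  rw [abs_of_nonneg h5]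
  calc _ ≤ (t : ℝ) ^ (P.σ / 2) * (C * Real.exp (2 * P.η * t) * (t : ℝ) ^ (-(P.σ / 2)) *
        wt (-P.σ) k) := by gcongr
    _ = ((t : ℝ) ^ (P.σ / 2) * (t : ℝ) ^ (-(P.σ / 2))) * C * Real.exp (2 * P.η * t) *
        wt (-P.σ) k := by ring
    _ ≤ _ := by rw [h4, one_mul]; gcongr

/-- The free evolution `φ ↦ S(t) φ`. -/
def linPart (T : ℝ) : Hs P.s →L[ℝ] WSpace T := (P.exists_linPart T).choose

lemma coeff_linPart (φ : Hs P.s) (t : Ioc (0 : ℝ) T) (k : ℤ) :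
    (P.linPart T φ t).coeff k = (t : ℝ) ^ (P.σ / 2) •
      (Complex.exp (((t : ℝ) : ℂ) * symbol P.β P.η k) * φ.coeff k) :=
  (P.exists_linPart T).choose_spec φ t k

lemma exists_duhPart (T : ℝ) : ∃ B : WSpace T →L[ℝ] WSpace T →L[ℝ] WSpace T, ∀ x y t k,
    (B x y t).coeff k = (t : ℝ) ^ (P.σ / 2) •
      duh P.β P.η 0 (forcing (P.ev T x) (P.ev T y)) t k := by
  have h1 := P.δ_pos
  have h2 := P.hσ
  have h3 := P.hσ'
  have h4 : P.δ = (1 / 2 - P.σ) / 8 := rfl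
  refine exists_duhamel P.β P.hη (a := 0) (b := T) (r := 0) (r' := 0) (σ := P.σ)
    (θ := P.σ / 2 + P.δ) (A := 1) (A' := |T| ^ P.δ) le_rfl h2 (by linarith) (by linarith)
    (by linarith) (by linarith) (P.ev T) zero_le_one
    (fun x t ht => P.norm_ev_le x ht) P.continuousOn_coeff_ev (K := Ioc (0 : ℝ) T)
    (τ := fun t => (t : ℝ)) (ρ := fun t => (t : ℝ) ^ (P.σ / 2)) continuous_subtype_val
    (fun t => Ioc_subset_Icc_self t.2)
    (continuous_subtype_val.rpow_const fun t => Or.inr (by linarith [P.hσ]))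
    (by positivity) ?_
  intro t ht
  rw [abs_of_nonneg (Real.rpow_nonneg t.2.1.le _), sub_zero, ← Real.rpow_add ht,
    show P.σ / 2 + (P.σ / 2 + P.δ - P.σ) = P.δ by ring]
  exact Real.rpow_le_rpow ht.le (t.2.2.trans (le_abs_self T)) h1.le

/-- The bilinear Duhamel operator on the weighted space. -/
def duhPart (T : ℝ) : WSpace T →L[ℝ] WSpace T →L[ℝ] WSpace T := (P.exists_duhPart T).choose

lemma coeff_duhPart (x y : WSpace T) (t : Ioc (0 : ℝ) T) (k : ℤ) :
    (P.duhPart T x y t).coeff k = (t : ℝ) ^ (P.σ / 2) •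
      duh P.β P.η 0 (forcing (P.ev T x) (P.ev T y)) t k :=
  (P.exists_duhPart T).choose_spec x y t k

/-- The Duhamel operator is small for short times, and also relative to a rapidly growing
exponential weight. -/
lemma norm_duhPart_le : ∃ C, 0 ≤ C ∧ ∀ (T l A : ℝ) (f g : WSpace T) (t : Ioc (0 : ℝ) T),
    2 * P.η ≤ l → 0 ≤ A →
    (∀ t' : Ioc (0 : ℝ) T, t' ≤ t → ‖f t'‖ * ‖g t'‖ ≤ A * Real.exp (l * t')) →
    ‖P.duhPart T f g t‖ ≤ C * l ^ (-P.δ) * A * Real.exp (l * t) * (t : ℝ) ^ P.δ := by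
  have h1 := P.δ_pos
  have h2 := P.hσ
  have h3 := P.hσ'
  have h4 : P.δ = (1 / 2 - P.σ) / 8 := rfl
  obtain ⟨C, hC0, hC⟩ := norm_duh_le P.hη (r := 0) (σ := P.σ) (θ := P.σ / 2 + P.δ) (γ := P.δ)
    h2 (by linarith) (by linarith) h1.le (by linarith)
  set q : ℝ := 1 - 2 * (P.σ / 2 + P.δ) - 2 * P.δ + 0 with hq
  have hq' : (0 : ℝ) + 1 / 2 < q := by linarith
  refine ⟨C * ‖bracket 0 q hq'‖, by positivity, ?_⟩
  intro T l A f g t hl hA hfg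
  have ht := t.2.1
  have hfb : ForcingBound 0 (t : ℝ) 0 P.σ l (2 ^ ((0 : ℝ) / 2) * A)
      (forcing (P.ev T f) (P.ev T g)) := by
    refine forcingBound_bilin le_rfl
      (fun k => (P.continuousOn_coeff_ev f k).mono (Ioc_subset_Ioc_right t.2.2))
      (fun k => (P.continuousOn_coeff_ev g k).mono (Ioc_subset_Ioc_right t.2.2)) ?_
    intro t' ht'
    have ht2 : t' ∈ Ioc 0 T := ⟨ht'.1, ht'.2.trans t.2.2⟩
    have e1 := P.norm_ev f ⟨t', ht2⟩
    have e2 := P.norm_ev g ⟨t', ht2⟩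
    have e3 := hfg ⟨t', ht2⟩ ht'.2
    have e4 : t' ^ (-(P.σ / 2)) * t' ^ (-(P.σ / 2)) = t' ^ (-P.σ) := by
      rw [← Real.rpow_add ht'.1]; congr 1; ring
    simp only at e1 e2 e3
    have e5 := Real.rpow_nonneg ht'.1.le (-P.σ)
    rw [e1, e2, sub_zero]
    calc _ = (‖f ⟨t', ht2⟩‖ * ‖g ⟨t', ht2⟩‖) * t' ^ (-P.σ) := by rw [← e4]; ring
      _ ≤ (A * Real.exp (l * t')) * t' ^ (-P.σ) := by gcongr
      _ = _ := by ring
  have hl0 : 0 < l := by linarith [P.hη]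
  have h5 := Real.rpow_nonneg ht.le (P.σ / 2)
  have h6 := Real.rpow_nonneg ht.le (P.δ)
  have h7 := Real.rpow_nonneg hl0.le (-P.δ)
  have hdom : ‖P.duhPart T f g t‖ ≤
      ‖(C * l ^ (-P.δ) * A * Real.exp (l * t) * (t : ℝ) ^ P.δ) • bracket 0 q hq'‖ := by
    apply Hs.norm_le_of_dominated
    intro k
    rw [norm_coeff_smul_bracket hq' (by positivity), P.coeff_duhPart, norm_smul,
      Real.norm_of_nonneg h5]
    have h8 := hC P.β 0 t l _ _ ht hl (by positivity) hfb k
    have h9 : (t : ℝ) ^ (P.σ / 2) * (t : ℝ) ^ (P.σ / 2 + P.δ - P.σ) = (t : ℝ) ^ P.δ := by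
      rw [← Real.rpow_add ht]; congr 1; ring
    rw [sub_zero, zero_div, Real.rpow_zero, one_mul] at h8
    calc _ ≤ (t : ℝ) ^ (P.σ / 2) * (C * A * (Real.exp (l * t) *
          (t : ℝ) ^ (P.σ / 2 + P.δ - P.σ) * l ^ (-P.δ)) * wt (-q) k) := by gcongr
      _ = _ := by rw [← h9]; ring
  refine hdom.trans (le_of_eq ?_)
  rw [norm_smul, Real.norm_of_nonneg (by positivity)]
  ring

lemma exists_large_weight (C Q : ℝ) :
    ∃ l, 2 * P.η ≤ l ∧ C * l ^ (-P.δ) * Q ≤ 1 / 2 := by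
  have h1 : Filter.Tendsto (fun l : ℝ => C * l ^ (-P.δ) * Q) Filter.atTop (𝓝 0) := by
    have := ((tendsto_rpow_neg_atTop P.δ_pos).const_mul C).mul_const Q
    simpa using this
  have h2 := h1.eventually (ge_mem_nhds (show (0 : ℝ) < 1 / 2 by norm_num))
  obtain ⟨l, hl1, hl2⟩ := (h2.and (Filter.eventually_ge_atTop (2 * P.η))).exists
  exact ⟨l, hl2, hl1⟩

lemma norm_exp_smul_le (l : ℝ) (w : WSpace T) (t : Ioc (0 : ℝ) T) :
    ‖Real.exp (l * t) • w t‖ ≤ Real.exp (|l| * |T|) * ‖w‖ := by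
  rw [norm_smul, Real.norm_of_nonneg (Real.exp_pos _).le]
  have h1 := w.norm_coe_le_norm t
  have h2 : l * t ≤ |l| * |T| := by
    refine (le_abs_self _).trans ?_
    rw [abs_mul, abs_of_pos t.2.1]
    gcongr
    exact t.2.2.trans (le_abs_self T)
  gcongr

/-- Multiplication by the exponential weight `e^{l t}`. -/
def expMul (T l : ℝ) : WSpace T →L[ℝ] WSpace T :=
  LinearMap.mkContinuous
    { toFun := fun w => BoundedContinuousFunction.ofNormedAddCommGroup
        (fun t : Ioc (0 : ℝ) T => Real.exp (l * t) • w t)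
        ((by fun_prop : Continuous fun t : Ioc (0 : ℝ) T => Real.exp (l * t)).smul w.continuous)
        (Real.exp (|l| * |T|) * ‖w‖) (norm_exp_smul_le l w)
      map_add' := fun w w' => by
        ext1 t
        exact smul_add (Real.exp (l * t)) (w t) (w' t)
      map_smul' := fun c w => by
        ext1 t
        exact smul_comm (Real.exp (l * t)) c (w t) }
    (Real.exp (|l| * |T|))
    (fun w => BoundedContinuousFunction.norm_ofNormedAddCommGroup_le _ (by positivity)
      (norm_exp_smul_le l w))

@[simp] lemma expMul_apply (l : ℝ) (w : WSpace T) (t : Ioc (0 : ℝ) T) :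
    expMul T l w t = Real.exp (l * t) • w t := rfl

lemma expMul_comp_neg (l : ℝ) : expMul T l * expMul T (-l) = 1 := by
  ext1 w
  apply BoundedContinuousFunction.ext
  intro t
  rw [mul_apply_eq_comp, expMul_apply, expMul_apply, smul_smul, ← Real.exp_add,
    neg_mul, add_neg_cancel, Real.exp_zero, one_smul, one_apply_eq_self]

/-- The linearised equation is uniquely solvable on any time interval, since its Duhamel term
becomes a contraction after conjugation with a rapidly growing exponential weight. -/
lemma isUnit_linearization (w w' : WSpace T) :
    IsUnit (1 + (P.duhPart T w + (P.duhPart T).flip w')) := by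
  obtain ⟨C, hC0, hC⟩ := P.norm_duhPart_le
  obtain ⟨l, hl, hlC⟩ := P.exists_large_weight C ((‖w‖ + ‖w'‖) * |T| ^ P.δ)
  have hl0 : 0 < l := by linarith [P.hη]
  set N : WSpace T →L[ℝ] WSpace T := P.duhPart T w + (P.duhPart T).flip w' with hN
  set N' : WSpace T →L[ℝ] WSpace T := expMul T (-l) * N * expMul T l with hN'
  have hle : ‖N'‖ ≤ 1 / 2 := by
    refine ContinuousLinearMap.opNorm_le_bound _ (by norm_num) fun d => ?_
    rw [BoundedContinuousFunction.norm_le (by positivity)]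
    intro t
    have e1 : N' d t = Real.exp (-l * t) •
        (P.duhPart T w (expMul T l d) t + P.duhPart T (expMul T l d) w' t) := rfl
    have e2 := hC T l (‖w‖ * ‖d‖) w (expMul T l d) t hl (by positivity) (fun t' _ => by
      rw [expMul_apply, norm_smul, Real.norm_of_nonneg (Real.exp_pos _).le]
      have := w.norm_coe_le_norm t'
      have := d.norm_coe_le_norm t'
      calc _ ≤ ‖w‖ * (Real.exp (l * t') * ‖d‖) := by gcongr
        _ = _ := by ring)
    have e3 := hC T l (‖w'‖ * ‖d‖) (expMul T l d) w' t hl (by positivity) (fun t' _ => by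
      rw [expMul_apply, norm_smul, Real.norm_of_nonneg (Real.exp_pos _).le]
      have := w'.norm_coe_le_norm t'
      have := d.norm_coe_le_norm t'
      calc _ ≤ (Real.exp (l * t') * ‖d‖) * ‖w'‖ := by gcongr
        _ = _ := by ring)
    have e4 : (t : ℝ) ^ P.δ ≤ |T| ^ P.δ :=
      Real.rpow_le_rpow t.2.1.le (t.2.2.trans (le_abs_self T)) P.δ_pos.le
    have e5 : Real.exp (-l * t) * Real.exp (l * t) = 1 := by
      rw [← Real.exp_add, neg_mul, neg_add_cancel, Real.exp_zero]
    have e6 := Real.rpow_nonneg hl0.le (-P.δ)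
    rw [e1, norm_smul, Real.norm_of_nonneg (Real.exp_pos _).le]
    calc _ ≤ Real.exp (-l * t) * (C * l ^ (-P.δ) * (‖w‖ * ‖d‖) * Real.exp (l * t) * (t : ℝ) ^ P.δ +
          C * l ^ (-P.δ) * (‖w'‖ * ‖d‖) * Real.exp (l * t) * (t : ℝ) ^ P.δ) := by
          gcongr
          exact (norm_add_le _ _).trans (add_le_add e2 e3)
      _ = (Real.exp (-l * t) * Real.exp (l * t)) *
          (C * l ^ (-P.δ) * ((‖w‖ + ‖w'‖) * (t : ℝ) ^ P.δ)) * ‖d‖ := by ring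
      _ ≤ 1 * (C * l ^ (-P.δ) * ((‖w‖ + ‖w'‖) * |T| ^ P.δ)) * ‖d‖ := by rw [e5]; gcongr
      _ ≤ _ := by rw [one_mul]; gcongr
  -- Neumann series, then the conjugation is undone
  have hu : IsUnit (1 + N') := by
    have := isUnit_one_sub_of_norm_lt_one (x := -N') (by rw [norm_neg]; linarith)
    rwa [sub_neg_eq_add] at this
  have hm := expMul_comp_neg (T := T) l
  have hm' := expMul_comp_neg (T := T) (-l)
  rw [neg_neg] at hm'
  have he : 1 + N = expMul T l * (1 + N') * expMul T (-l) := by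
    calc 1 + N = (expMul T l * expMul T (-l)) +
          (expMul T l * expMul T (-l)) * N * (expMul T l * expMul T (-l)) := by
            rw [hm, one_mul, mul_one]
      _ = _ := by rw [hN']; noncomm_ring
  rw [he]
  have u1 : IsUnit (expMul T l) := ⟨⟨expMul T l, expMul T (-l), hm, hm'⟩, rfl⟩
  have u2 : IsUnit (expMul T (-l)) := ⟨⟨expMul T (-l), expMul T l, hm', hm⟩, rfl⟩
  exact (u1.mul hu).mul u2

/-- The nonlinear map `w ↦ w + B(w, w)`; the integral equation is `nonlinMap w = linPart φ`. -/
def nonlinMap (T : ℝ) (w : WSpace T) : WSpace T := w + P.duhPart T w w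

/-- The difference `w - w'` of two points with the same image lies in the kernel of
`1 + B(w, ·) + B(·, w')`, which is invertible. -/
lemma nonlinMap_injective : Function.Injective (P.nonlinMap T) := by
  intro w w' h
  obtain ⟨u, hu⟩ := P.isUnit_linearization w w'
  have h1 : (1 + (P.duhPart T w + (P.duhPart T).flip w')) (w - w') = 0 := by
    have h2 : w + P.duhPart T w w = w' + P.duhPart T w' w' := h
    have h3 : (1 + (P.duhPart T w + (P.duhPart T).flip w')) (w - w') =
        (w + P.duhPart T w w) - (w' + P.duhPart T w' w') := by
      simp only [add_apply, one_apply_eq_self, map_sub,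
        ContinuousLinearMap.flip_apply]
      abel
    rw [h3, h2, sub_self]
  rw [← hu] at h1
  have h4 : (↑u⁻¹ * ↑u : WSpace T →L[ℝ] WSpace T) (w - w') = 0 := by
    rw [mul_apply_eq_comp, h1, map_zero]
  rw [Units.inv_mul, one_apply_eq_self] at h4
  exact sub_eq_zero.1 h4

lemma contDiff_nonlinMap : ContDiff ℝ ∞ (P.nonlinMap T) :=
  contDiff_id.add ((P.duhPart T).contDiff.clm_apply contDiff_id)

/-- By the inverse function theorem, a solution operator of the integral equation is smooth. -/
lemma contDiff_of_nonlinMap_eq {W : Hs P.s → WSpace T}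
    (hW : ∀ φ, P.nonlinMap T (W φ) = P.linPart T φ) : ContDiff ℝ ∞ W := by
  rw [contDiff_iff_contDiffAt]
  intro φ₀
  obtain ⟨u, hu⟩ := P.isUnit_linearization (W φ₀) (W φ₀)
  have hd : HasFDerivAt (P.nonlinMap T)
      ((ContinuousLinearEquiv.unitsEquiv ℝ (WSpace T) u : WSpace T ≃L[ℝ] WSpace T) :
        WSpace T →L[ℝ] WSpace T) (W φ₀) := by
    have h1 : HasFDerivAt (P.nonlinMap T) (ContinuousLinearMap.id ℝ (WSpace T) +
        ((P.duhPart T (W φ₀)).comp (ContinuousLinearMap.id ℝ (WSpace T)) +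
          (P.duhPart T).flip (W φ₀))) (W φ₀) :=
      (hasFDerivAt_id _).add ((P.duhPart T).hasFDerivAt.clm_apply (hasFDerivAt_id _))
    convert! h1 using 1
  have hc : ContDiffAt ℝ ∞ (P.nonlinMap T) (W φ₀) := P.contDiff_nonlinMap.contDiffAt
  have hs := hc.to_localInverse hd (by simp)
  have hL : ContDiffAt ℝ ∞ (fun φ => hc.localInverse hd (by simp) (P.linPart T φ)) φ₀ := by
    refine ContDiffAt.comp φ₀ ?_ (P.linPart T).contDiff.contDiffAt
    rw [← hW φ₀]
    exact hs
  refine hL.congr_of_eventuallyEq ?_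
  have hr := (hc.hasStrictFDerivAt' hd (by simp)).eventually_right_inverse
  rw [hW φ₀] at hr
  filter_upwards [(P.linPart T).continuous.continuousAt.eventually hr] with φ hφ
  apply P.nonlinMap_injective
  rw [hW]
  exact hφ.symm

lemma coeff_of_eq {w y : WSpace T} {φ : Hs P.s} (h : w = P.linPart T φ - P.duhPart T y y)
    {t : ℝ} (ht : t ∈ Ioc 0 T) (k : ℤ) :
    (P.ev T w t).coeff k = Complex.exp ((t : ℂ) * symbol P.β P.η k) * φ.coeff k -
      duh P.β P.η 0 (forcing (P.ev T y) (P.ev T y)) t k := by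
  have h1 := P.ev_apply w ⟨t, ht⟩
  simp only at h1
  rw [h1, h, BoundedContinuousFunction.sub_apply, map_smul, map_sub, Pi.smul_apply, Pi.sub_apply,
    P.coeff_linPart, P.coeff_duhPart, ← smul_sub, smul_smul, ← Real.rpow_add ht.1, neg_add_cancel,
    Real.rpow_zero, one_smul]

/-- Every mild solution of order `t^{-σ/2}` in `L²(𝕋)` comes from the weighted space. -/
lemma exists_of_mild {φ : Hs P.s} {F : ℝ → Hs 0} {A : ℝ} (hA : 0 ≤ A)
    (hc : ∀ k, ContinuousOn (fun t => (F t).coeff k) (Ioc 0 T))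
    (hb : ∀ t ∈ Ioc 0 T, ‖F t‖ ≤ A * t ^ (-(P.σ / 2)))
    (hm : ∀ t ∈ Ioc 0 T, ∀ k, (F t).coeff k =
      Complex.exp ((t : ℂ) * symbol P.β P.η k) * φ.coeff k - duh P.β P.η 0 (forcing F F) t k) :
    ∃ z : WSpace T, P.nonlinMap T z = P.linPart T φ ∧ ∀ t ∈ Ioc 0 T, P.ev T z t = F t := by
  have h1 := P.δ_pos
  have h2 := P.hσ
  have h3 := P.hσ'
  have h4 : P.δ = (1 / 2 - P.σ) / 8 := rfl
  obtain ⟨B, hB⟩ := exists_duhamel P.β P.hη (a := 0) (b := T) (r := 0) (r' := 0) (σ := P.σ)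
    (θ := P.σ / 2 + P.δ) (A := A) (A' := |T| ^ P.δ) le_rfl h2 (by linarith) (by linarith)
    (by linarith) (by linarith) (LinearMap.toSpanSingleton ℝ (ℝ → Hs 0) F) hA
    (fun x t ht => by
      rw [LinearMap.toSpanSingleton_apply, Pi.smul_apply, norm_smul, sub_zero]
      have := hb t ht
      calc _ ≤ ‖x‖ * (A * t ^ (-(P.σ / 2))) := by gcongr
        _ = _ := by ring)
    (fun x k => by
      simp only [LinearMap.toSpanSingleton_apply, Pi.smul_apply, map_smul]
      exact (hc k).const_smul x) (K := Ioc (0 : ℝ) T)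
    (τ := fun t => (t : ℝ)) (ρ := fun t => (t : ℝ) ^ (P.σ / 2)) continuous_subtype_val
    (fun t => Ioc_subset_Icc_self t.2)
    (continuous_subtype_val.rpow_const fun t => Or.inr (by linarith [P.hσ]))
    (by positivity) (fun t ht => by
      rw [abs_of_nonneg (Real.rpow_nonneg t.2.1.le _), sub_zero, ← Real.rpow_add ht,
        show P.σ / 2 + (P.σ / 2 + P.δ - P.σ) = P.δ by ring]
      exact Real.rpow_le_rpow ht.le (t.2.2.trans (le_abs_self T)) h1.le)
  set z : WSpace T := P.linPart T φ - B 1 1 with hz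
  have hev : ∀ t ∈ Ioc 0 T, P.ev T z t = F t := by
    intro t ht
    apply Hs.coeff_injective
    funext k
    have e := P.ev_apply z ⟨t, ht⟩
    simp only at e
    rw [e, hz, BoundedContinuousFunction.sub_apply, map_smul, map_sub, Pi.smul_apply, Pi.sub_apply,
      P.coeff_linPart, hB, ← smul_sub, smul_smul, ← Real.rpow_add ht.1, neg_add_cancel,
      Real.rpow_zero, one_smul, hm t ht k]
    simp only [LinearMap.toSpanSingleton_apply, one_smul]
    rfl
  refine ⟨z, ?_, hev⟩
  have hBz : P.duhPart T z z = B 1 1 := by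
    ext1 t
    apply Hs.coeff_injective
    funext k
    rw [P.coeff_duhPart, hB]
    congr 1
    refine duh_congr t.2.1.le fun t' ht' => ?_
    have ht2 : t' ∈ Ioc 0 T := ⟨ht'.1, ht'.2.trans t.2.2⟩
    simp [forcing, hev t' ht2]
  rw [nonlinMap, hBz, hz, sub_add_cancel]

end Params

/-! ### Parabolic smoothing -/

/-- The curve `t ↦ χ t • x t`, extended to all times by constants. -/
def evCurve {a b r : ℝ} (hab : a ≤ b) (χ : ℝ → ℝ) : C(Icc a b, Hs r) →ₗ[ℝ] (ℝ → Hs r) where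
  toFun x t := χ t • IccExtend hab x t
  map_add' x y := by
    funext t
    simp [IccExtend]
  map_smul' c x := by
    funext t
    simp [IccExtend, smul_comm c]

lemma evCurve_apply {a b r : ℝ} (hab : a ≤ b) (χ : ℝ → ℝ) (x : C(Icc a b, Hs r)) {t : ℝ}
    (ht : t ∈ Icc a b) : evCurve hab χ x t = χ t • x ⟨t, ht⟩ := by
  change χ t • IccExtend hab x t = _
  rw [IccExtend_of_mem hab _ ht]

/-- The Duhamel integral gains a quarter of a derivative. -/
lemma exists_duhamel_curve (β : ℝ) {η : ℝ} (hη : 0 < η) {a a' b r r' : ℝ} (haa : a ≤ a')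
    (hab : a ≤ b) (hr : 0 ≤ r) (hr' : r' ≤ r + 1 / 4) {χ : ℝ → ℝ}
    (hχ : ContinuousOn χ (Ioc a b)) (hχ1 : ∀ t ∈ Ioc a b, |χ t| ≤ 1) :
    ∃ B : C(Icc a b, Hs r) →L[ℝ] C(Icc a b, Hs r) →L[ℝ] (Icc a' b →ᵇ Hs r'),
      ∀ x y t k, (B x y t).coeff k = duh β η a
        (fun t' => bilin (evCurve hab χ x t').coeff (evCurve hab χ y t').coeff) t k := by
  -- `θ = 1/32` leaves room: the theoretical gain, of almost half a derivative, is not needed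
  obtain ⟨B, hB⟩ := exists_duhamel β hη (a := a) (b := b) (r := r) (r' := r') (σ := 0)
    (θ := 1 / 32) (A := 1) (A' := (b - a) ^ (1 / 32 : ℝ)) hr le_rfl one_pos (by norm_num)
    (by norm_num) (by linarith) (evCurve hab χ) zero_le_one
    (fun x t ht => by
      rw [evCurve_apply hab χ x (Ioc_subset_Icc_self ht), norm_smul, Real.norm_eq_abs, zero_div,
        neg_zero, Real.rpow_zero, mul_one]
      exact mul_le_mul (hχ1 t ht) (x.norm_coe_le_norm _) (norm_nonneg _) zero_le_one)
    (fun x k => by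
      have h1 : ContinuousOn (fun t => (IccExtend hab x t).coeff k) (Ioc a b) :=
        ((Hs.continuous_coeff k).comp (x.continuous.Icc_extend')).continuousOn
      have h2 : (fun t => (evCurve hab χ x t).coeff k) =
          fun t => χ t • (IccExtend hab x t).coeff k := by
        funext t
        change (χ t • IccExtend hab x t).coeff k = _
        rw [map_smul, Pi.smul_apply]
      rw [h2]
      exact hχ.smul h1)
    (K := Icc a' b) (τ := fun t => (t : ℝ)) (ρ := fun _ => 1) continuous_subtype_val
    (fun t => ⟨haa.trans t.2.1, t.2.2⟩) continuous_const
    (Real.rpow_nonneg (by linarith) _) (fun t ht => by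
      rw [abs_one, one_mul, sub_zero]
      exact Real.rpow_le_rpow (by linarith) (by linarith [t.2.2]) (by norm_num))
  exact ⟨B, fun x y t k => by rw [hB, one_smul]⟩

/-- Bounded continuous functions on a compact space as continuous maps. -/
def bcfToC (a b r : ℝ) : (Icc a b →ᵇ Hs r) →L[ℝ] C(Icc a b, Hs r) :=
  ((ContinuousMap.linearIsometryBoundedOfCompact (Icc a b) (Hs r) ℝ).symm :
    (Icc a b →ᵇ Hs r) →L[ℝ] C(Icc a b, Hs r))

@[simp] lemma bcfToC_apply {a b r : ℝ} (f : Icc a b →ᵇ Hs r) (t : Icc a b) :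
    bcfToC a b r f t = f t := rfl

/-- A mild solution depending smoothly on a parameter gains a quarter of a derivative at
later times, and still depends smoothly on the parameter. -/
lemma smoothing_step {β η : ℝ} (hη : 0 < η) {a a' b r r' : ℝ} (haa : a < a')
    (hab : a ≤ b) (hr : 0 ≤ r) (hr' : r' ≤ r + 1 / 4) {χ : ℝ → ℝ}
    (hχ : ContinuousOn χ (Ioc a b)) (hχ1 : ∀ t ∈ Ioc a b, |χ t| ≤ 1)
    {X : Type*} [NormedAddCommGroup X] [NormedSpace ℝ X] {Ψ : X → C(Icc a b, Hs r)}
    (hΨ : ContDiff ℝ ∞ Ψ) {U : X → ℝ → ℤ → ℂ} (hU : ∀ x t, (Ψ x t).coeff = U x t)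
    (hm : ∀ x, ∀ t ∈ Icc a b, ∀ k, U x t k =
      Complex.exp (((t - a : ℝ) : ℂ) * symbol β η k) * U x a k -
        duh β η a (fun t' => bilin (χ t' • U x t') (χ t' • U x t')) t k) :
    ∃ Ψ' : X → C(Icc a' b, Hs r'), ContDiff ℝ ∞ Ψ' ∧ ∀ x t, (Ψ' x t).coeff = U x t := by
  obtain ⟨B, hB⟩ := exists_duhamel_curve β hη (r' := r') haa.le hab hr hr' hχ hχ1
  obtain ⟨C, hC0, hC⟩ := norm_exp_symbol_le hη (m := max 0 (r' - r)) (le_max_left _ _)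
  set m := max 0 (r' - r) with hmdef
  have ha0 : 0 < a' - a := by linarith
  obtain ⟨S, hS⟩ := exists_semigroup β η (s := r) (r := r')
    (C := C * Real.exp (2 * η * (b - a)) * (a' - a) ^ (-(m / 2)))
    (by positivity) (K := Icc a' b) (τ := fun t => (t : ℝ) - a) (ρ := fun _ => 1)
    (by fun_prop) continuous_const (fun t k => by
      have ht : 0 < (t : ℝ) - a := by linarith [t.2.1]
      have h1 := hC β _ ht k
      have h2 : wt (-m) k ≤ wt (r - r') k :=
        wt_mono (by linarith [le_max_right 0 (r' - r)]) k
      have h3 : Real.exp (2 * η * ((t : ℝ) - a)) ≤ Real.exp (2 * η * (b - a)) := by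
        gcongr; exact t.2.2
      have h4 : ((t : ℝ) - a) ^ (-(m / 2)) ≤ (a' - a) ^ (-(m / 2)) :=
        Real.rpow_le_rpow_of_nonpos ha0 (by linarith [t.2.1])
          (by linarith [le_max_left 0 (r' - r)])
      have h5 := wt_pos (-m) k
      have h6 := Real.rpow_nonneg ht.le (-(m / 2))
      rw [abs_one, one_mul]
      exact h1.trans (by gcongr))
  have ha : a ∈ Icc a b := ⟨le_rfl, hab⟩
  refine ⟨fun x => bcfToC a' b r' (S (Ψ x ⟨a, ha⟩) - B (Ψ x) (Ψ x)), ?_, ?_⟩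
  · refine (bcfToC a' b r').contDiff.comp (ContDiff.sub ?_ ?_)
    · let L : C(Icc a b, Hs r) →L[ℝ] Hs r := ContinuousMap.evalCLM ℝ ⟨a, ha⟩
      have he : ContDiff ℝ ∞ fun x => L (Ψ x) := L.contDiff.comp hΨ
      exact S.contDiff.comp he
    · exact (B.contDiff.comp hΨ).clm_apply hΨ
  · intro x t
    funext k
    have ht : (t : ℝ) ∈ Icc a b := ⟨haa.le.trans t.2.1, t.2.2⟩
    rw [bcfToC_apply, BoundedContinuousFunction.sub_apply, map_sub, Pi.sub_apply, hS, hB, one_smul,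
      hU, hm x t ht k]
    congr 1
    refine duh_congr ht.1 fun t' ht' => ?_
    rw [evCurve_apply hab χ _ ⟨ht'.1.le, ht'.2.trans ht.2⟩, map_smul, hU]

namespace Params

variable (P : Params) {T : ℝ}

lemma intervalIntegrable_forcing (y : WSpace T) {t : ℝ} (ht : t ∈ Icc 0 T) (k : ℤ) :
    IntervalIntegrable (fun t' => forcing (P.ev T y) (P.ev T y) t' k) volume 0 t := by
  have hfb : ForcingBound 0 t 0 P.σ 0 (2 ^ ((0 : ℝ) / 2) * (‖y‖ * ‖y‖))
      (forcing (P.ev T y) (P.ev T y)) := by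
    refine forcingBound_bilin le_rfl
      (fun k => (P.continuousOn_coeff_ev y k).mono (Ioc_subset_Ioc_right ht.2))
      (fun k => (P.continuousOn_coeff_ev y k).mono (Ioc_subset_Ioc_right ht.2)) ?_
    intro t' ht'
    have e := P.norm_ev_le y (t := t') ⟨ht'.1, ht'.2.trans ht.2⟩
    have e4 : t' ^ (-(P.σ / 2)) * t' ^ (-(P.σ / 2)) = t' ^ (-P.σ) := by
      rw [← Real.rpow_add ht'.1]; congr 1; ring
    rw [sub_zero, one_mul] at e
    rw [sub_zero, zero_mul, Real.exp_zero, one_mul, ← e4]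
    have := Real.rpow_nonneg ht'.1.le (-(P.σ / 2))
    calc _ ≤ (‖y‖ * t' ^ (-(P.σ / 2))) * (‖y‖ * t' ^ (-(P.σ / 2))) := by gcongr
      _ = _ := by ring
  exact hfb.intervalIntegrable ht.1 (by linarith [P.hσ']) le_rfl (by positivity) k

lemma mild_restart {w y : WSpace T} {φ : Hs P.s} (h : w = P.linPart T φ - P.duhPart T y y)
    {a t : ℝ} (ha : 0 < a) (hat : a ≤ t) (ht : t ≤ T) (k : ℤ) :
    (P.ev T w t).coeff k =
      Complex.exp (((t - a : ℝ) : ℂ) * symbol P.β P.η k) * (P.ev T w a).coeff k -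
      duh P.β P.η a (forcing (P.ev T y) (P.ev T y)) t k := by
  rw [P.coeff_of_eq h ⟨ha.trans_le hat, ht⟩, P.coeff_of_eq h ⟨ha, hat.trans ht⟩]
  have i1 := P.intervalIntegrable_forcing y (t := a) ⟨ha.le, hat.trans ht⟩ k
  have i2 := P.intervalIntegrable_forcing y (t := t) ⟨ha.le.trans hat, ht⟩ k
  rw [duh_restart i1 (i1.symm.trans i2), mul_sub, ← mul_assoc, ← Complex.exp_add]
  have : ((t - a : ℝ) : ℂ) * symbol P.β P.η k + (a : ℂ) * symbol P.β P.η k =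
      (t : ℂ) * symbol P.β P.η k := by push_cast; ring
  rw [this]
  ring

/-- Restriction of the functions of the weighted space to times away from zero. -/
def restrictPart (T ε : ℝ) (hε : 0 < ε) : WSpace T →L[ℝ] C(Icc ε T, Hs 0) :=
  LinearMap.mkContinuous
    { toFun := fun w => ⟨fun t => P.ev T w t, by
        have := (P.continuousOn_ev w).mono
          (show Icc ε T ⊆ Ioc 0 T from fun t ht => ⟨hε.trans_le ht.1, ht.2⟩)
        exact continuousOn_iff_continuous_domRestrict.1 this⟩
      map_add' := fun w w' => by
        ext1 t
        change P.ev T (w + w') t = P.ev T w t + P.ev T w' t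
        rw [map_add, Pi.add_apply]
      map_smul' := fun c w => by
        ext1 t
        change P.ev T (c • w) t = c • P.ev T w t
        rw [map_smul, Pi.smul_apply] }
    (ε ^ (-(P.σ / 2)))
    (fun w => by
      rw [ContinuousMap.norm_le _ (by positivity)]
      intro t
      have h1 := P.norm_ev_le w (t := t) ⟨hε.trans_le t.2.1, t.2.2⟩
      have h2 : (t : ℝ) ^ (-(P.σ / 2)) ≤ ε ^ (-(P.σ / 2)) :=
        Real.rpow_le_rpow_of_nonpos hε t.2.1 (by linarith [P.hσ])
      rw [sub_zero, one_mul, mul_comm] at h1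
      exact h1.trans (by gcongr))

/-- Away from time zero, a family of mild solutions depending smoothly on a parameter in the
weighted space depends smoothly on it in every Sobolev space. The scalar factor `χ` in front of
the nonlinearity is `1` for the original equation, and a cut-off in the construction of global
solutions. -/
lemma exists_contDiff_curve {X : Type*} [NormedAddCommGroup X] [NormedSpace ℝ X]
    {w y : X → WSpace T} (hw : ContDiff ℝ ∞ w) {χ : ℝ → ℝ} (hχ : ContinuousOn χ (Ioc 0 T))
    (hχ1 : ∀ t ∈ Ioc 0 T, |χ t| ≤ 1) (hy : ∀ x t, y x t = χ t • w x t) {φ : X → Hs P.s}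
    (h : ∀ x, w x = P.linPart T (φ x) - P.duhPart T (y x) (y x)) (r : ℝ) {ε : ℝ} (hε : 0 < ε)
    (hεT : ε ≤ T) : ∃ Ψ : X → C(Icc ε T, Hs r), ContDiff ℝ ∞ Ψ ∧
      ∀ x t, (Ψ x t).coeff = (P.ev T (w x) t).coeff := by
  have hm : ∀ a, 0 < a → ∀ x, ∀ t ∈ Icc a T, ∀ k, (P.ev T (w x) t).coeff k =
      Complex.exp (((t - a : ℝ) : ℂ) * symbol P.β P.η k) * (P.ev T (w x) a).coeff k -
        duh P.β P.η a (fun t' => bilin (χ t' • (P.ev T (w x) t').coeff)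
          (χ t' • (P.ev T (w x) t').coeff)) t k := by
    intro a ha x t ht k
    rw [P.mild_restart (h x) ha ht.1 ht.2]
    congr 1
    refine duh_congr ht.1 fun t' ht' => ?_
    have ht2 : t' ∈ Ioc 0 T := ⟨ha.trans ht'.1, ht'.2.trans ht.2⟩
    have e1 : P.ev T (y x) t' = χ t' • P.ev T (w x) t' := by
      have e2 := P.ev_apply (y x) ⟨t', ht2⟩
      have e3 := P.ev_apply (w x) ⟨t', ht2⟩
      simp only at e2 e3
      rw [e2, e3, hy, smul_comm]
    simp only [forcing, e1, map_smul]
  have step : ∀ r r' : ℝ, 0 ≤ r → r' ≤ r + 1 / 4 →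
      (∀ ε, 0 < ε → ε ≤ T → ∃ Ψ : X → C(Icc ε T, Hs r), ContDiff ℝ ∞ Ψ ∧
        ∀ x t, (Ψ x t).coeff = (P.ev T (w x) t).coeff) →
      ∀ ε, 0 < ε → ε ≤ T → ∃ Ψ : X → C(Icc ε T, Hs r'), ContDiff ℝ ∞ Ψ ∧
        ∀ x t, (Ψ x t).coeff = (P.ev T (w x) t).coeff := by
    intro r r' hr hr' ih ε hε hεT
    obtain ⟨Ψ, hΨ, hU⟩ := ih (ε / 2) (by linarith) (by linarith)
    have hsub : Ioc (ε / 2) T ⊆ Ioc 0 T := Ioc_subset_Ioc_left (by linarith)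
    exact smoothing_step P.hη (by linarith : ε / 2 < ε) (by linarith) hr hr' (hχ.mono hsub)
      (fun t ht => hχ1 t (hsub ht)) hΨ (U := fun x t => (P.ev T (w x) t).coeff) hU
      (hm (ε / 2) (by linarith))
  have level : ∀ n : ℕ, ∀ ε, 0 < ε → ε ≤ T → ∃ Ψ : X → C(Icc ε T, Hs (n / 4 : ℝ)),
      ContDiff ℝ ∞ Ψ ∧ ∀ x t, (Ψ x t).coeff = (P.ev T (w x) t).coeff := by
    intro n
    induction n with
    | zero =>
      rw [Nat.cast_zero, zero_div]
      intro ε hε _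
      exact ⟨fun x => P.restrictPart T ε hε (w x), (P.restrictPart T ε hε).contDiff.comp hw,
        fun x t => rfl⟩
    | succ n ih =>
      refine step _ _ (by positivity) ?_ ih
      push_cast; linarith
  obtain ⟨n, hn⟩ := exists_nat_ge (4 * r)
  exact step _ r (by positivity) (by linarith) (level n) ε hε hεT

end Params

/-! ### Decay of the `L²` norm -/

lemma wt_neg_le_one {r : ℝ} (hr : 0 ≤ r) (k : ℤ) : wt (-r) k ≤ 1 := by
  rw [← wt_zero k]; exact wt_mono (by linarith) k

/-- The conservation law `∫ f · f f_x dz = 0`: the sum over the triples `a + b + c = 0` of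
`a f̂ₐ f̂_b f̂_c` vanishes by symmetry. -/
lemma tsum_conj_mul_bilin (f : Hs 3) :
    ∑' k, (starRingEnd ℂ) (f.coeff k) * bilin f.coeff f.coeff k = 0 := by
  set g : ℤ × ℤ → ℂ := fun p =>
    (p.1 : ℂ) * (f.coeff (-p.1) * (f.coeff p.2 * f.coeff (p.1 - p.2))) with hg
  have hgs : Summable g := by
    have h1 : Summable fun p : ℤ × ℤ => (‖f‖ ^ 3 * wt (-2) p.1) * wt (-3) p.2 :=
      ((summable_wt (by norm_num : (1 : ℝ) < 2)).mul_left _).mul_of_nonneg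
        (summable_wt (by norm_num : (1 : ℝ) < 3))
        (fun k => mul_nonneg (by positivity) (wt_pos _ _).le) (fun k => (wt_pos _ _).le)
    refine Summable.of_norm_bounded h1 fun p => ?_
    have e1 := f.norm_coeff_le (-p.1)
    have e2 := f.norm_coeff_le p.2
    have e3 : ‖f.coeff (p.1 - p.2)‖ ≤ ‖f‖ := (f.norm_coeff_le _).trans
      (mul_le_of_le_one_right (norm_nonneg _) (wt_neg_le_one (by norm_num) _))
    have e4 := abs_le_wt_one p.1
    have e5 : wt (-2) p.1 = wt 1 p.1 * wt (-3) p.1 := by rw [← wt_add]; norm_num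
    rw [wt_neg_arg] at e1
    have w1 := wt_pos 1 p.1
    have w2 := wt_pos (-3) p.1
    have w3 := wt_pos (-3) p.2
    simp only [hg, norm_mul, Complex.norm_intCast]
    calc _ ≤ wt 1 p.1 * ((‖f‖ * wt (-3) p.1) * ((‖f‖ * wt (-3) p.2) * ‖f‖)) := by gcongr
      _ = _ := by rw [e5]; ring
  -- two substitutions which permute the frequencies `-k`, `j` and `k - j`
  let e₁ : ℤ × ℤ ≃ ℤ × ℤ := Function.Involutive.toPerm (fun p => (-p.2, -p.1))
    (fun p => by simp)
  let e₂ : ℤ × ℤ ≃ ℤ × ℤ := Function.Involutive.toPerm (fun p => (p.2 - p.1, p.2))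
    (fun p => by simp)
  have hsum : ∑' p, g p = 0 := by
    have s1 : Summable fun p => g (e₁ p) := e₁.summable_iff.2 hgs
    have s2 : Summable fun p => g (e₂ p) := e₂.summable_iff.2 hgs
    have t1 := e₁.tsum_eq g
    have t2 := e₂.tsum_eq g
    have h0 : ∀ p, g p + (g (e₁ p) + g (e₂ p)) = 0 := by
      rintro ⟨k, j⟩
      change (k : ℂ) * (f.coeff (-k) * (f.coeff j * f.coeff (k - j))) +
        (((-j : ℤ) : ℂ) * (f.coeff (-(-j)) * (f.coeff (-k) * f.coeff (-j - -k))) +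
          ((j - k : ℤ) : ℂ) * (f.coeff (-(j - k)) * (f.coeff j * f.coeff (j - k - j)))) = 0
      rw [neg_neg, show -j - -k = k - j by ring, show -(j - k) = k - j by ring,
        show j - k - j = -k by ring]
      push_cast; ring
    have h1 : ∑' p, (g p + (g (e₁ p) + g (e₂ p))) = 0 := by simp only [h0, tsum_zero]
    rw [hgs.tsum_add (s1.add s2), s1.tsum_add s2, t1, t2] at h1
    have h3 : (3 : ℂ) * ∑' p, g p = 0 := by rw [← h1]; ring
    simpa using h3
  have hk : ∀ k, (starRingEnd ℂ) (f.coeff k) * bilin f.coeff f.coeff k =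
      Complex.I / 2 * ∑' j, g (k, j) := by
    intro k
    simp only [hg]
    rw [← f.coeff_neg, tsum_mul_left, tsum_mul_left]
    unfold bilin
    ring
  simp only [hk]
  rw [tsum_mul_left, ← hgs.tsum_prod, hsum, mul_zero]

lemma continuous_bilin {v : ℝ → Hs 3} (hv : Continuous v) {M : ℝ} (hM : ∀ t, ‖v t‖ ≤ M) (k : ℤ) :
    Continuous fun t => bilin (v t).coeff (v t).coeff k := by
  unfold bilin
  refine continuous_const.mul ?_
  have hM0 : 0 ≤ M := (norm_nonneg _).trans (hM 0)
  refine continuous_tsum (u := fun j => M ^ 2 * wt (-3) j) (fun j =>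
    ((Hs.continuous_coeff j).comp hv).mul ((Hs.continuous_coeff (k - j)).comp hv))
    ((summable_wt (by norm_num)).mul_left _) fun j t => ?_
  have e2 := (v t).norm_coeff_le j
  have e3 : ‖(v t).coeff (k - j)‖ ≤ ‖v t‖ := ((v t).norm_coeff_le _).trans
    (mul_le_of_le_one_right (norm_nonneg _) (wt_neg_le_one (by norm_num) _))
  have := hM t
  have w3 := wt_pos (-3) j
  rw [norm_mul]
  calc _ ≤ (M * wt (-3) j) * M := by gcongr; exacts [e2.trans (by gcongr), e3.trans this]
    _ = _ := by ring

lemma norm_conj_mul_bilin_le (f : Hs 3) {M : ℝ} (hM : ‖f‖ ≤ M) (k : ℤ) :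
    ‖(starRingEnd ℂ) (f.coeff k) * bilin f.coeff f.coeff k‖ ≤
      M ^ 3 * 2 ^ ((3 : ℝ) / 2) * wt (-2) k := by
  have e1 := f.norm_coeff_le k
  have e2 := norm_bilin_le (by norm_num) f f k
  have e3 := abs_le_wt_one k
  have e4 : wt (-2) k = wt 1 k * wt (-3) k := by rw [← wt_add]; norm_num
  have e5 := wt_neg_le_one (r := 3) (by norm_num) k
  have w1 := wt_pos 1 k
  have w2 := wt_pos (-3) k
  have hM0 := (norm_nonneg f).trans hM
  rw [norm_mul, RCLike.norm_conj]
  calc _ ≤ (M * wt (-3) k) * (wt 1 k * (2 ^ ((3 : ℝ) / 2) * 1 * (M * M))) := by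
        gcongr
        · exact e1.trans (by gcongr)
        · exact e2.trans (by gcongr)
    _ = _ := by rw [e4]; ring

/-- The `L²` norm of a regular mild solution does not grow, because the dissipation symbol is
nonnegative on the integers. -/
lemma tsum_sq_le_of_mild {β η : ℝ} (hη : 0 < η) {v : ℝ → Hs 3} (hv : Continuous v) {M : ℝ}
    (hM : ∀ t, ‖v t‖ ≤ M) {χ : ℝ → ℝ} (hχ : Continuous χ) (hχ1 : ∀ t, |χ t| ≤ 1) {a b : ℝ}
    (hab : a ≤ b)
    (hm : ∀ t ∈ Icc a b, ∀ k, (v t).coeff k =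
      Complex.exp (((t - a : ℝ) : ℂ) * symbol β η k) * (v a).coeff k -
        duh β η a (fun t' => bilin (χ t' • (v t').coeff) (χ t' • (v t').coeff)) t k) :
    ∑' k, ‖(v b).coeff k‖ ^ 2 ≤ ∑' k, ‖(v a).coeff k‖ ^ 2 := by
  set N : ℝ → ℤ → ℂ := fun t' => bilin (χ t' • (v t').coeff) (χ t' • (v t').coeff) with hN
  have hNeq : ∀ t k, N t k = ((χ t ^ 2 : ℝ) : ℂ) * bilin (v t).coeff (v t).coeff k := by
    intro t k
    simp only [hN]
    rw [bilin_smul_left, bilin_smul_right, smul_smul, Complex.real_smul, sq]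
  have hNc : ∀ k, Continuous fun t => N t k := by
    intro k
    simp only [hNeq]
    exact (Complex.continuous_ofReal.comp (hχ.pow 2)).mul (continuous_bilin hv hM k)
  -- on `[a,b]` this is the coefficient of `v`; unlike the latter it is differentiable at all times
  set u : ℤ → ℝ → ℂ := fun k t => Complex.exp (((t - a : ℝ) : ℂ) * symbol β η k) *
    ((v a).coeff k - ∫ t' in a..t, Complex.exp (((a - t' : ℝ) : ℂ) * symbol β η k) * N t' k)
    with hu
  have huv : ∀ t ∈ Icc a b, ∀ k, u k t = (v t).coeff k := by
    intro t ht k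
    rw [hm t ht k, duh_eq_mul (c := a)]
    simp only [hu]; ring
  have hud : ∀ k t, HasDerivAt (u k) (symbol β η k * u k t - N t k) t := by
    intro k t
    have hc : Continuous fun t' : ℝ =>
        Complex.exp (((a - t' : ℝ) : ℂ) * symbol β η k) * N t' k :=
      Continuous.mul (by fun_prop) (hNc k)
    have d1 := (hc.integral_hasStrictDerivAt a t).hasDerivAt
    have d2 : HasDerivAt (fun t : ℝ => Complex.exp (((t - a : ℝ) : ℂ) * symbol β η k))
        (Complex.exp (((t - a : ℝ) : ℂ) * symbol β η k) * (((1 : ℝ) : ℂ) * symbol β η k)) t :=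
      ((((hasDerivAt_id t).sub_const a).ofReal_comp).mul_const _).cexp
    have d3 := d2.mul (d1.const_sub ((v a).coeff k))
    convert! d3 using 1
    have e1 : Complex.exp (((t - a : ℝ) : ℂ) * symbol β η k) *
        (Complex.exp (((a - t : ℝ) : ℂ) * symbol β η k) * N t k) = N t k := by
      rw [← mul_assoc, ← Complex.exp_add]
      have : ((t - a : ℝ) : ℂ) * symbol β η k + ((a - t : ℝ) : ℂ) * symbol β η k = 0 := by
        push_cast; ring
      rw [this, Complex.exp_zero, one_mul]
    rw [mul_neg, e1]
    simp only [hu, Complex.ofReal_one]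
    ring
  set D : ℤ → ℝ := fun k => M ^ 3 * 2 ^ ((3 : ℝ) / 2) * wt (-2) k with hD
  have hDs : Summable D := (summable_wt (by norm_num)).mul_left _
  -- the energy of finitely many modes can grow only by the part of the cancelling sum outside of
  -- `S`, and this tends to zero along the finite sets `S`
  have hfin : ∀ S : Finset ℤ, ∑ k ∈ S, ‖(v b).coeff k‖ ^ 2 ≤
      ∑ k ∈ S, ‖(v a).coeff k‖ ^ 2 + 2 * (∑' k : {k // k ∉ S}, D k) * (b - a) := by
    intro S
    set E : ℝ := ∑' k : {k // k ∉ S}, D k with hE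
    have hE0 : 0 ≤ E := tsum_nonneg fun k =>
      (norm_nonneg _).trans (norm_conj_mul_bilin_le (v a) (hM a) k)
    set e : ℝ → ℝ := fun t => ∑ k ∈ S, ‖u k t‖ ^ 2 with he
    have hed : ∀ t, HasDerivAt e
        (∑ k ∈ S, 2 * inner ℝ (u k t) (symbol β η k * u k t - N t k)) t :=
      fun t => HasDerivAt.fun_sum fun k _ => (hud k t).norm_sq
    have hle : ∀ t ∈ Icc a b,
        ∑ k ∈ S, 2 * inner ℝ (u k t) (symbol β η k * u k t - N t k) ≤ 2 * E := by
      intro t ht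
      have hterm : ∀ k, inner ℝ (u k t) (symbol β η k * u k t - N t k) ≤
          -(χ t ^ 2 * ((starRingEnd ℂ) ((v t).coeff k) * bilin (v t).coeff (v t).coeff k).re) := by
        intro k
        rw [inner_sub_right, Complex.inner, Complex.inner, hNeq, huv t ht]
        have e1 : ((starRingEnd ℂ) ((v t).coeff k) * (symbol β η k * (v t).coeff k)).re =
            -(η * ((k : ℝ) ^ 2 - |(k : ℝ)|)) * Complex.normSq ((v t).coeff k) := by
          have : (starRingEnd ℂ) ((v t).coeff k) * (symbol β η k * (v t).coeff k) =
              symbol β η k * ((Complex.normSq ((v t).coeff k) : ℝ) : ℂ) := by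
            rw [Complex.normSq_eq_conj_mul_self]; ring
          rw [this, Complex.re_mul_ofReal]
          congr 1
          unfold symbol
          rw [Complex.sub_re, Complex.ofReal_re, Complex.re_mul_ofReal, Complex.I_re]
          ring
        have e2 : ((starRingEnd ℂ) ((v t).coeff k) *
            (((χ t ^ 2 : ℝ) : ℂ) * bilin (v t).coeff (v t).coeff k)).re =
            χ t ^ 2 * ((starRingEnd ℂ) ((v t).coeff k) * bilin (v t).coeff (v t).coeff k).re := by
          rw [mul_left_comm, Complex.re_ofReal_mul]
        have e3 := mul_nonneg (dissipation_nonneg hη k) (Complex.normSq_nonneg ((v t).coeff k))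
        rw [mul_comm (symbol β η k * _), mul_comm (((χ t ^ 2 : ℝ) : ℂ) * _), e1, e2]
        linarith
      have hz := tsum_conj_mul_bilin (v t)
      have hsm : Summable fun k =>
          (starRingEnd ℂ) ((v t).coeff k) * bilin (v t).coeff (v t).coeff k :=
        Summable.of_norm_bounded hDs fun k => norm_conj_mul_bilin_le (v t) (hM t) k
      have htail : -(∑ k ∈ S,
          (starRingEnd ℂ) ((v t).coeff k) * bilin (v t).coeff (v t).coeff k) =
          ∑' k : {k // k ∉ S},
            (starRingEnd ℂ) ((v t).coeff k) * bilin (v t).coeff (v t).coeff k := by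
        have := hsm.sum_add_tsum_subtype_compl S
        rw [hz] at this
        exact neg_eq_of_add_eq_zero_right this
      have hn : ‖∑' k : {k // k ∉ S},
          (starRingEnd ℂ) ((v t).coeff k) * bilin (v t).coeff (v t).coeff k‖ ≤ E :=
        tsum_of_norm_bounded (hDs.subtype _).hasSum
          fun k => norm_conj_mul_bilin_le (v t) (hM t) k
      have hχ2 : χ t ^ 2 ≤ 1 := by
        rw [← sq_abs]; exact pow_le_one₀ (abs_nonneg _) (hχ1 t)
      calc _ ≤ ∑ k ∈ S, 2 * -(χ t ^ 2 *
            ((starRingEnd ℂ) ((v t).coeff k) * bilin (v t).coeff (v t).coeff k).re) := by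
            gcongr with k _; exact hterm k
        _ = 2 * (χ t ^ 2 * (-(∑ k ∈ S,
            (starRingEnd ℂ) ((v t).coeff k) * bilin (v t).coeff (v t).coeff k)).re) := by
            rw [Complex.neg_re, Complex.re_sum, ← Finset.mul_sum, Finset.sum_neg_distrib,
              ← Finset.mul_sum]
            ring
        _ ≤ 2 * (χ t ^ 2 * E) := by
            gcongr
            rw [htail]
            exact (Complex.re_le_norm _).trans hn
        _ ≤ 2 * (1 * E) := by gcongr
        _ = 2 * E := by ring
    have hmono := (convex_Icc a b).image_sub_le_mul_sub_of_deriv_le (f := e) (C := 2 * E)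
      (fun t _ => (hed t).continuousAt.continuousWithinAt)
      (fun t _ => (hed t).differentiableAt.differentiableWithinAt)
      (fun t ht => by
        rw [(hed t).deriv]
        exact hle t (interior_subset ht)) a ⟨le_rfl, hab⟩ b ⟨hab, le_rfl⟩ hab
    have ha : e a = ∑ k ∈ S, ‖(v a).coeff k‖ ^ 2 :=
      Finset.sum_congr rfl fun k _ => by rw [huv a ⟨le_rfl, hab⟩]
    have hb : e b = ∑ k ∈ S, ‖(v b).coeff k‖ ^ 2 :=
      Finset.sum_congr rfl fun k _ => by rw [huv b ⟨hab, le_rfl⟩]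
    rw [ha, hb] at hmono
    linarith
  have hsq : ∀ t, Summable fun k => ‖(v t).coeff k‖ ^ 2 := by
    intro t
    refine (v t).summable_sq.of_nonneg_of_le (fun k => sq_nonneg _) fun k => ?_
    have h1 : 1 ≤ wt 3 k := by rw [← wt_zero k]; exact wt_mono (by norm_num) k
    exact pow_le_pow_left₀ (norm_nonneg _) (le_mul_of_one_le_left (norm_nonneg _) h1) 2
  have hla : Filter.Tendsto (fun S : Finset ℤ => ∑ k ∈ S, ‖(v a).coeff k‖ ^ 2) Filter.atTop
      (𝓝 (∑' k, ‖(v a).coeff k‖ ^ 2)) := (hsq a).hasSum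
  have hlim := hla.add (((tendsto_tsum_compl_atTop_zero D).const_mul 2).mul_const (b - a))
  rw [mul_zero, zero_mul, add_zero] at hlim
  exact le_of_tendsto_of_tendsto' (hsq b).hasSum hlim hfin

/-! ### Global solutions -/

section Cutoff

variable {E : Type*} [NormedAddCommGroup E]

/-- The factor of the radial projection onto the ball of radius `R`. -/
def cutFactor (R : ℝ) (x : E) : ℝ := R / max R ‖x‖

lemma cutFactor_nonneg {R : ℝ} (hR : 0 < R) (x : E) : 0 ≤ cutFactor R x :=
  div_nonneg hR.le (hR.le.trans (le_max_left _ _))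

lemma cutFactor_le_one {R : ℝ} (hR : 0 < R) (x : E) : cutFactor R x ≤ 1 :=
  div_le_one_of_le₀ (le_max_left _ _) (hR.le.trans (le_max_left _ _))

lemma cutFactor_eq_one {R : ℝ} (hR : 0 < R) {x : E} (hx : ‖x‖ ≤ R) : cutFactor R x = 1 := by
  rw [cutFactor, max_eq_left hx, div_self hR.ne']

variable [NormedSpace ℝ E]

lemma norm_cutFactor_smul_le {R : ℝ} (hR : 0 < R) (x : E) : ‖cutFactor R x • x‖ ≤ R := by
  have h : 0 < max R ‖x‖ := hR.trans_le (le_max_left _ _)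
  rw [norm_smul, Real.norm_of_nonneg (cutFactor_nonneg hR x), cutFactor, div_mul_eq_mul_div,
    div_le_iff₀ h]
  gcongr
  exact le_max_right _ _

lemma norm_cutFactor_smul_sub_le {R : ℝ} (hR : 0 < R) (x y : E) :
    ‖cutFactor R x • x - cutFactor R y • y‖ ≤ 2 * ‖x - y‖ := by
  have hx : 0 < max R ‖x‖ := hR.trans_le (le_max_left _ _)
  have hy : 0 < max R ‖y‖ := hR.trans_le (le_max_left _ _)
  have e1 : cutFactor R x • x - cutFactor R y • y =
      cutFactor R x • (x - y) + (cutFactor R x - cutFactor R y) • y := by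
    rw [smul_sub, sub_smul]; abel
  have e2 : cutFactor R x - cutFactor R y =
      cutFactor R x * ((max R ‖y‖ - max R ‖x‖) / max R ‖y‖) := by
    unfold cutFactor; field_simp
  have e3 : |max R ‖y‖ - max R ‖x‖| ≤ ‖x - y‖ := by
    refine (abs_max_sub_max_le_max R ‖y‖ R ‖x‖).trans ?_
    rw [sub_self, abs_zero, max_eq_right (abs_nonneg _), norm_sub_rev]
    exact abs_norm_sub_norm_le y x
  have h1 := cutFactor_nonneg hR x
  have h2 := cutFactor_le_one hR x
  have e4 : ‖y‖ / max R ‖y‖ ≤ 1 := div_le_one_of_le₀ (le_max_right _ _) hy.le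
  rw [e1]
  refine (norm_add_le _ _).trans ?_
  rw [norm_smul, norm_smul, e2, norm_mul, norm_div, Real.norm_of_nonneg h1, Real.norm_of_nonneg hy.le,
    Real.norm_eq_abs]
  calc _ = cutFactor R x * ‖x - y‖ +
        cutFactor R x * (|max R ‖y‖ - max R ‖x‖| * (‖y‖ / max R ‖y‖)) := by ring
    _ ≤ 1 * ‖x - y‖ + 1 * (‖x - y‖ * 1) := by gcongr
    _ = _ := by ring

end Cutoff

variable {T : ℝ}

/-- The pointwise radial projection onto the balls of radius `R t`. -/
def cutoff (R : C(Ioc (0 : ℝ) T, ℝ)) (hR : ∀ t, 0 < R t) (w : WSpace T) : WSpace T :=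
  BoundedContinuousFunction.ofNormedAddCommGroup (fun t => cutFactor (R t) (w t) • w t)
    (Continuous.smul (M := ℝ) (R.continuous.div (R.continuous.max w.continuous.norm)
      fun t => ((hR t).trans_le (le_max_left _ _)).ne') w.continuous)
    ‖w‖ (fun t => by
      rw [norm_smul, Real.norm_of_nonneg (cutFactor_nonneg (hR t) _)]
      exact (mul_le_of_le_one_left (norm_nonneg _) (cutFactor_le_one (hR t) _)).trans
        (w.norm_coe_le_norm t))

lemma cutoff_apply (R : C(Ioc (0 : ℝ) T, ℝ)) (hR : ∀ t, 0 < R t) (w : WSpace T)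
    (t : Ioc (0 : ℝ) T) : cutoff R hR w t = cutFactor (R t) (w t) • w t := rfl

namespace Params

variable (P : Params)

/-- The equation with truncated nonlinearity has a global Lipschitz nonlinearity, so it can be
solved on any time interval by the contraction principle in an exponentially weighted norm. -/
lemma exists_cutoff_solution (R : C(Ioc (0 : ℝ) T, ℝ)) (hR : ∀ t, 0 < R t) {R₀ : ℝ}
    (hR₀ : 0 ≤ R₀) (hRR : ∀ t, R t ≤ R₀) (f : WSpace T) :
    ∃ w, w = f - P.duhPart T (cutoff R hR w) (cutoff R hR w) := by
  obtain ⟨C, hC0, hC⟩ := P.norm_duhPart_le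
  obtain ⟨l, hl, hlC⟩ := P.exists_large_weight C (4 * R₀ * |T| ^ P.δ)
  have hl0 : 0 < l := by linarith [P.hη]
  set S : WSpace T → WSpace T := fun w => f - P.duhPart T (cutoff R hR w) (cutoff R hR w) with hS
  have key : ContractingWith (1 / 2) (fun x => expMul T (-l) (S (expMul T l x))) := by
    refine ⟨by rw [← NNReal.coe_lt_coe]; norm_num, LipschitzWith.of_dist_le_mul fun x y => ?_⟩
    rw [dist_eq_norm, dist_eq_norm, BoundedContinuousFunction.norm_le (by positivity)]
    intro t
    set a := cutoff R hR (expMul T l x) with ha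
    set b := cutoff R hR (expMul T l y) with hb
    have e1 : (expMul T (-l) (S (expMul T l x)) - expMul T (-l) (S (expMul T l y))) t =
        Real.exp (-l * t) • (P.duhPart T (b - a) b t + P.duhPart T a (b - a) t) := by
      rw [← map_sub, expMul_apply]
      congr 1
      have : S (expMul T l x) - S (expMul T l y) =
          P.duhPart T (b - a) b + P.duhPart T a (b - a) := by
        simp only [hS, ← ha, ← hb, map_sub, sub_apply]
        abel
      rw [this, BoundedContinuousFunction.add_apply]
    have hab : ∀ t', ‖(b - a) t'‖ ≤ 2 * ‖x - y‖ * Real.exp (l * t') := by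
      intro t'
      rw [BoundedContinuousFunction.sub_apply, ha, hb, cutoff_apply, cutoff_apply]
      refine (norm_cutFactor_smul_sub_le (hR t') _ _).trans ?_
      rw [expMul_apply, expMul_apply, ← smul_sub, norm_smul,
        Real.norm_of_nonneg (Real.exp_pos _).le, norm_sub_rev]
      have := (x - y).norm_coe_le_norm t'
      rw [BoundedContinuousFunction.sub_apply] at this
      calc _ ≤ 2 * (Real.exp (l * t') * ‖x - y‖) := by gcongr
        _ = _ := by ring
    have ha' : ∀ t', ‖a t'‖ ≤ R₀ := fun t' => (norm_cutFactor_smul_le (hR t') _).trans (hRR t')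
    have hb' : ∀ t', ‖b t'‖ ≤ R₀ := fun t' => (norm_cutFactor_smul_le (hR t') _).trans (hRR t')
    have e2 := hC T l (2 * ‖x - y‖ * R₀) (b - a) b t hl (by positivity) (fun t' _ => by
      calc _ ≤ (2 * ‖x - y‖ * Real.exp (l * t')) * R₀ :=
            mul_le_mul (hab t') (hb' t') (norm_nonneg _) (by positivity)
        _ = _ := by ring)
    have e3 := hC T l (2 * ‖x - y‖ * R₀) a (b - a) t hl (by positivity) (fun t' _ => by
      calc _ ≤ R₀ * (2 * ‖x - y‖ * Real.exp (l * t')) :=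
            mul_le_mul (ha' t') (hab t') (norm_nonneg _) hR₀
        _ = _ := by ring)
    have e4 : (t : ℝ) ^ P.δ ≤ |T| ^ P.δ :=
      Real.rpow_le_rpow t.2.1.le (t.2.2.trans (le_abs_self T)) P.δ_pos.le
    have e5 : Real.exp (-l * t) * Real.exp (l * t) = 1 := by
      rw [← Real.exp_add, neg_mul, neg_add_cancel, Real.exp_zero]
    have e6 := Real.rpow_nonneg hl0.le (-P.δ)
    rw [e1, norm_smul, Real.norm_of_nonneg (Real.exp_pos _).le]
    calc _ ≤ Real.exp (-l * t) *
          (C * l ^ (-P.δ) * (2 * ‖x - y‖ * R₀) * Real.exp (l * t) * (t : ℝ) ^ P.δ +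
          C * l ^ (-P.δ) * (2 * ‖x - y‖ * R₀) * Real.exp (l * t) * (t : ℝ) ^ P.δ) := by
          gcongr
          exact (norm_add_le _ _).trans (add_le_add e2 e3)
      _ = (Real.exp (-l * t) * Real.exp (l * t)) *
          (C * l ^ (-P.δ) * (4 * R₀ * (t : ℝ) ^ P.δ)) * ‖x - y‖ := by ring
      _ ≤ 1 * (C * l ^ (-P.δ) * (4 * R₀ * |T| ^ P.δ)) * ‖x - y‖ := by rw [e5]; gcongr
      _ ≤ 1 / 2 * ‖x - y‖ := by rw [one_mul]; gcongr
      _ = _ := by simp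
  set x := key.fixedPoint with hx
  have hfix : expMul T (-l) (S (expMul T l x)) = x := key.fixedPoint_isFixedPt
  refine ⟨expMul T l x, ?_⟩
  change _ = S (expMul T l x)
  conv_lhs => rw [← hfix, ← mul_apply_eq_comp, expMul_comp_neg, one_apply_eq_self]

/-- The `L²` norm of a solution of the truncated equation does not grow: the truncation
multiplies the nonlinearity by a scalar function of time, and does not affect the cancellation. -/
lemma norm_ev_le_of_cutoff (R : C(Ioc (0 : ℝ) T, ℝ)) (hR : ∀ t, 0 < R t) {w : WSpace T}
    {φ : Hs P.s}
    (h : w = P.linPart T φ - P.duhPart T (cutoff R hR w) (cutoff R hR w)) {τ t : ℝ}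
    (hτ : 0 < τ) (hτt : τ ≤ t) (ht : t ≤ T) : ‖P.ev T w t‖ ≤ ‖P.ev T w τ‖ := by
  classical
  have hτT := hτt.trans ht
  set χ : ℝ → ℝ := fun t =>
    if h : t ∈ Ioc 0 T then cutFactor (R ⟨t, h⟩) (w ⟨t, h⟩) else 0 with hχdef
  have hχ_apply : ∀ t : Ioc (0 : ℝ) T, χ t = cutFactor (R t) (w t) := fun t => by
    simp only [hχdef]; rw [dif_pos t.2]
  have hχ : ContinuousOn χ (Ioc 0 T) := by
    rw [continuousOn_iff_continuous_domRestrict]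
    have : (Ioc 0 T).domRestrict χ = fun t => cutFactor (R t) (w t) := funext hχ_apply
    rw [this]
    exact R.continuous.div (R.continuous.max w.continuous.norm)
      fun t => ((hR t).trans_le (le_max_left _ _)).ne'
  have hχ1 : ∀ t ∈ Ioc 0 T, |χ t| ≤ 1 := fun t ht => by
    have := hχ_apply ⟨t, ht⟩
    simp only at this
    rw [this, abs_of_nonneg (cutFactor_nonneg (hR _) _)]
    exact cutFactor_le_one (hR _) _
  have hy : ∀ t, cutoff R hR w t = χ t • w t := fun t => by rw [cutoff_apply, hχ_apply]
  obtain ⟨Ψ, -, hΨ⟩ := P.exists_contDiff_curve (X := ℝ) (w := fun _ => w)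
    (y := fun _ => cutoff R hR w) contDiff_const hχ hχ1 (fun _ => hy) (φ := fun _ => φ)
    (fun _ => h) 3 hτ hτT
  set v : ℝ → Hs 3 := IccExtend hτT (Ψ 0) with hv
  have hvt : ∀ t' ∈ Icc τ T, (v t').coeff = (P.ev T w t').coeff := fun t' ht' => by
    rw [hv, IccExtend_of_mem hτT _ ht', hΨ]
  set χ' : ℝ → ℝ := IccExtend hτT (fun t => χ t) with hχ'
  have hsub : ∀ t' ∈ Icc τ T, t' ∈ Ioc 0 T := fun t' ht' => ⟨hτ.trans_le ht'.1, ht'.2⟩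
  have hχ't : ∀ t' ∈ Icc τ T, χ' t' = χ t' := fun t' ht' => by
    rw [hχ', IccExtend_of_mem hτT _ ht']
  have hmain := tsum_sq_le_of_mild (β := P.β) P.hη (v := v) (Ψ 0).continuous.Icc_extend'
    (M := ‖Ψ 0‖) (fun t' => (Ψ 0).norm_coe_le_norm _) (χ := χ')
    (continuousOn_iff_continuous_domRestrict.1 (hχ.mono hsub)).Icc_extend'
    (fun t' => hχ1 _ (hsub _ (projIcc τ T hτT t').2)) hτt (by
      intro t' ht' k
      have ht2 : t' ∈ Icc τ T := ⟨ht'.1, ht'.2.trans ht⟩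
      rw [hvt t' ht2, hvt τ ⟨le_rfl, hτT⟩, P.mild_restart h hτ ht'.1 ht2.2]
      congr 1
      refine duh_congr ht'.1 fun r hr => ?_
      have hr2 : r ∈ Icc τ T := ⟨hr.1.le, hr.2.trans ht2.2⟩
      have e1 : P.ev T (cutoff R hR w) r = χ r • P.ev T w r := by
        have e2 := P.ev_apply (cutoff R hR w) ⟨r, hsub r hr2⟩
        have e3 := P.ev_apply w ⟨r, hsub r hr2⟩
        simp only at e2 e3
        rw [e2, e3, hy, smul_comm]
      rw [hvt r hr2, hχ't r hr2]
      simp only [forcing, e1, map_smul])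
  rw [hvt t ⟨hτt, ht⟩, hvt τ ⟨le_rfl, hτT⟩] at hmain
  apply le_of_sq_le_sq _ (norm_nonneg _)
  rw [Hs.norm_sq_eq, Hs.norm_sq_eq]
  simp only [wt_zero, one_mul]
  gcongr

/-- The equation is solvable on every time interval. A solution of the truncated equation obeys
the truncation: for short times by the smallness of the Duhamel term, and afterwards since the
`L²` norm does not grow. -/
theorem exists_solution (hT : 0 < T) (φ : Hs P.s) :
    ∃ w, P.nonlinMap T w = P.linPart T φ := by
  obtain ⟨C, hC0, hC⟩ := P.norm_duhPart_le
  have hη := P.hη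
  set M : ℝ := ‖P.linPart T φ‖ + 1 with hM
  have hM0 : 0 < M := by positivity
  obtain ⟨τ, hτ0, hτT, hτ⟩ : ∃ τ, 0 < τ ∧ τ ≤ T ∧
      C * (2 * P.η) ^ (-P.δ) * (M * M) * Real.exp (2 * P.η * T) * τ ^ P.δ ≤ 1 := by
    have h1 : Filter.Tendsto (fun τ : ℝ => C * (2 * P.η) ^ (-P.δ) * (M * M) *
        Real.exp (2 * P.η * T) * τ ^ P.δ) (𝓝[>] 0) (𝓝 0) := by
      have h2 : ContinuousAt (fun τ : ℝ => τ ^ P.δ) 0 :=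
        Real.continuousAt_rpow_const 0 _ (Or.inr P.δ_pos.le)
      have h3 := (h2.tendsto.mono_left (nhdsWithin_le_nhds (s := Ioi 0))).const_mul
        (C * (2 * P.η) ^ (-P.δ) * (M * M) * Real.exp (2 * P.η * T))
      rwa [Real.zero_rpow P.δ_pos.ne', mul_zero] at h3
    have h4 := h1.eventually (ge_mem_nhds (show (0 : ℝ) < 1 by norm_num))
    obtain ⟨τ, ha, hb⟩ := (h4.and (Ioc_mem_nhdsGT hT)).exists
    exact ⟨τ, hb.1, hb.2, ha⟩
  have hσ2 : 0 ≤ P.σ / 2 := by linarith [P.hσ]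
  -- in terms of `u t = t^{-σ/2} w t`, the cutoff at times `t ≥ τ` acts where `‖u t‖` exceeds
  -- `M τ^{-σ/2}`, a bound for `‖u τ‖`
  let R : C(Ioc (0 : ℝ) T, ℝ) := ⟨fun t => M * max 1 (((t : ℝ) / τ) ^ (P.σ / 2)), by
    refine continuous_const.mul (continuous_const.max ?_)
    exact (continuous_subtype_val.div_const τ).rpow_const fun _ => Or.inr hσ2⟩
  have hRt : ∀ t, R t = M * max 1 (((t : ℝ) / τ) ^ (P.σ / 2)) := fun t => rfl
  have hR : ∀ t, 0 < R t := fun t =>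
    mul_pos hM0 (zero_lt_one.trans_le (le_max_left _ _))
  have hRR : ∀ t, R t ≤ M * max 1 ((T / τ) ^ (P.σ / 2)) := fun t => by
    have h1 : 0 ≤ (t : ℝ) / τ := div_nonneg t.2.1.le hτ0.le
    have h2 := t.2.2
    rw [hRt]
    gcongr
  obtain ⟨w, hw⟩ := P.exists_cutoff_solution R hR
    (mul_nonneg hM0.le (zero_le_one.trans (le_max_left _ _))) hRR (P.linPart T φ)
  have hshort : ∀ t : Ioc (0 : ℝ) T, (t : ℝ) ≤ τ → ‖w t‖ ≤ M := by
    intro t ht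
    have e1 := hC T (2 * P.η) (M * M) (cutoff R hR w) (cutoff R hR w) t le_rfl (by positivity)
      (fun t' htt => by
        have h1 : R t' = M := by
          have h2 : ((t' : ℝ) / τ) ^ (P.σ / 2) ≤ 1 := by
            refine Real.rpow_le_one (div_nonneg t'.2.1.le hτ0.le) ?_ hσ2
            exact div_le_one_of_le₀ (le_trans htt ht) hτ0.le
          rw [hRt, max_eq_left h2, mul_one]
        have h3 : ‖cutoff R hR w t'‖ ≤ M := by
          rw [← h1]; exact norm_cutFactor_smul_le (hR t') _
        have h4 : 1 ≤ Real.exp (2 * P.η * t') :=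
          Real.one_le_exp (mul_nonneg (by linarith) t'.2.1.le)
        calc _ ≤ M * M := by gcongr
          _ ≤ _ := le_mul_of_one_le_right (by positivity) h4)
    have e2 : ‖w t‖ ≤ ‖P.linPart T φ‖ +
        ‖P.duhPart T (cutoff R hR w) (cutoff R hR w) t‖ := by
      have : w t = P.linPart T φ t - P.duhPart T (cutoff R hR w) (cutoff R hR w) t :=
        congrArg (fun z : WSpace T => z t) hw
      rw [this]
      exact (norm_sub_le _ _).trans (by gcongr; exact (P.linPart T φ).norm_coe_le_norm t)
    refine e2.trans ?_
    rw [hM]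
    gcongr
    refine (e1.trans ?_).trans hτ
    have h1 := t.2.1
    have h2 := t.2.2
    have h3 := P.δ_pos
    gcongr
  have hle : ∀ t, ‖w t‖ ≤ R t := by
    intro t
    rcases le_total (t : ℝ) τ with ht | ht
    · refine (hshort t ht).trans ?_
      rw [hRt]
      exact le_mul_of_one_le_right hM0.le (le_max_left _ _)
    · have e1 := P.norm_ev_le_of_cutoff R hR hw hτ0 ht t.2.2
      have e2 := P.norm_ev w ⟨τ, hτ0, hτT⟩
      have e3 := hshort ⟨τ, hτ0, hτT⟩ le_rfl
      rw [P.norm_ev w t] at e1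
      simp only at e2
      rw [e2] at e1
      have h1 := t.2.1
      have h2 : (t : ℝ) ^ (P.σ / 2) * (t : ℝ) ^ (-(P.σ / 2)) = 1 := by
        rw [← Real.rpow_add h1, add_neg_cancel, Real.rpow_zero]
      have h3 := Real.rpow_nonneg h1.le (P.σ / 2)
      have h4 := Real.rpow_nonneg hτ0.le (-(P.σ / 2))
      rw [hRt]
      calc ‖w t‖ = (t : ℝ) ^ (P.σ / 2) * ((t : ℝ) ^ (-(P.σ / 2)) * ‖w t‖) := by
            rw [← mul_assoc, h2, one_mul]
        _ ≤ (t : ℝ) ^ (P.σ / 2) * (τ ^ (-(P.σ / 2)) * M) := by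
            exact mul_le_mul_of_nonneg_left (e1.trans (mul_le_mul_of_nonneg_left e3 h4)) h3
        _ = M * ((t : ℝ) / τ) ^ (P.σ / 2) := by
            rw [Real.div_rpow h1.le hτ0.le, Real.rpow_neg hτ0.le]; ring
        _ ≤ _ := by gcongr; exact le_max_right _ _
  have hcut : cutoff R hR w = w := by
    ext1 t
    rw [cutoff_apply, cutFactor_eq_one (hR t) (hle t), one_smul]
  rw [hcut] at hw
  refine ⟨w, ?_⟩
  rw [nonlinMap]
  nth_rewrite 1 [hw]
  abel

/-- The solution operator of the integral equation on `(0,T]`, in the weighted space. -/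
def flow (hT : 0 < T) (φ : Hs P.s) : WSpace T := (P.exists_solution hT φ).choose

lemma nonlinMap_flow (hT : 0 < T) (φ : Hs P.s) :
    P.nonlinMap T (P.flow hT φ) = P.linPart T φ := (P.exists_solution hT φ).choose_spec

lemma contDiff_flow (hT : 0 < T) : ContDiff ℝ ∞ (P.flow hT) :=
  P.contDiff_of_nonlinMap_eq (P.nonlinMap_flow hT)

lemma flow_eq (hT : 0 < T) (φ : Hs P.s) :
    P.flow hT φ = P.linPart T φ - P.duhPart T (P.flow hT φ) (P.flow hT φ) :=
  eq_sub_of_add_eq (P.nonlinMap_flow hT φ)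

/-- A mild solution of order `t^{-σ/2}` in `L²(𝕋)` is given by the solution operator. -/
lemma ev_flow_eq_of_mild (hT : 0 < T) {φ : Hs P.s} {F : ℝ → Hs 0} {A : ℝ} (hA : 0 ≤ A)
    (hc : ∀ k, ContinuousOn (fun t => (F t).coeff k) (Ioc 0 T))
    (hb : ∀ t ∈ Ioc 0 T, ‖F t‖ ≤ A * t ^ (-(P.σ / 2)))
    (hm : ∀ t ∈ Ioc 0 T, ∀ k, (F t).coeff k =
      Complex.exp ((t : ℂ) * symbol P.β P.η k) * φ.coeff k - duh P.β P.η 0 (forcing F F) t k)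
    {t : ℝ} (ht : t ∈ Ioc 0 T) : P.ev T (P.flow hT φ) t = F t := by
  obtain ⟨z, hz, hzF⟩ := P.exists_of_mild hA hc hb hm
  rw [← hzF t ht, P.nonlinMap_injective (hz.trans (P.nonlinMap_flow hT φ).symm)]

end Params

/-! ### The flow map as a curve in `H^s` -/

lemma contDiff_bilinear_diag {X E F : Type*} [NormedAddCommGroup X] [NormedSpace ℝ X]
    [NormedAddCommGroup E] [NormedSpace ℝ E] [NormedAddCommGroup F] [NormedSpace ℝ F]
    (B : E →L[ℝ] E →L[ℝ] F) {f : X → E} (hf : ContDiff ℝ ∞ f) :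
    ContDiff ℝ ∞ fun x => B (f x) (f x) :=
  (B.contDiff.comp hf).clm_apply hf

namespace Params

variable (P : Params)

/-- The Fourier coefficients at time `t ∈ [0,T]` of the solution with initial value `φ`. -/
def solCoeff {T : ℝ} (hT : 0 < T) (φ : Hs P.s) (t : ℝ) (k : ℤ) : ℂ :=
  Complex.exp ((t : ℂ) * symbol P.β P.η k) * φ.coeff k -
    duh P.β P.η 0 (forcing (P.ev T (P.flow hT φ)) (P.ev T (P.flow hT φ))) t k

variable {T : ℝ} (hT : 0 < T)

lemma coeff_ev_flow (φ : Hs P.s) {t : ℝ} (ht : t ∈ Ioc 0 T) :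
    (P.ev T (P.flow hT φ) t).coeff = P.solCoeff hT φ t :=
  funext fun k => P.coeff_of_eq (P.flow_eq hT φ) ht k

/-- The free evolution as a continuous curve in `H^r(𝕋)`, for `r ≤ s`. -/
lemma exists_linCurve (T : ℝ) {r : ℝ} (hr : r ≤ P.s) :
    ∃ S : Hs P.s →L[ℝ] (Icc 0 T →ᵇ Hs r), ∀ φ t k, (S φ t).coeff k =
      Complex.exp (((t : ℝ) : ℂ) * symbol P.β P.η k) * φ.coeff k := by
  obtain ⟨S, hS⟩ := exists_semigroup P.β P.η (s := P.s) (r := r) (C := 1) zero_le_one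
    (K := Icc 0 T) (τ := fun t => (t : ℝ)) (ρ := fun _ => 1) continuous_subtype_val
    continuous_const (fun t k => by
      rw [abs_one]
      have h1 : 1 ≤ wt (P.s - r) k := by rw [← wt_zero k]; exact wt_mono (by linarith) k
      exact mul_le_mul le_rfl ((norm_exp_symbol_le_one P.hη t.2.1 k).trans h1) (norm_nonneg _)
        zero_le_one)
  exact ⟨S, fun φ t k => by rw [hS, one_smul]⟩

/-- The Duhamel term as a continuous curve in `H^r(𝕋)`, for `r ≤ -σ`. -/
lemma exists_duhCurve (T : ℝ) {r : ℝ} (hr : r ≤ -P.σ) :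
    ∃ B : WSpace T →L[ℝ] WSpace T →L[ℝ] (Icc 0 T →ᵇ Hs r), ∀ x y t k, (B x y t).coeff k =
      duh P.β P.η 0 (forcing (P.ev T x) (P.ev T y)) t k := by
  have h1 := P.δ_pos
  have h2 := P.hσ
  have h3 := P.hσ'
  have h4 : P.δ = (1 / 2 - P.σ) / 8 := rfl
  obtain ⟨B, hB⟩ := exists_duhamel P.β P.hη (a := 0) (b := T) (r := 0) (r' := r) (σ := P.σ)
    (θ := P.σ + P.δ) (A := 1) (A' := |T| ^ P.δ) le_rfl h2 (by linarith) (by linarith)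
    (by linarith) (by linarith) (P.ev T) zero_le_one
    (fun x t ht => P.norm_ev_le x ht) P.continuousOn_coeff_ev (K := Icc (0 : ℝ) T)
    (τ := fun t => (t : ℝ)) (ρ := fun _ => 1) continuous_subtype_val
    (fun t => t.2) continuous_const (by positivity) (fun t ht => by
      rw [abs_one, one_mul, sub_zero, add_sub_cancel_left]
      exact Real.rpow_le_rpow ht.le (t.2.2.trans (le_abs_self T)) h1.le)
  exact ⟨B, fun x y t k => by rw [hB, one_smul]; rfl⟩

/-- For `s < 0` and `σ = -s`, the case `r = s` is the flow map with values in
`C([0,T]; H^s(𝕋))`. -/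
lemma exists_flowCurve_of_le_neg {r : ℝ} (hr : r ≤ -P.σ) :
    ∃ Φ : Hs P.s → C(Icc 0 T, Hs r), ContDiff ℝ ∞ Φ ∧
      ∀ φ t, (Φ φ t).coeff = P.solCoeff hT φ t := by
  obtain ⟨S, hS⟩ := P.exists_linCurve T (hr.trans P.hs)
  obtain ⟨B, hB⟩ := P.exists_duhCurve T hr
  refine ⟨fun φ => bcfToC 0 T r (S φ - B (P.flow hT φ) (P.flow hT φ)), ?_, fun φ t => ?_⟩
  · exact (bcfToC 0 T r).contDiff.comp (S.contDiff.sub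
      (contDiff_bilinear_diag B (P.contDiff_flow hT)))
  · funext k
    rw [bcfToC_apply, BoundedContinuousFunction.sub_apply, map_sub, Pi.sub_apply, hS, hB]
    rfl

/-- For `s ≥ 0` the regularity of the curve is raised in steps of a quarter derivative, up to
the regularity of the initial value. -/
lemma exists_flowCurve_of_nonneg (hs : 0 ≤ P.s) (hσ : P.σ = 0) :
    ∃ Φ : Hs P.s → C(Icc 0 T, Hs P.s), ContDiff ℝ ∞ Φ ∧
      ∀ φ t, (Φ φ t).coeff = P.solCoeff hT φ t := by
  have level : ∀ n : ℕ, ∀ r ≤ P.s, r ≤ n / 4 → ∃ Φ : Hs P.s → C(Icc 0 T, Hs r),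
      ContDiff ℝ ∞ Φ ∧ ∀ φ t, (Φ φ t).coeff = P.solCoeff hT φ t := by
    intro n
    induction n with
    | zero =>
      intro r _ hr
      refine P.exists_flowCurve_of_le_neg hT ?_
      rw [hσ, neg_zero]; simpa using hr
    | succ n ih =>
      intro r hrs hr
      have hr0 : 0 ≤ min P.s ((n : ℝ) / 4) := le_min hs (by positivity)
      have hr1 : r ≤ min P.s ((n : ℝ) / 4) + 1 / 4 := by
        push_cast at hr
        rw [min_def]; split_ifs <;> linarith
      obtain ⟨Φ, hΦ, hc⟩ := ih (min P.s (n / 4)) (min_le_left _ _) (min_le_right _ _)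
      obtain ⟨S, hS⟩ := P.exists_linCurve T hrs
      obtain ⟨B, hB⟩ := exists_duhamel_curve P.β P.hη (r' := r) (le_refl (0 : ℝ)) hT.le hr0 hr1
        (χ := fun _ => 1) continuousOn_const (fun t _ => by rw [abs_one])
      refine ⟨fun φ => bcfToC 0 T r (S φ - B (Φ φ) (Φ φ)), ?_, fun φ t => ?_⟩
      · exact (bcfToC 0 T r).contDiff.comp (S.contDiff.sub
          (contDiff_bilinear_diag B hΦ))
      · funext k
        rw [bcfToC_apply, BoundedContinuousFunction.sub_apply, map_sub, Pi.sub_apply, hS, hB,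
          solCoeff]
        congr 1
        refine duh_congr t.2.1 fun t' ht' => ?_
        have ht2 : t' ∈ Ioc 0 T := ⟨ht'.1, ht'.2.trans t.2.2⟩
        rw [evCurve_apply hT.le _ _ (Ioc_subset_Icc_self ht2), one_smul, hc]
        simp only [forcing, P.coeff_ev_flow hT φ ht2]
  obtain ⟨n, hn⟩ := exists_nat_ge (4 * P.s)
  exact level n P.s le_rfl (by linarith)

end Params

/-! ### The space `X_T^s` -/

/-- The pairs of a curve in `H^s(𝕋)` and a function of the weighted space that represent the
same function of time. -/
def compatible (s : ℝ) (T : PosTime) : Submodule ℝ (Curve s T × WSpace T.1) where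
  carrier := {p | ∀ t, (p.2 t).coeff = (t : ℝ) ^ (|s| / 2) • (p.1 (posToIcc t)).coeff}
  add_mem' := by
    intro p q hp hq t
    simp [hp t, hq t]
  zero_mem' := by
    intro t
    simp
  smul_mem' := by
    intro c p hp t
    simp only [Prod.smul_fst, Prod.smul_snd, BoundedContinuousFunction.smul_apply,
      ContinuousMap.smul_apply, map_smul, hp t]
    exact smul_comm _ _ _

lemma compatible_xPair {s : ℝ} {T : PosTime} (p : Curve s T × WSpace T.1)
    (t : Ioc (0 : ℝ) T.1) :
    xPair s T (p.1, fun t => (t : ℝ) ^ (-(|s| / 2)) • p.2 t) t =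
      WithLp.toLp 1 (p.1 (posToIcc t), p.2 t) := by
  change WithLp.toLp 1 (p.1 (posToIcc t), (t : ℝ) ^ (|s| / 2) •
    ((t : ℝ) ^ (-(|s| / 2)) • p.2 t)) = _
  rw [smul_smul, ← Real.rpow_add t.2.1, add_neg_cancel, Real.rpow_zero, one_smul]

lemma norm_compatible_xPair_le {s : ℝ} {T : PosTime} (p : Curve s T × WSpace T.1)
    (t : Ioc (0 : ℝ) T.1) :
    ‖xPair s T (p.1, fun t => (t : ℝ) ^ (-(|s| / 2)) • p.2 t) t‖ ≤ 2 * ‖p‖ := by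
  rw [compatible_xPair, WithLp.prod_norm_eq_of_L1]
  have h1 := (p.1.norm_coe_le_norm (posToIcc t)).trans (norm_fst_le p)
  have h2 := (p.2.norm_coe_le_norm t).trans (norm_snd_le p)
  change ‖p.1 (posToIcc t)‖ + ‖p.2 t‖ ≤ _
  linarith

/-- A compatible pair as an element of `X_T^s`. -/
def compatibleToX (s : ℝ) (T : PosTime) : compatible s T →L[ℝ] XSpace s T :=
  LinearMap.mkContinuous
    { toFun := fun p => (⟨(p.1.1, fun t => (t : ℝ) ^ (-(|s| / 2)) • p.1.2 t),
        fun t => by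
          rw [map_smul, p.2 t, smul_smul, ← Real.rpow_add t.2.1, neg_add_cancel, Real.rpow_zero,
            one_smul],
        memℓp_infty ⟨2 * ‖p.1‖, by rintro _ ⟨t, rfl⟩; exact norm_compatible_xPair_le p.1 t⟩⟩ :
          xSubmodule s T)
      map_add' := fun p q => Subtype.ext (Prod.ext rfl (funext fun t =>
        smul_add ((t : ℝ) ^ (-(|s| / 2))) (p.1.2 t) (q.1.2 t)))
      map_smul' := fun c p => Subtype.ext (Prod.ext rfl (funext fun t =>
        smul_comm ((t : ℝ) ^ (-(|s| / 2))) c (p.1.2 t))) }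
    2 (fun p => lp.norm_le_of_forall_le (by positivity) fun t => norm_compatible_xPair_le p.1 t)

lemma toCurve_compatibleToX {s : ℝ} {T : PosTime} (p : compatible s T) :
    (compatibleToX s T p).toCurve = p.1.1 := rfl

/-- Two bounded bilinear maps whose pairs of values lie in a submodule combine to a bounded
bilinear map into it. -/
lemma exists_bilinear_submodule {X Y Z : Type*} [NormedAddCommGroup X] [NormedSpace ℝ X]
    [NormedAddCommGroup Y] [NormedSpace ℝ Y] [NormedAddCommGroup Z] [NormedSpace ℝ Z]
    (V : Submodule ℝ (Y × Z)) (B₁ : X →L[ℝ] X →L[ℝ] Y) (B₂ : X →L[ℝ] X →L[ℝ] Z)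
    (h : ∀ x y, (B₁ x y, B₂ x y) ∈ V) :
    ∃ B : X →L[ℝ] X →L[ℝ] V, ∀ x y, (B x y : Y × Z) = (B₁ x y, B₂ x y) := by
  let B₀ : X →ₗ[ℝ] X →ₗ[ℝ] V := LinearMap.mk₂ ℝ (fun x y => ⟨(B₁ x y, B₂ x y), h x y⟩)
    (fun x x' y => Subtype.ext (by simp)) (fun c x y => Subtype.ext (by simp))
    (fun x y y' => Subtype.ext (by simp)) (fun c x y => Subtype.ext (by simp))
  refine ⟨B₀.mkContinuous₂ (‖B₁‖ + ‖B₂‖) fun x y => ?_, fun x y => rfl⟩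
  have h1 := B₁.le_opNorm₂ x y
  have h2 := B₂.le_opNorm₂ x y
  have h3 : 0 ≤ ‖B₁‖ * ‖x‖ * ‖y‖ := by positivity
  have h4 : 0 ≤ ‖B₂‖ * ‖x‖ * ‖y‖ := by positivity
  change max ‖B₁ x y‖ ‖B₂ x y‖ ≤ _
  rw [add_mul, add_mul]
  exact max_le (by linarith) (by linarith)

namespace Params

variable (P : Params)

/-- For `s < 0` the flow map is smooth with values in `X_T^s`. -/
lemma exists_flowX (T : PosTime) (hσ : P.σ = |P.s|) (hs : P.s < 0) :
    ∃ Ψ : Hs P.s → XSpace P.s T, ContDiff ℝ ∞ Ψ ∧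
      ∀ φ t, ((Ψ φ).toCurve t).coeff = P.solCoeff T.2 φ t := by
  obtain ⟨S, hS⟩ := P.exists_linCurve T.1 le_rfl
  obtain ⟨B, hB⟩ := P.exists_duhCurve T.1 (r := P.s) (by rw [hσ, abs_of_neg hs, neg_neg])
  let S₁ : Hs P.s →L[ℝ] Curve P.s T := (bcfToC 0 T.1 P.s).comp S
  let B₁ : WSpace T.1 →L[ℝ] WSpace T.1 →L[ℝ] Curve P.s T :=
    (ContinuousLinearMap.compL ℝ (WSpace T.1) _ _ (bcfToC 0 T.1 P.s)).comp B
  have hS₁ : ∀ φ t, S₁ φ t = S φ t := fun φ t => rfl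
  have hB₁ : ∀ x y t, B₁ x y t = B x y t := fun x y t => rfl
  let L : Hs P.s →L[ℝ] compatible P.s T := (S₁.prod (P.linPart T.1)).codRestrict _ fun φ t => by
    funext k
    change (P.linPart T.1 φ t).coeff k = ((t : ℝ) ^ (|P.s| / 2) • (S₁ φ (posToIcc t)).coeff) k
    rw [coeff_linPart, Pi.smul_apply, hS₁, hS, hσ]
    rfl
  obtain ⟨D, hD⟩ := exists_bilinear_submodule (compatible P.s T) B₁ (P.duhPart T.1)
    fun x y t => by
      funext k
      change (P.duhPart T.1 x y t).coeff k =
        ((t : ℝ) ^ (|P.s| / 2) • (B₁ x y (posToIcc t)).coeff) k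
      rw [coeff_duhPart, Pi.smul_apply, hB₁, hB, hσ]
      rfl
  refine ⟨fun φ => compatibleToX P.s T (L φ - D (P.flow T.2 φ) (P.flow T.2 φ)), ?_, fun φ t => ?_⟩
  · exact (compatibleToX P.s T).contDiff.comp (L.contDiff.sub
      (contDiff_bilinear_diag (F := compatible P.s T) D (P.contDiff_flow T.2)))
  · funext k
    rw [toCurve_compatibleToX, Submodule.coe_sub, Prod.fst_sub, hD, ContinuousMap.sub_apply,
      map_sub, Pi.sub_apply]
    change (S₁ φ t).coeff k - _ = _
    rw [hS₁, hB₁, hS, hB]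
    rfl

/-! ### Uniqueness -/

/-- The forcing term of a curve of distributions. -/
def curveForcing {s : ℝ} {T : PosTime} (u : Curve s T) : ℝ → ℤ → ℂ :=
  fun t => nonlin (IccExtend T.2.le u t).coeff

lemma isSolution_coeff {β η s : ℝ} {T : PosTime} {φ : Hs s} {u : Curve s T}
    (h : IsSolution β η φ u) (t : Icc (0 : ℝ) T.1) (k : ℤ) :
    (u t).coeff k = Complex.exp ((t.1 : ℂ) * symbol β η k) * φ.coeff k -
      duh β η 0 (curveForcing u) t k := (h.2 t k).2

lemma curveForcing_eq {s : ℝ} {T : PosTime} {u : Curve s T} {t : ℝ} (ht : t ∈ Icc 0 T.1)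
    {F : Hs 0} (hF : F.coeff = (u ⟨t, ht⟩).coeff) :
    curveForcing u t = bilin F.coeff F.coeff := by
  rw [curveForcing, IccExtend_of_mem _ _ ht, ← hF]
  rfl

lemma intervalIntegrable_curveForcing {β η s : ℝ} {T : PosTime} {φ : Hs s} {u : Curve s T}
    (h : IsSolution β η φ u) (t : Icc (0 : ℝ) T.1) (k : ℤ) :
    IntervalIntegrable (fun t' => curveForcing u t' k) volume 0 t := by
  have h1 := (h.2 t k).1
  have h2 : IntervalIntegrable (fun t' : ℝ =>
      Complex.exp (((t' - t.1 : ℝ) : ℂ) * symbol β η k) * duhamelIntegrand β η u t.1 k t')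
      volume 0 t := h1.continuousOn_mul (by fun_prop)
  convert! h2 using 2 with t'
  unfold duhamelIntegrand
  rw [← mul_assoc, ← Complex.exp_add]
  have : ((t' - t.1 : ℝ) : ℂ) * symbol β η k + ((t.1 - t' : ℝ) : ℂ) * symbol β η k = 0 := by
    push_cast; ring
  rw [this, Complex.exp_zero, one_mul]
  rfl

lemma continuous_coeff_extend {s : ℝ} {T : PosTime} (u : Curve s T) (k : ℤ) :
    Continuous fun t => (IccExtend T.2.le u t).coeff k :=
  (Hs.continuous_coeff k).comp u.continuous.Icc_extend'

/-- The solutions on a shorter time interval are the restrictions. -/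
lemma ev_flow_restrict {T T' : ℝ} (hT : 0 < T) (hT' : 0 < T') (hTT : T' ≤ T) (φ : Hs P.s)
    {t : ℝ} (ht : t ∈ Ioc 0 T') : P.ev T' (P.flow hT' φ) t = P.ev T (P.flow hT φ) t := by
  have hsub : Ioc 0 T' ⊆ Ioc 0 T := Ioc_subset_Ioc_right hTT
  refine P.ev_flow_eq_of_mild hT' (norm_nonneg (P.flow hT φ))
    (fun k => (P.continuousOn_coeff_ev _ k).mono hsub) (fun t ht => ?_) (fun t ht k => ?_) ht
  · simpa using P.norm_ev_le (P.flow hT φ) (hsub ht)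
  · exact P.coeff_of_eq (P.flow_eq hT φ) (hsub ht) k

variable {P}

/-- A solution that is `O(t^{-σ/2})` in `L²(𝕋)` is given by the solution operator. -/
lemma coeff_eq_of_bound {T : PosTime} {φ : Hs P.s} {u : Curve P.s T}
    (h : IsSolution P.β P.η φ u) {F : ℝ → Hs 0} {A : ℝ} (hA : 0 ≤ A)
    (hF : ∀ t (ht : t ∈ Ioc 0 T.1), (F t).coeff = (u ⟨t, Ioc_subset_Icc_self ht⟩).coeff)
    (hb : ∀ t ∈ Ioc 0 T.1, ‖F t‖ ≤ A * t ^ (-(P.σ / 2))) {t : ℝ} (ht : t ∈ Ioc 0 T.1) :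
    (u ⟨t, Ioc_subset_Icc_self ht⟩).coeff = P.solCoeff T.2 φ t := by
  rw [← P.coeff_ev_flow T.2 φ ht, ← hF t ht]
  congr 1
  symm
  refine P.ev_flow_eq_of_mild T.2 hA (fun k => ?_) hb (fun t ht k => ?_) ht
  · refine (continuous_coeff_extend u k).continuousOn.congr fun t ht => ?_
    change (F t).coeff k = (IccExtend T.2.le u t).coeff k
    rw [IccExtend_of_mem _ _ (Ioc_subset_Icc_self ht), hF t ht]
  · rw [hF t ht, isSolution_coeff h]
    congr 1
    refine duh_congr ht.1.le fun t' ht' => ?_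
    have ht2 : t' ∈ Ioc 0 T.1 := ⟨ht'.1, ht'.2.trans ht.2⟩
    rw [curveForcing_eq (Ioc_subset_Icc_self ht2) (hF t' ht2)]
    rfl

/-- Uniqueness in `𝔛_T^s`, for `s < 0`. -/
lemma coeff_eq_of_xSpace {T : PosTime} (hσ : P.σ = |P.s|) {φ : Hs P.s} {u : Curve P.s T}
    (h : IsSolution P.β P.η φ u) (v : XSpace P.s T) (hv : v.toCurve = u) {t : ℝ}
    (ht : t ∈ Ioc 0 T.1) : (u ⟨t, Ioc_subset_Icc_self ht⟩).coeff = P.solCoeff T.2 φ t := by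
  classical
  have hF : ∀ t (ht : t ∈ Ioc 0 T.1),
      (if h : t ∈ Ioc 0 T.1 then v.1.2 ⟨t, h⟩ else 0 : Hs 0) = v.1.2 ⟨t, ht⟩ := fun t ht =>
    dif_pos ht
  refine coeff_eq_of_bound h (F := fun t => if h : t ∈ Ioc 0 T.1 then v.1.2 ⟨t, h⟩ else 0)
    (norm_nonneg v) (fun t ht => ?_) (fun t ht => ?_) ht
  · simp only [hF t ht]
    rw [← hv]
    exact v.2.1 ⟨t, ht⟩
  · simp only [hF t ht]
    have h1 : ‖xPair P.s T v.1 ⟨t, ht⟩‖ ≤ ‖v‖ :=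
      lp.norm_apply_le_norm ENNReal.top_ne_zero (XSpace.toLp P.s T v) ⟨t, ht⟩
    have h2 := (WithLp.norm_snd_le _ _).trans h1
    change ‖t ^ (|P.s| / 2) • v.1.2 ⟨t, ht⟩‖ ≤ ‖v‖ at h2
    rw [norm_smul, Real.norm_of_nonneg (Real.rpow_nonneg ht.1.le _)] at h2
    rw [Real.rpow_neg ht.1.le, ← div_eq_mul_inv, le_div_iff₀ (Real.rpow_pos_of_pos ht.1 _), hσ]
    linarith

/-- Uniqueness in `C([0,T]; H^s(𝕋))`, for `s ≥ 0`. -/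
lemma coeff_eq_of_nonneg {T : PosTime} (hs : 0 ≤ P.s) (hσ : P.σ = 0) {φ : Hs P.s}
    {u : Curve P.s T} (h : IsSolution P.β P.η φ u) {t : ℝ}
    (ht : t ∈ Ioc 0 T.1) : (u ⟨t, Ioc_subset_Icc_self ht⟩).coeff = P.solCoeff T.2 φ t := by
  have hdom : ∀ (f : Hs P.s) k, ‖f.coeff k‖ ≤ ‖(f.shift 0).coeff k‖ := fun f k => by
    rw [Hs.norm_coeff_shift]
    have h1 : 1 ≤ wt (P.s - 0) k := by rw [← wt_zero k]; exact wt_mono (by linarith) k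
    exact le_mul_of_one_le_left (norm_nonneg _) h1
  have hmem : ∀ f : Hs P.s, f.coeff ∈ hsSubmodule 0 := fun f =>
    mem_hsSubmodule_of_dominated f.coeff_neg (f.shift 0) (hdom f)
  have hle : ∀ f : Hs P.s, ‖Hs.mk f.coeff (hmem f)‖ ≤ ‖f‖ := fun f =>
    (Hs.norm_le_of_dominated (Hs.mk f.coeff (hmem f)) (f.shift 0) fun k => by
      rw [Hs.coeff_mk]; exact hdom f k).trans (Hs.norm_shift 0 f).le
  refine coeff_eq_of_bound h (F := fun t => Hs.mk (IccExtend T.2.le u t).coeff (hmem _))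
    (norm_nonneg u) (fun t ht => ?_) (fun t ht => ?_) ht
  · rw [Hs.coeff_mk, IccExtend_of_mem _ _ (Ioc_subset_Icc_self ht)]
  · rw [hσ, zero_div, neg_zero, Real.rpow_zero, mul_one]
    exact (hle _).trans (u.norm_coe_le_norm _)

/-- Uniqueness in `C([0,T]; H^s(𝕋)) ∩ C((0,T); L²(𝕋))`. Shifted in time by `d > 0`, the solution
is bounded in `L²(𝕋)`, so it is given by the solution operator, whose continuity in the initial
value permits the limit `d → 0`. -/
lemma coeff_eq_of_continuousOn {T : PosTime} {φ : Hs P.s} {u : Curve P.s T}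
    (h : IsSolution P.β P.η φ u) {F : ℝ → Hs 0} (hFc : ContinuousOn F (Ioo 0 T.1))
    (hF : ∀ t (ht : t ∈ Ioo 0 T.1), (F t).coeff = (u ⟨t, Ioo_subset_Icc_self ht⟩).coeff) {t : ℝ}
    (ht : t ∈ Ioo 0 T.1) : (u ⟨t, Ioo_subset_Icc_self ht⟩).coeff = P.solCoeff T.2 φ t := by
  have hT := T.2
  set u' : ℝ → Hs P.s := IccExtend hT.le u with hu'
  have hu't : ∀ r (hr : r ∈ Icc 0 T.1), u' r = u ⟨r, hr⟩ := fun r hr => IccExtend_of_mem _ _ hr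
  -- both `u (d + ·)` and the flow started at `u d` solve the equation on `[0,t]`
  have hshift : ∀ d, 0 < d → d < T.1 - t → P.ev t (P.flow ht.1 (u' d)) t = F (t + d) := by
    intro d hd hdt
    have hsub : Icc d (t + d) ⊆ Ioo 0 T.1 := fun r hr => ⟨hd.trans_le hr.1, by linarith [hr.2]⟩
    have hin : ∀ r ∈ Ioc 0 t, r + d ∈ Icc d (t + d) := fun r hr =>
      ⟨by linarith [hr.1], by linarith [hr.2]⟩
    obtain ⟨A, hA⟩ := isCompact_Icc.exists_bound_of_continuousOn (hFc.mono hsub)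
    have hA0 : 0 ≤ A := (norm_nonneg _).trans (hA d ⟨le_rfl, by linarith [ht.1]⟩)
    refine P.ev_flow_eq_of_mild ht.1 (F := fun r => F (r + d)) (A := A * t ^ (P.σ / 2))
      (mul_nonneg hA0 (Real.rpow_nonneg ht.1.le _)) (fun k => ?_) (fun r hr => ?_)
      (fun r hr k => ?_) ⟨ht.1, le_rfl⟩
    · refine ((Hs.continuous_coeff k).comp_continuousOn hFc).comp
        (g := fun x => (F x).coeff k) (f := fun r => r + d) (by fun_prop) ?_
      exact fun r hr => hsub (hin r hr)
    · refine (hA _ (hin r hr)).trans ?_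
      rw [mul_assoc, Real.rpow_neg hr.1.le, ← div_eq_mul_inv, ← Real.div_rpow ht.1.le hr.1.le]
      refine le_mul_of_one_le_right hA0 (Real.one_le_rpow ?_ (by linarith [P.hσ]))
      rw [one_le_div hr.1]
      exact hr.2
    · have m1 := hsub (hin r hr)
      have m2 := hsub (left_mem_Icc.2 (by linarith [ht.1] : d ≤ t + d))
      have c1 := Ioo_subset_Icc_self m1
      have c2 := Ioo_subset_Icc_self m2
      have i1 := intervalIntegrable_curveForcing h ⟨d, c2⟩ k
      have i2 := intervalIntegrable_curveForcing h ⟨r + d, c1⟩ k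
      rw [hF _ m1, hu't d c2, isSolution_coeff h, isSolution_coeff h,
        duh_restart i1 (i1.symm.trans i2), mul_sub, ← mul_assoc, ← Complex.exp_add]
      have e1 : (r : ℂ) * symbol P.β P.η k + (d : ℂ) * symbol P.β P.η k =
          ((r + d : ℝ) : ℂ) * symbol P.β P.η k := by push_cast; ring
      have e2 : duh P.β P.η d (curveForcing u) (r + d) k =
          duh P.β P.η 0 (forcing (fun r => F (r + d)) (fun r => F (r + d))) r k := by
        have e3 : duh P.β P.η 0 (fun r => curveForcing u (r + d)) r k =
            duh P.β P.η d (curveForcing u) (r + d) k := by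
          unfold duh
          have := intervalIntegral.integral_comp_add_right (a := 0) (b := r) (fun t' =>
            Complex.exp (((r + d - t' : ℝ) : ℂ) * symbol P.β P.η k) * curveForcing u t' k) d
          rw [zero_add] at this
          rw [← this]
          congr 1
          funext t'
          congr 3
          push_cast; ring
        rw [← e3]
        refine duh_congr hr.1.le fun t' ht' => ?_
        have m3 := hsub (hin t' ⟨ht'.1, ht'.2.trans hr.2⟩)
        rw [curveForcing_eq (Ioo_subset_Icc_self m3) (hF _ m3)]
        rfl
      rw [e1, ← e2]
      have e4 : ((r + d - d : ℝ) : ℂ) = (r : ℂ) := by push_cast; ring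
      simp only [e4]
      ring
  have hφ : u' 0 = φ := by
    apply Hs.coeff_injective
    funext k
    rw [hu't 0 ⟨le_rfl, hT.le⟩, isSolution_coeff h]
    simp
  have hl1 : Filter.Tendsto (fun d => P.ev t (P.flow ht.1 (u' d)) t) (𝓝[>] 0)
      (𝓝 (P.ev t (P.flow ht.1 φ) t)) := by
    have c1 : Continuous fun d => P.ev t (P.flow ht.1 (u' d)) t := by
      have c2 : Continuous fun w : WSpace t => P.ev t w t := by
        have : (fun w : WSpace t => P.ev t w t) =
            fun w => t ^ (-(P.σ / 2)) • w ⟨t, ht.1, le_rfl⟩ :=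
          funext fun w => P.ev_apply w ⟨t, ht.1, le_rfl⟩
        rw [this]
        have c3 : Continuous fun w : WSpace t => w ⟨t, ht.1, le_rfl⟩ := continuous_eval_const _
        exact c3.const_smul (t ^ (-(P.σ / 2)))
      exact c2.comp ((P.contDiff_flow ht.1).continuous.comp u.continuous.Icc_extend')
    have := c1.tendsto 0
    rw [hφ] at this
    exact this.mono_left nhdsWithin_le_nhds
  have hl2 : Filter.Tendsto (fun d => F (t + d)) (𝓝[>] 0) (𝓝 (F t)) := by
    have c1 : ContinuousAt F t := hFc.continuousAt (Ioo_mem_nhds ht.1 ht.2)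
    have c2 : Filter.Tendsto (fun d : ℝ => t + d) (𝓝[>] 0) (𝓝 t) := by
      have : Continuous fun d : ℝ => t + d := by fun_prop
      have := this.tendsto 0
      rw [add_zero] at this
      exact this.mono_left nhdsWithin_le_nhds
    exact c1.tendsto.comp c2
  have heq : (fun d => P.ev t (P.flow ht.1 (u' d)) t) =ᶠ[𝓝[>] 0] fun d => F (t + d) := by
    filter_upwards [Ioo_mem_nhdsGT (show (0 : ℝ) < T.1 - t by linarith [ht.2])] with d hd
    exact hshift d hd.1 hd.2
  have hfin := tendsto_nhds_unique (hl1.congr' heq) hl2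
  rw [← hF t ht, ← hfin, P.ev_flow_restrict T.2 ht.1 ht.2.le φ ⟨ht.1, le_rfl⟩]
  exact P.coeff_ev_flow T.2 φ (Ioo_subset_Ioc_self ht)

/-- Solutions are determined by their values at the times in `(0,T)`. -/
lemma eq_of_coeff_eq {T : PosTime} {φ : Hs P.s} {u v : Curve P.s T}
    (hu : IsSolution P.β P.η φ u) (hv : IsSolution P.β P.η φ v)
    (h : ∀ t (ht : t ∈ Ioo 0 T.1),
      (v ⟨t, Ioo_subset_Icc_self ht⟩).coeff = (u ⟨t, Ioo_subset_Icc_self ht⟩).coeff) : v = u := by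
  ext1 t
  apply Hs.coeff_injective
  funext k
  rw [isSolution_coeff hu, isSolution_coeff hv]
  congr 1
  refine duh_congr_Ioo t.2.1 fun t' ht' => ?_
  have ht2 : t' ∈ Ioo 0 T.1 := ⟨ht'.1, ht'.2.trans_le t.2.2⟩
  rw [curveForcing, curveForcing, IccExtend_of_mem _ _ (Ioo_subset_Icc_self ht2),
    IccExtend_of_mem _ _ (Ioo_subset_Icc_self ht2), h t' ht2]

/-! ### Global well-posedness -/

lemma isSolution_of_coeff {T : PosTime} {φ : Hs P.s} {u : Curve P.s T}
    (hu : ∀ t, (u t).coeff = P.solCoeff T.2 φ t) : IsSolution P.β P.η φ u := by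
  have hev : ∀ t (ht : t ∈ Ioc 0 T.1), (P.ev T.1 (P.flow T.2 φ) t).coeff =
      (u ⟨t, Ioc_subset_Icc_self ht⟩).coeff := fun t ht => by
    rw [hu, P.coeff_ev_flow T.2 φ ht]
  have hN : ∀ t ∈ Ioc 0 T.1, curveForcing u t =
      forcing (P.ev T.1 (P.flow T.2 φ)) (P.ev T.1 (P.flow T.2 φ)) t := fun t ht =>
    curveForcing_eq (Ioc_subset_Icc_self ht) (hev t ht)
  refine ⟨fun t ht => ?_, fun t k => ⟨?_, ?_⟩⟩
  · rw [← hev t.1 (Ioo_subset_Ioc_self ht)]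
    exact Hs.coeff_mem _
  · have h1 := intervalIntegrable_duh (β := P.β) (η := P.η) (t := t.1)
      (P.intervalIntegrable_forcing (P.flow T.2 φ) t.2 k)
    refine h1.congr fun t' ht' => ?_
    rw [uIoc_of_le t.2.1] at ht'
    have ht2 : t' ∈ Ioc 0 T.1 := ⟨ht'.1, ht'.2.trans t.2.2⟩
    simp only [← hN t' ht2]
    rfl
  · change _ = _ - duh P.β P.η 0 (curveForcing u) t k
    rw [hu, solCoeff]
    congr 1
    exact duh_congr t.2.1 fun t' ht' => by rw [hN t' ⟨ht'.1, ht'.2.trans t.2.2⟩]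

/-- At positive times the flow map is smooth with values in every Sobolev space. -/
lemma exists_contDiff_flow (T : PosTime) (r : ℝ) {ε : ℝ} (hε : 0 < ε) (hεT : ε ≤ T.1) :
    ∃ Ψ : Hs P.s → C(Icc ε T.1, Hs r), ContDiff ℝ ∞ Ψ ∧
      ∀ φ t, (Ψ φ t).coeff = P.solCoeff T.2 φ t := by
  obtain ⟨Ψ, h1, h2⟩ := P.exists_contDiff_curve (P.contDiff_flow T.2) (χ := fun _ => 1)
    continuousOn_const (fun t _ => by rw [abs_one]) (y := P.flow T.2)
    (fun φ t => by rw [one_smul]) (φ := id) (P.flow_eq T.2) r hε hεT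
  refine ⟨Ψ, h1, fun φ t => ?_⟩
  rw [h2]
  exact P.coeff_ev_flow T.2 φ ⟨hε.trans_le t.2.1, t.2.2⟩

lemma solCoeff_mem (T : PosTime) (φ : Hs P.s) (r : ℝ) {t : ℝ} (ht : t ∈ Ioc 0 T.1) :
    P.solCoeff T.2 φ t ∈ hsSubmodule r := by
  obtain ⟨Ψ, -, hΨ⟩ := exists_contDiff_flow (P := P) T r ht.1 ht.2
  rw [← hΨ φ ⟨t, le_rfl, ht.2⟩]
  exact Hs.coeff_mem _

lemma continuous_solCoeff (T : PosTime) (φ : Hs P.s) (r : ℝ) :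
    Continuous fun t : Ioc 0 T.1 => Hs.mk (P.solCoeff T.2 φ t) (solCoeff_mem T φ r t.2) := by
  rw [continuous_iff_continuousAt]
  intro t₀
  have ht0 := t₀.2.1
  have hε : t₀.1 / 2 ≤ T.1 := by linarith [t₀.2.2]
  obtain ⟨Ψ, -, hΨ⟩ := exists_contDiff_flow (P := P) T r (half_pos ht0) hε
  have hc : Continuous fun t : Ioc 0 T.1 => IccExtend hε (Ψ φ) t.1 :=
    (Ψ φ).continuous.Icc_extend'.comp continuous_subtype_val
  refine hc.continuousAt.congr ?_
  have hev : ∀ᶠ t : Ioc 0 T.1 in 𝓝 t₀, t₀.1 / 2 < t.1 :=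
    continuous_subtype_val.continuousAt.eventually (lt_mem_nhds (half_lt_self ht0))
  filter_upwards [hev] with t ht
  apply Hs.coeff_injective
  rw [IccExtend_of_mem hε _ ⟨ht.le, t.2.2⟩, hΨ, Hs.coeff_mk]

lemma contHInfty_of_coeff {T : PosTime} {φ : Hs P.s} {u : Curve P.s T}
    (hu : ∀ t, (u t).coeff = P.solCoeff T.2 φ t) : ContHInfty (Ioc 0 T.1) u := by
  intro r
  refine ⟨⟨fun t => Hs.mk (P.solCoeff T.2 φ t.1.1) (solCoeff_mem T φ r t.2),
    (continuous_solCoeff T φ r).comp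
      (f := fun t : {t : Icc (0 : ℝ) T.1 // t.1 ∈ Ioc 0 T.1} => (⟨t.1.1, t.2⟩ : Ioc 0 T.1))
      (by fun_prop)⟩, fun t => ?_⟩
  rw [hu]
  exact Hs.coeff_mk _ _

/-- Global well-posedness with a smooth flow map. The hypothesis on `σ` matches the weight of
`𝔛_T^s` for `s < 0`, and means that there is no weight for `s ≥ 0`. -/
theorem smoothFlowOn_univ (hσ : P.σ = max 0 (-P.s)) (T : PosTime) :
    SmoothFlowOn P.β P.η P.s T univ := by
  have hneg : P.s < 0 → P.σ = |P.s| := fun hs => by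
    rw [hσ, abs_of_neg hs, max_eq_right (by linarith)]
  have hnonneg : 0 ≤ P.s → P.σ = 0 := fun hs => by rw [hσ, max_eq_left (by linarith)]
  obtain ⟨Φ, hΦ, hc⟩ : ∃ Φ : Hs P.s → Curve P.s T, ContDiff ℝ ∞ Φ ∧
      ∀ φ t, (Φ φ t).coeff = P.solCoeff T.2 φ t := by
    rcases lt_or_ge P.s 0 with hs | hs
    · exact P.exists_flowCurve_of_le_neg T.2 (by rw [hneg hs, abs_of_neg hs, neg_neg])
    · exact P.exists_flowCurve_of_nonneg T.2 hs (hnonneg hs)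
  have hX : P.s < 0 → ∃ Ψ : Hs P.s → XSpace P.s T,
      ContDiff ℝ ∞ Ψ ∧ ∀ φ, (Ψ φ).toCurve = Φ φ := by
    intro hs
    obtain ⟨Ψ, h1, h2⟩ := P.exists_flowX T (hneg hs) hs
    refine ⟨Ψ, h1, fun φ => ?_⟩
    ext1 t
    apply Hs.coeff_injective
    rw [h2, hc]
  refine ⟨Φ, fun φ _ => ?_, hΦ.contDiffOn, fun hs => ?_, fun ε r hε => ?_⟩
  · have hsol := isSolution_of_coeff (hc φ)
    refine ⟨hsol, contHInfty_of_coeff (hc φ), fun hs => ?_, fun v hv hcl => ?_⟩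
    · obtain ⟨Ψ, -, h2⟩ := hX hs
      exact ⟨Ψ φ, h2 φ⟩
    · refine eq_of_coeff_eq hsol hv fun t ht => ?_
      rw [hc]
      rcases lt_or_ge P.s 0 with hs | hs
      · rcases hcl with hcl | hcl
        · classical
          obtain ⟨w, hw⟩ := hcl 0
          have hF : ∀ t (ht : t ∈ Ioo 0 T.1),
              (if h : t ∈ Ioo 0 T.1 then w ⟨⟨t, Ioo_subset_Icc_self h⟩, h⟩ else 0 : Hs 0) =
                w ⟨⟨t, Ioo_subset_Icc_self ht⟩, ht⟩ := fun t ht => dif_pos ht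
          refine coeff_eq_of_continuousOn hv (F := fun t =>
            if h : t ∈ Ioo 0 T.1 then w ⟨⟨t, Ioo_subset_Icc_self h⟩, h⟩ else 0) ?_
            (fun t ht => ?_) ht
          · rw [continuousOn_iff_continuous_domRestrict]
            have : (Ioo 0 T.1).domRestrict (fun t => if h : t ∈ Ioo 0 T.1 then
                w ⟨⟨t, Ioo_subset_Icc_self h⟩, h⟩ else 0) =
                fun t : Ioo 0 T.1 => w ⟨⟨t, Ioo_subset_Icc_self t.2⟩, t.2⟩ :=
              funext fun t => hF t t.2
            rw [this]
            exact w.continuous.comp (by fun_prop)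
          · simp only [hF t ht]
            exact hw _
        · obtain ⟨v', hv'⟩ := hcl hs
          exact coeff_eq_of_xSpace (hneg hs) hv v' hv' (Ioo_subset_Ioc_self ht)
      · exact coeff_eq_of_nonneg hs (hnonneg hs) hv (Ioo_subset_Ioc_self ht)
  · obtain ⟨Ψ, h1, h2⟩ := hX hs
    exact ⟨Ψ, h1.contDiffOn, fun φ _ => h2 φ⟩
  · rcases le_or_gt ε T.1 with hεT | hεT
    · obtain ⟨Ψ, h1, h2⟩ := exists_contDiff_flow (P := P) T r hε hεT
      exact ⟨Ψ, h1.contDiffOn, fun φ _ t h h' => by rw [h2, hc]⟩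
    -- the interval `[ε,T]` is empty
    · exact ⟨fun _ => 0, contDiffOn_const, fun φ _ t h h' =>
        absurd (h'.1.trans h'.2) (not_le.2 hεT)⟩

end Params

end ChenLee

end


theorem theorem2 (β η s : ℝ) (hβ : 0 ≤ β) (hη : 0 < η) (hs : -1 / 2 < s) :
    (∀ φ : ChenLee.Hs s,
      sSup {τ : EReal | ∃ T : ChenLee.PosTime,
        τ = ((T.1 : ℝ) : EReal) ∧ ChenLee.LocalConclusions β η φ T} = ⊤) ∧
    ∀ T : ChenLee.PosTime, ChenLee.SmoothFlowOn β η s T Set.univ := by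
  have hflow : ∀ T : ChenLee.PosTime, ChenLee.SmoothFlowOn β η s T Set.univ := fun T =>
    ChenLee.Params.smoothFlowOn_univ
      (P := ⟨β, η, s, max 0 (-s), hη, le_max_left _ _, max_lt (by norm_num) (by linarith),
        by linarith [le_max_right 0 (-s)]⟩) rfl T
  refine ⟨fun φ => ?_, hflow⟩
  rw [EReal.eq_top_iff_forall_lt]
  intro y
  have hT : 0 < |y| + 1 := by positivity
  have hmem : ((|y| + 1 : ℝ) : EReal) ∈ {τ : EReal | ∃ T : ChenLee.PosTime,
      τ = ((T.1 : ℝ) : EReal) ∧ ChenLee.LocalConclusions β η φ T} :=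
    ⟨⟨|y| + 1, hT⟩, rfl, Set.univ, isOpen_univ, trivial, hflow _⟩
  refine lt_of_lt_of_le ?_ (le_sSup hmem)
  exact EReal.coe_lt_coe_iff.2 (by linarith [le_abs_self y])
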